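/- Let $k\ge 2$ and $0\le n\le 2k-2$ be integers, $\Gamma=\mathrm{SL}_2(\mathbb Z)$, $\mathbb H$ the upper half-plane, $\tau=u+iv\in\mathbb H$. Put $$H_{k,k-1}(z,\tau)=\sum_{M\in\Gamma} v^{2k-1}(z-\tau)^{-1}(z-\overline\tau)^{1-2k}\Big|_{2-2k,\tau}M ,\qquad \mathcal H_{1-k,n}(\tau)=\frac{(2i)^{2k-2}}{2\pi}\int_0^\infty H_{k,k-1}(iy,\tau)\,y^n\,dy ,$$ where $|_{2-2k,\tau}$ is the weight $2-2k$ slash operator in $\tau$, and the integral is a Cauchy principal value if $\tau\in\bigcup_{M\in\Gamma}M(i\mathbb R_+)$. Let $$\xi_{2-2k}f=2iv^{2-2k}\,\overline{\frac{\partial f}{\partial\overline\tau}},\qquad \mathcal D^{2k-1}=\Big(\frac1{2\pi i}\frac{\partial}{\partial\tau}\Big)^{2k-1},$$ let $E_{2k}$ be the Eisenstein series of weight $2k$ for $\Gamma$ normalized to have constant term $1$, and let $\langle f,g\rangle=\int_{\Gamma\backslash\mathbb H}f\,\overline g\,v^{2k}\frac{du\,dv}{v^2}$ be the Petersson inner product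 on the space $S_{2k}$ of cusp forms of weight $2k$ for $\Gamma$. There is a unique $R_n\in S_{2k}$ with $\langle f,R_n\rangle=\int_0^\infty f(iy)y^n\,dy$ for all $f\in S_{2k}$. For every $\tau\in\mathbb H\setminus\bigcup_{M\in\Gamma}M(i\mathbb R_+)$, the series $H_{k,k-1}(iy,\tau)$ (for each $y>0$) and the integral defining $\mathcal H_{1-k,n}(\tau)$ converge absolutely, $\mathcal H_{1-k,n}$ is smooth (in the real sense) at $\tau$, and $$\xi_{2-2k}\mathcal H_{1-k,n}(\tau)=-R_n(\tau),$$ $$\mathcal D^{2k-1}\mathcal H_{1-k,n}(\tau)=(-1)^{n+1}\frac{(2k-2)!}{(4\pi)^{2k-1}}R_n(\tau)-\big((-1)^k\delta_{n=0}+\delta_{n=2k-2}\big)\frac{(2k-2)!}{(2\pi)^{2k-1}}E_{2k}(\tau).$$ -/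

import Mathlib

open scoped MatrixGroups ModularForm UpperHalfPlane ComplexConjugate Topology ContDiff

noncomputable section

namespace PeriodMaass

/-- The summand of Petersson's Poincaré series: `v^(k+ℓ) (z - τ)^(ℓ-k) (z - conj τ)^(-ℓ-k)`,
slashed by `M` with weight `-2ℓ` in the variable `τ = u + iv`. -/
def poincareTerm (k l : ℤ) (z τ : ℍ) (M : SL(2, ℤ)) : ℂ :=
  ((fun w : ℍ => (w.im : ℂ) ^ (k + l) * ((z : ℂ) - (w : ℂ)) ^ (l - k)
    * ((z : ℂ) - conj (w : ℂ)) ^ (-l - k)) ∣[-2 * l] M) τ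

/-- Petersson's Poincaré series `H_{k,ℓ}(z, τ)`, a sum over all `M ∈ SL₂(ℤ)`. -/
def poincare (k l : ℤ) (z τ : ℍ) : ℂ := ∑' M : SL(2, ℤ), poincareTerm k l z τ M

/-- The point `iy` of the upper half-plane, for `y > 0`. -/
def imPoint (y : ℝ) : ℍ := UpperHalfPlane.ofComplex (Complex.I * (y : ℂ))

/-- The integrand `H_{k,k-1}(iy, τ) y^n`. -/
def curlyHIntegrand (k n : ℕ) (τ : ℍ) (y : ℝ) : ℂ :=
  poincare (k : ℤ) ((k : ℤ) - 1) (imPoint y) τ * (y : ℂ) ^ n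

/-- The set of `y > 0` such that `iy` has distance more than `ε` from every point of the orbit
`SL₂(ℤ) τ` lying on the positive imaginary axis (that is, from every pole of the integrand). If
no point of the orbit lies there, this is all of `(0, ∞)`. -/
def truncatedAxis (τ : ℍ) (ε : ℝ) : Set ℝ :=
  {y : ℝ | 0 < y ∧ ∀ M : SL(2, ℤ), (M • τ).re = 0 → ε < |y - (M • τ).im|}

/-- The function `𝓗_{1-k,n}(τ) = (2i)^(2k-2)/(2π) ∫₀^∞ H_{k,k-1}(iy,τ) y^n dy`. The integral is a
Cauchy principal value; when `τ` lies on no `SL₂(ℤ)`-translate of the positive imaginary axis,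
`truncatedAxis τ ε` is `(0, ∞)` for all `ε` and this is the ordinary integral. -/
def curlyH (k n : ℕ) (τ : ℍ) : ℂ :=
  (2 * Complex.I) ^ (2 * k - 2) / (2 * (Real.pi : ℂ)) *
    Filter.limUnder (𝓝[>] (0 : ℝ)) (fun ε : ℝ => ∫ y in truncatedAxis τ ε, curlyHIntegrand k n τ y)

/-- The union of the `SL₂(ℤ)`-translates of the positive imaginary axis. -/
def exceptionalSet : Set ℍ := ⋃ M : SL(2, ℤ), (fun w : ℍ => M • w) '' {w : ℍ | w.re = 0}

/-- The Wirtinger derivative `∂f/∂τ = (∂f/∂u - i ∂f/∂v) / 2`. -/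
def dTau (f : ℍ → ℂ) (τ : ℍ) : ℂ :=
  (1 / 2) * (fderiv ℝ (f ∘ UpperHalfPlane.ofComplex) (τ : ℂ) 1
    - Complex.I * fderiv ℝ (f ∘ UpperHalfPlane.ofComplex) (τ : ℂ) Complex.I)

/-- The Wirtinger derivative `∂f/∂(conj τ) = (∂f/∂u + i ∂f/∂v) / 2`. -/
def dTauBar (f : ℍ → ℂ) (τ : ℍ) : ℂ :=
  (1 / 2) * (fderiv ℝ (f ∘ UpperHalfPlane.ofComplex) (τ : ℂ) 1
    + Complex.I * fderiv ℝ (f ∘ UpperHalfPlane.ofComplex) (τ : ℂ) Complex.I)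

/-- The operator `ξ_κ f = 2 i v^κ conj (∂f/∂(conj τ))`. -/
def xiOp (κ : ℤ) (f : ℍ → ℂ) (τ : ℍ) : ℂ :=
  2 * Complex.I * (τ.im : ℂ) ^ κ * conj (dTauBar f τ)

/-- The operator `𝓓 f = (2πi)⁻¹ ∂f/∂τ`. -/
def dOp (f : ℍ → ℂ) (τ : ℍ) : ℂ := (1 / (2 * (Real.pi : ℂ) * Complex.I)) * dTau f τ

/-- The Petersson inner product `⟨f, g⟩ = ∫ f(τ) conj(g(τ)) v^(2k) du dv / v²` over the standard
fundamental domain of `SL₂(ℤ)`, for cusp forms of weight `2k` (linear in `f`). -/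
def peterssonInner (k : ℕ) (f g : CuspForm 𝒮ℒ (2 * (k : ℤ))) : ℂ :=
  ∫ τ in ModularGroup.fd, f τ * conj (g τ) * (τ.im : ℂ) ^ (2 * k)

/-- The `n`-th period `r_n(f) = ∫₀^∞ f(iy) y^n dy`. -/
def period (n : ℕ) (f : ℍ → ℂ) : ℂ :=
  ∫ y in Set.Ioi (0 : ℝ), f (imPoint y) * (y : ℂ) ^ n

/-- The property characterizing the cusp form `R_n`: `⟨f, R_n⟩ = r_n(f)` for all cusp forms `f`
of weight `2k`. -/
def RepresentsPeriod (k n : ℕ) (R : CuspForm 𝒮ℒ (2 * (k : ℤ))) : Prop :=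
  ∀ f : CuspForm 𝒮ℒ (2 * (k : ℤ)), peterssonInner k f R = period n f

end PeriodMaass

end

noncomputable section

namespace PeriodMaass

open Filter MeasureTheory

/-! ### Sums over `SL₂(ℤ)` -/

/-- The product of the squared Euclidean norms of the rows of a matrix in `SL₂(ℤ)`. -/
def rowWeight (M : SL(2, ℤ)) : ℝ :=
  ((M 0 0 : ℝ) ^ 2 + (M 0 1 : ℝ) ^ 2) * ((M 1 0 : ℝ) ^ 2 + (M 1 1 : ℝ) ^ 2)

lemma det_entries (M : SL(2, ℤ)) : M 0 0 * M 1 1 - M 0 1 * M 1 0 = 1 := by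
  have := M.det_coe
  rwa [Matrix.det_fin_two] at this

/-- Coordinates on `SL₂(ℤ)`: the first column, and the translation part on the right. -/
def columnCoord (M : SL(2, ℤ)) : ℤ × ℤ × ℤ :=
  (M 0 0, M 1 0, if M 1 0 = 0 then M 0 1 else M 1 1 / M 1 0)

lemma columnCoord_injective : Function.Injective columnCoord := by
  intro M N h
  simp only [columnCoord, Prod.mk.injEq] at h
  obtain ⟨h0, h1, h2⟩ := h
  have hM := det_entries M
  have hN := det_entries N
  rw [← h0, ← h1] at hN
  rw [← h1] at h2
  have key : M 0 1 = N 0 1 ∧ M 1 1 = N 1 1 := by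
    by_cases hc : M 1 0 = 0
    · simp only [hc, if_true] at h2 hM hN
      refine ⟨h2, ?_⟩
      have ha : M 0 0 ≠ 0 := by rintro h; simp [h] at hM
      apply mul_left_cancel₀ ha
      linarith
    · simp only [hc, if_false] at h2
      have e1 := Int.mul_ediv_add_emod (M 1 1) (M 1 0)
      have e2 := Int.mul_ediv_add_emod (N 1 1) (M 1 0)
      rw [← h2] at e2
      have hdvd : M 1 0 ∣ (M 1 1 - N 1 1) := by
        have hcop : IsCoprime (M 1 0) (M 0 0) := ⟨-M 0 1, M 1 1, by linarith⟩
        apply hcop.dvd_of_dvd_mul_left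
        exact ⟨M 0 1 - N 0 1, by linarith⟩
      have hd : M 1 1 = N 1 1 := by
        have : M 1 1 % M 1 0 = N 1 1 % M 1 0 := (Int.emod_emod_of_dvd _ dvd_rfl).symm.trans
          (by rw [Int.emod_emod_of_dvd _ dvd_rfl]; exact (Int.emod_emod_of_dvd _ dvd_rfl).symm.trans
                (by rw [Int.emod_emod_of_dvd _ dvd_rfl]
                    exact Int.emod_eq_emod_iff_emod_sub_eq_zero.mpr (Int.emod_eq_zero_of_dvd hdvd)))
        rw [← e1, ← e2, this]
      refine ⟨?_, hd⟩
      rw [← hd] at hN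
      apply mul_right_cancel₀ hc
      linarith
  ext i j
  fin_cases i <;> fin_cases j
  exacts [h0, key.1, h1, key.2]

lemma one_le_sq_add_sq_of_ne {a b : ℤ} (h : a ≠ 0 ∨ b ≠ 0) : (1 : ℝ) ≤ (a : ℝ) ^ 2 + (b : ℝ) ^ 2 := by
  have : (1 : ℤ) ≤ a ^ 2 + b ^ 2 := by
    rcases h with h | h
    · have := sq_nonneg b; have := pow_pos (abs_pos.mpr h) 2; rw [sq_abs] at this; linarith
    · have := sq_nonneg a; have := pow_pos (abs_pos.mpr h) 2; rw [sq_abs] at this; linarith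
  exact_mod_cast this

lemma row_zero_ne (M : SL(2, ℤ)) : M 0 0 ≠ 0 ∨ M 0 1 ≠ 0 := by
  by_contra! h
  have := det_entries M
  simp [h.1, h.2] at this

lemma row_one_ne (M : SL(2, ℤ)) : M 1 0 ≠ 0 ∨ M 1 1 ≠ 0 := by
  by_contra! h
  have := det_entries M
  simp [h.1, h.2] at this

lemma one_le_row_zero (M : SL(2, ℤ)) : (1 : ℝ) ≤ (M 0 0 : ℝ) ^ 2 + (M 0 1 : ℝ) ^ 2 :=
  one_le_sq_add_sq_of_ne (row_zero_ne M)

lemma one_le_row_one (M : SL(2, ℤ)) : (1 : ℝ) ≤ (M 1 0 : ℝ) ^ 2 + (M 1 1 : ℝ) ^ 2 :=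
  one_le_sq_add_sq_of_ne (row_one_ne M)

lemma one_le_rowWeight (M : SL(2, ℤ)) : 1 ≤ rowWeight M :=
  one_le_mul_of_one_le_of_one_le (one_le_row_zero M) (one_le_row_one M)

lemma rowWeight_pos (M : SL(2, ℤ)) : 0 < rowWeight M := one_pos.trans_le (one_le_rowWeight M)

lemma columnCoord_le_rowWeight (M : SL(2, ℤ)) :
    (1 + ((columnCoord M).1 : ℝ) ^ 2) * ((1 + ((columnCoord M).2.1 : ℝ) ^ 2) *
      (1 + ((columnCoord M).2.2 : ℝ) ^ 2)) ≤ 12 * rowWeight M := by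
  have hrow := one_le_row_zero M
  have hdet := det_entries M
  simp only [columnCoord, rowWeight]
  by_cases hc : M 1 0 = 0
  · simp only [hc, if_true, Int.cast_zero]
    rw [hc] at hdet
    have had : M 0 0 * M 1 1 = 1 := by linarith
    have ha : (M 0 0 : ℝ) ^ 2 = 1 := by
      rcases Int.eq_one_or_neg_one_of_mul_eq_one had with h | h <;> simp [h]
    have hd : (M 1 1 : ℝ) ^ 2 = 1 := by
      rw [mul_comm] at had
      rcases Int.eq_one_or_neg_one_of_mul_eq_one had with h | h <;> simp [h]
    rw [ha, hd]
    nlinarith [sq_nonneg (M 0 1 : ℝ)]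
  · simp only [hc, if_false]
    have hc1 : (1 : ℝ) ≤ (M 1 0 : ℝ) ^ 2 := by
      simpa using one_le_sq_add_sq_of_ne (a := M 1 0) (b := 0) (Or.inl hc)
    have e1 := Int.mul_ediv_add_emod (M 1 1) (M 1 0)
    have e2 : (M 1 1 % M 1 0) ^ 2 ≤ (M 1 0) ^ 2 := by
      have h1 := Int.emod_nonneg (M 1 1) hc
      have h2 := Int.emod_lt_abs (M 1 1) hc
      rw [← sq_abs (M 1 0)]
      nlinarith
    set m := M 1 1 / M 1 0
    set e := M 1 1 % M 1 0
    have e1' : (M 1 1 : ℝ) = (M 1 0 : ℝ) * m + e := by exact_mod_cast e1.symm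
    have e2' : (e : ℝ) ^ 2 ≤ (M 1 0 : ℝ) ^ 2 := by exact_mod_cast e2
    have h3 : (M 1 0 : ℝ) ^ 2 * (1 + (m : ℝ) ^ 2) ≤ 3 * ((M 1 0 : ℝ) ^ 2 + (M 1 1 : ℝ) ^ 2) := by
      have : (M 1 0 : ℝ) * m = M 1 1 - e := by linarith
      have h4 : ((M 1 0 : ℝ) * m) ^ 2 ≤ 2 * (M 1 1 : ℝ) ^ 2 + 2 * (M 1 0 : ℝ) ^ 2 := by
        rw [this]; nlinarith [sq_nonneg ((M 1 1 : ℝ) + e)]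
      nlinarith [sq_nonneg (M 1 1 : ℝ)]
    have h5 : 1 + (M 0 0 : ℝ) ^ 2 ≤ 2 * ((M 0 0 : ℝ) ^ 2 + (M 0 1 : ℝ) ^ 2) := by
      nlinarith [sq_nonneg (M 0 1 : ℝ)]
    have h6 : (1 + (M 1 0 : ℝ) ^ 2) * (1 + (m : ℝ) ^ 2)
        ≤ 6 * ((M 1 0 : ℝ) ^ 2 + (M 1 1 : ℝ) ^ 2) := by
      nlinarith [sq_nonneg (m : ℝ)]
    calc _ ≤ (2 * ((M 0 0 : ℝ) ^ 2 + (M 0 1 : ℝ) ^ 2)) *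
        (6 * ((M 1 0 : ℝ) ^ 2 + (M 1 1 : ℝ) ^ 2)) := by gcongr
      _ = _ := by ring

lemma summable_int_inv_one_add_sq : Summable (fun m : ℤ => (1 + (m : ℝ) ^ 2)⁻¹) := by
  have h : Summable (fun n : ℕ => (1 + (n : ℝ) ^ 2)⁻¹) := by
    refine Summable.of_norm_bounded_eventually_nat (g := fun n : ℕ => 1 / (n : ℝ) ^ 2)
      (Real.summable_one_div_nat_pow.mpr one_lt_two) ?_
    filter_upwards [eventually_gt_atTop 0] with n hn
    have : (0 : ℝ) < n := by exact_mod_cast hn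
    rw [Real.norm_of_nonneg (by positivity), one_div]
    gcongr
    linarith
  apply Summable.of_nat_of_neg
  · simpa using h
  · simpa using h

theorem summable_inv_rowWeight : Summable (fun M : SL(2, ℤ) => (rowWeight M)⁻¹) := by
  have h := summable_int_inv_one_add_sq
  have hn : ∀ m : ℤ, 0 ≤ (1 + (m : ℝ) ^ 2)⁻¹ := fun m => by positivity
  have h2 := h.mul_of_nonneg (h.mul_of_nonneg h hn hn) hn
    (fun x => mul_nonneg (hn _) (hn _))
  have h3 := (h2.comp_injective columnCoord_injective).mul_left 12
  refine Summable.of_nonneg_of_le (fun M => (inv_pos.mpr (rowWeight_pos M)).le) (fun M => ?_) h3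
  have h4 := columnCoord_le_rowWeight M
  simp only [Function.comp]
  rw [← mul_inv, ← mul_inv, ← div_eq_mul_inv, inv_eq_one_div, div_le_div_iff₀ (rowWeight_pos M)
    (by positivity)]
  linarith

/-- The sum of the inverses of the row weights, with the factor occurring in bounds on strips. -/
def rowConst : ℝ := 144 * ∑' M : SL(2, ℤ), (rowWeight M)⁻¹

lemma rowConst_nonneg : 0 ≤ rowConst :=
  mul_nonneg (by norm_num) (tsum_nonneg fun M => (inv_pos.mpr (rowWeight_pos M)).le)

/-! ### Linear forms attached to a matrix -/

/-- The numerator `pz + q` of the Möbius transformation of `M`. -/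
def nu (M : SL(2, ℤ)) (z : ℂ) : ℂ := M 0 0 * z + M 0 1

/-- The denominator `rz + s` of the Möbius transformation of `M`. -/
def de (M : SL(2, ℤ)) (z : ℂ) : ℂ := M 1 0 * z + M 1 1

lemma normSq_form (a b : ℤ) (z : ℂ) :
    ‖(a : ℂ) * z + b‖ ^ 2 = (a * z.re + b) ^ 2 + (a * z.im) ^ 2 := by
  rw [Complex.sq_norm, Complex.normSq_apply]
  simp
  ring

lemma form_ge_of_strip (a b : ℤ) {z : ℂ} (hre : |z.re| ≤ 1) (him : 1 / 2 ≤ z.im) :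
    ((a : ℝ) ^ 2 + (b : ℝ) ^ 2) / 12 ≤ ‖(a : ℂ) * z + b‖ ^ 2 := by
  rw [normSq_form]
  have h1 : z.re ^ 2 ≤ 1 := by
    rw [← sq_abs]; nlinarith [abs_nonneg z.re]
  have h2 : 1 / 4 ≤ z.im ^ 2 := by nlinarith
  have h3 : (a : ℝ) ^ 2 * z.re ^ 2 ≤ (a : ℝ) ^ 2 * 1 := by gcongr
  have h4 : (a : ℝ) ^ 2 * (1 / 4) ≤ (a : ℝ) ^ 2 * z.im ^ 2 := by gcongr
  nlinarith [sq_nonneg ((a : ℝ) * z.re + b), sq_nonneg (2 * ((a : ℝ) * z.re) + b),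
    sq_nonneg ((a : ℝ) * z.re + 2 * ((a : ℝ) * z.re + b))]

lemma one_le_form {a b : ℤ} (h : a ≠ 0 ∨ b ≠ 0) {z : ℂ} (hz : 1 ≤ z.im) :
    1 ≤ ‖(a : ℂ) * z + b‖ := by
  have : (1 : ℝ) ≤ ‖(a : ℂ) * z + b‖ ^ 2 := by
    rw [normSq_form]
    by_cases ha : a = 0
    · have := one_le_sq_add_sq_of_ne h
      simp only [ha, Int.cast_zero] at this ⊢
      nlinarith
    · have := one_le_sq_add_sq_of_ne (a := a) (b := 0) (Or.inl ha)
      simp only [Int.cast_zero] at this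
      have hz2 : 1 ≤ z.im ^ 2 := by nlinarith
      nlinarith [sq_nonneg ((a : ℝ) * z.re + b)]
  nlinarith [norm_nonneg ((a : ℂ) * z + b)]

lemma one_le_nu (M : SL(2, ℤ)) {z : ℂ} (hz : 1 ≤ z.im) : 1 ≤ ‖nu M z‖ :=
  one_le_form (row_zero_ne M) hz

lemma one_le_de (M : SL(2, ℤ)) {z : ℂ} (hz : 1 ≤ z.im) : 1 ≤ ‖de M z‖ :=
  one_le_form (row_one_ne M) hz

lemma form_ne_zero {a b : ℤ} (h : a ≠ 0 ∨ b ≠ 0) {z : ℂ} (hz : z.im ≠ 0) :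
    (a : ℂ) * z + b ≠ 0 := by
  intro h0
  have h1 := congrArg Complex.im h0
  have h2 := congrArg Complex.re h0
  simp at h1 h2
  have ha : a = 0 := by tauto
  simp [ha] at h2
  tauto

lemma nu_ne_zero (M : SL(2, ℤ)) {z : ℂ} (hz : z.im ≠ 0) : nu M z ≠ 0 :=
  form_ne_zero (row_zero_ne M) hz

lemma de_ne_zero (M : SL(2, ℤ)) {z : ℂ} (hz : z.im ≠ 0) : de M z ≠ 0 :=
  form_ne_zero (row_one_ne M) hz

lemma inv_forms_le (M : SL(2, ℤ)) {z : ℂ} (hre : |z.re| ≤ 1) (him : 1 / 2 ≤ z.im) :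
    (‖de M z‖ ^ 2 * ‖nu M z‖ ^ 2)⁻¹ ≤ 144 * (rowWeight M)⁻¹ := by
  have h1 := form_ge_of_strip (M 0 0) (M 0 1) hre him
  have h2 := form_ge_of_strip (M 1 0) (M 1 1) hre him
  have h3 := one_le_row_zero M
  have h4 := one_le_row_one M
  have : rowWeight M / 144 ≤ ‖de M z‖ ^ 2 * ‖nu M z‖ ^ 2 := by
    calc rowWeight M / 144 = (((M 1 0 : ℝ) ^ 2 + (M 1 1 : ℝ) ^ 2) / 12) *
          (((M 0 0 : ℝ) ^ 2 + (M 0 1 : ℝ) ^ 2) / 12) := by rw [rowWeight]; ring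
      _ ≤ _ := by unfold de nu; gcongr
  calc _ ≤ (rowWeight M / 144)⁻¹ := by
        have := rowWeight_pos M
        gcongr
    _ = _ := by rw [inv_div]; ring

/-! ### Exponential decay of periodic functions -/

theorem norm_le_exp_of_periodic {f : ℂ → ℂ} {Y C : ℝ} (hf : Function.Periodic f 1)
    (hd : ∀ z : ℂ, Y < z.im → DifferentiableAt ℂ f z) (hb : ∀ z : ℂ, Y < z.im → ‖f z‖ ≤ C)
    (h0 : ZeroAtFilter (comap Complex.im atTop) f) {z : ℂ} (hz : Y < z.im) :
    ‖f z‖ ≤ C * Real.exp (-2 * Real.pi * (z.im - Y)) := by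
  have hf' : Function.Periodic f ((1 : ℝ) : ℂ) := by simpa using hf
  have hC : 0 ≤ C := (norm_nonneg _).trans (hb z hz)
  set F := Function.Periodic.cuspFunction 1 f
  set R := Real.exp (-2 * Real.pi * Y)
  have hF0 : F 0 = 0 := Function.Periodic.cuspFunction_zero_of_zero_at_inf one_pos h0
  have hev : ∀ᶠ z in comap Complex.im atTop, Y < z.im :=
    tendsto_comap.eventually (eventually_gt_atTop Y)
  have hlt : ∀ w : ℂ, ‖Function.Periodic.qParam 1 w‖ < R ↔ Y < w.im := by
    intro w
    have := Function.Periodic.norm_qParam_lt_iff (h := 1) one_pos Y w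
    simpa [R] using this
  have hdF : DifferentiableOn ℂ F (Metric.ball 0 R) := by
    intro q hq
    by_cases hq0 : q = 0
    · rw [hq0]
      exact (Function.Periodic.differentiableAt_cuspFunction_zero one_pos hf' (hev.mono hd)
        h0.boundedAtFilter).differentiableWithinAt
    · rw [← Function.Periodic.qParam_right_inv one_ne_zero hq0]
      refine (Function.Periodic.differentiableAt_cuspFunction one_ne_zero hf'
        (hd _ ?_)).differentiableWithinAt
      rw [← hlt, Function.Periodic.qParam_right_inv one_ne_zero hq0]
      simpa using hq
  have hmaps : Set.MapsTo F (Metric.ball 0 R) (Metric.closedBall (F 0) C) := by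
    intro q hq
    rw [hF0, mem_closedBall_zero_iff]
    by_cases hq0 : q = 0
    · rw [hq0, hF0, norm_zero]; exact hC
    · have hq1 := Function.Periodic.qParam_right_inv one_ne_zero hq0
      rw [← hq1, show F _ = _ from Function.Periodic.eq_cuspFunction one_ne_zero hf' _]
      apply hb
      rw [← hlt, hq1]
      simpa using hq
  have hzq : Function.Periodic.qParam 1 z ∈ Metric.ball (0 : ℂ) R := by
    rw [mem_ball_zero_iff, hlt]; exact hz
  have := Complex.dist_le_div_mul_dist_of_mapsTo_ball hdF hmaps hzq
  rw [hF0, dist_zero_right, dist_zero_right,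
    show F _ = _ from Function.Periodic.eq_cuspFunction one_ne_zero hf' _,
    Function.Periodic.norm_qParam] at this
  refine this.trans_eq ?_
  rw [div_mul_eq_mul_div, mul_div_assoc, ← Real.exp_sub]
  congr 2
  ring

/-- Every complex number has an integer translate in the strip `|Re z| ≤ 1/2`. -/
lemma exists_int_abs_re_le (z : ℂ) : ∃ m : ℤ, |(z + m).re| ≤ 1 / 2 := by
  refine ⟨-round z.re, ?_⟩
  simpa [← sub_eq_add_neg] using abs_sub_round z.re

/-- The abstract form of exponential decay of a Poincaré series at `i∞`. -/
theorem poincare_series_decay {t : SL(2, ℤ) → ℂ → ℂ} {Y C : ℝ} (hY : 1 / 2 ≤ Y)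
    (hT : ∀ M z, t M (z + 1) = t (M * ModularGroup.T) z)
    (hd : ∀ M (z : ℂ), Y < z.im → DifferentiableAt ℂ (t M) z)
    (hb : ∀ M (z : ℂ), Y ≤ z.im → ‖t M z‖ ≤ C * (‖de M z‖ ^ 2 * ‖nu M z‖ ^ 2)⁻¹) {z : ℂ}
    (hz : Y ≤ z.im) :
    Summable (fun M => ‖t M z‖) ∧
      ‖∑' M, t M z‖ ≤ C * rowConst * Real.exp (-2 * Real.pi * (z.im - Y)) := by
  set f : ℂ → ℂ := fun z => ∑' M, t M z
  have hC : 0 ≤ C := by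
    have h := hb 1 (⟨0, Y⟩) le_rfl
    have hpos : 0 < (‖de 1 (⟨0, Y⟩ : ℂ)‖ ^ 2 * ‖nu 1 (⟨0, Y⟩ : ℂ)‖ ^ 2)⁻¹ := by
      have hne : (⟨0, Y⟩ : ℂ).im ≠ 0 := by simp; linarith
      have := norm_pos_iff.mpr (de_ne_zero 1 hne)
      have := norm_pos_iff.mpr (nu_ne_zero 1 hne)
      positivity
    by_contra! hlt
    have := (norm_nonneg _).trans h
    nlinarith
  have hper : Function.Periodic f 1 := by
    intro z
    simp only [f]
    simp_rw [hT]
    exact (Equiv.mulRight ModularGroup.T).tsum_eq (fun M => t M z)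
  have hT' : ∀ (m : ℤ) (z : ℂ) M, t M (z + m) = t (M * ModularGroup.T ^ m) z := by
    intro m
    induction m with
    | zero => simp
    | succ n ih =>
      intro z M
      rw [Int.cast_add, Int.cast_one, ← add_assoc, hT, ih, mul_assoc, ← zpow_one_add, add_comm 1]
    | pred n ih =>
      intro z M
      have h1 := hT (M * ModularGroup.T⁻¹) (z + ((-n - 1 : ℤ) : ℂ))
      rw [inv_mul_cancel_right] at h1
      rw [← h1, add_assoc]
      have : (((-n - 1 : ℤ) : ℂ)) + 1 = ((-n : ℤ) : ℂ) := by push_cast; ring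
      rw [this, ih, mul_assoc, ← zpow_neg_one, ← zpow_add]
      congr 3
      ring
  have hstrip : ∀ M (z : ℂ), Y ≤ z.im → |z.re| ≤ 1 →
      ‖t M z‖ ≤ C * (144 * (rowWeight M)⁻¹) := fun M z h1 h2 =>
    (hb M z h1).trans (mul_le_mul_of_nonneg_left (inv_forms_le M h2 (hY.trans h1)) hC)
  have hsum0 : Summable fun M => C * (144 * (rowWeight M)⁻¹) :=
    (summable_inv_rowWeight.mul_left 144).mul_left C
  have hsum1 : ∑' M, C * (144 * (rowWeight M)⁻¹) = C * rowConst := by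
    rw [tsum_mul_left, tsum_mul_left, rowConst]
  have hfm : ∀ (m : ℤ) (z : ℂ), f (z + m) = f z := by
    intro m z
    have := hper.int_mul m z
    simpa using this
  have hbd : ∀ z : ℂ, Y ≤ z.im → ‖f z‖ ≤ C * rowConst := by
    intro z hz
    obtain ⟨m, hm⟩ := exists_int_abs_re_le z
    rw [← hfm m z, ← hsum1]
    exact tsum_of_norm_bounded hsum0.hasSum fun M => hstrip M _ (by simpa using hz) (hm.trans (by norm_num))
  have hsm : Summable (fun M => ‖t M z‖) := by
    obtain ⟨m, hm⟩ := exists_int_abs_re_le z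
    have h1 : Summable (fun M => ‖t M (z + m)‖) :=
      Summable.of_nonneg_of_le (fun M => norm_nonneg _)
        (fun M => hstrip M _ (by simpa using hz) (hm.trans (by norm_num))) hsum0
    simp_rw [hT'] at h1
    exact (Equiv.mulRight (ModularGroup.T ^ m)).summable_iff.mp h1
  refine ⟨hsm, ?_⟩
  rcases hz.eq_or_lt with hz | hz
  · simpa [← hz] using hbd z hz.le
  have hdiff : ∀ z : ℂ, Y < z.im → DifferentiableAt ℂ f z := by
    intro z hz
    obtain ⟨m, hm⟩ := exists_int_abs_re_le z
    let U : Set ℂ := {w | Y < w.im ∧ |w.re| < 1}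
    have hU : IsOpen U := (isOpen_lt continuous_const Complex.continuous_im).inter
      (isOpen_lt (continuous_abs.comp Complex.continuous_re) continuous_const)
    have h1 := Complex.differentiableOn_tsum_of_summable_norm hsum0
      (fun M w hw => (hd M w hw.1).differentiableWithinAt) hU
      (fun M w hw => hstrip M w hw.1.le hw.2.le)
    have h2 : DifferentiableAt ℂ f (z + m) :=
      h1.differentiableAt (hU.mem_nhds ⟨by simpa using hz, by linarith⟩)
    have h3 : f = fun w => f (w + m) := funext fun w => (hfm m w).symm
    rw [h3]
    exact DifferentiableAt.comp (g := f) (f := fun w : ℂ => w + m) z h2 (by fun_prop)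
  have hzero : ZeroAtFilter (comap Complex.im atTop) f := by
    choose m hm using exists_int_abs_re_le
    have h1 : f = fun z => ∑' M, t M (z + m z) := funext fun z => (hfm (m z) z).symm
    have h2 : (0 : ℂ) = ∑' _ : SL(2, ℤ), (0 : ℂ) := by simp
    rw [ZeroAtFilter, h1, h2]
    have hev : ∀ Z : ℝ, ∀ᶠ z in comap Complex.im atTop, Z ≤ z.im := fun Z =>
      tendsto_comap.eventually (eventually_ge_atTop Z)
    refine tendsto_tsum_of_dominated_convergence hsum0 (fun M => ?_) ?_
    · rw [tendsto_zero_iff_norm_tendsto_zero]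
      have h3 : Tendsto (fun z : ℂ => C * (z.im ^ 2)⁻¹) (comap Complex.im atTop) (𝓝 0) := by
        have h4 : Tendsto (fun y : ℝ => C * (y ^ 2)⁻¹) atTop (𝓝 (C * 0)) :=
          ((tendsto_pow_atTop two_ne_zero).inv_tendsto_atTop).const_mul C
        rw [mul_zero] at h4
        exact h4.comp tendsto_comap
      refine squeeze_zero' (Eventually.of_forall fun z => norm_nonneg _) ?_ h3
      filter_upwards [hev Y, hev 1] with z hz1 hz2
      have hz1' : Y ≤ (z + m z).im := by simpa using hz1
      have hz2' : 1 ≤ (z + m z).im := by simpa using hz2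
      refine (hb M _ hz1').trans (mul_le_mul_of_nonneg_left (inv_anti₀ (by positivity) ?_) hC)
      have him : z.im = (z + m z).im := by simp
      have hd1 := one_le_pow₀ (n := 2) (one_le_de M hz2')
      have hn1 := one_le_pow₀ (n := 2) (one_le_nu M hz2')
      rw [him]
      by_cases hr : M 1 0 = 0
      · have hp : M 0 0 ≠ 0 := by
          intro hp
          have := det_entries M
          simp [hr, hp] at this
        have hp1 : (1 : ℝ) ≤ (M 0 0 : ℝ) ^ 2 := by
          simpa using one_le_sq_add_sq_of_ne (a := M 0 0) (b := 0) (Or.inl hp)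
        have h5 : (z + m z).im ^ 2 ≤ ‖nu M (z + m z)‖ ^ 2 := by
          rw [nu, normSq_form]
          nlinarith [sq_nonneg ((M 0 0 : ℝ) * (z + m z).re + M 0 1), sq_nonneg (z + m z).im]
        exact h5.trans (le_mul_of_one_le_left (by positivity) hd1)
      · have hp1 : (1 : ℝ) ≤ (M 1 0 : ℝ) ^ 2 := by
          simpa using one_le_sq_add_sq_of_ne (a := M 1 0) (b := 0) (Or.inl hr)
        have h5 : (z + m z).im ^ 2 ≤ ‖de M (z + m z)‖ ^ 2 := by
          rw [de, normSq_form]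
          nlinarith [sq_nonneg ((M 1 0 : ℝ) * (z + m z).re + M 1 1), sq_nonneg (z + m z).im]
        exact h5.trans (le_mul_of_one_le_right (by positivity) hn1)
    · filter_upwards [hev Y] with z hz M
      exact hstrip M _ (by simpa using hz) ((hm z).trans (by norm_num))
  exact norm_le_exp_of_periodic hper hdiff (fun z hz => hbd z hz.le) hzero hz

/-! ### Holomorphic dependence of integrals on parameters -/

/-- A family of functions holomorphic on `U` and locally dominated by an integrable function. -/
structure LocallyDominated {α : Type*} [MeasurableSpace α] (μ : Measure α) (U : Set ℂ)
    (F : α → ℂ → ℂ) : Prop where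
  measurable : ∀ a ∈ U, AEStronglyMeasurable (fun x => F x a) μ
  differentiable : ∀ᵐ x ∂μ, DifferentiableOn ℂ (F x) U
  bound : ∀ a ∈ U, ∃ ε > 0, Metric.ball a ε ⊆ U ∧ ∃ b : α → ℝ, Integrable b μ ∧
    ∀ᵐ x ∂μ, ∀ a' ∈ Metric.ball a ε, ‖F x a'‖ ≤ b x

namespace LocallyDominated

variable {α : Type*} [MeasurableSpace α] {μ : Measure α} {U : Set ℂ} {F : α → ℂ → ℂ}

lemma isOpen (h : LocallyDominated μ U F) : IsOpen U := by
  rw [Metric.isOpen_iff]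
  intro a ha
  obtain ⟨ε, hε, hsub, -⟩ := h.bound a ha
  exact ⟨ε, hε, hsub⟩

lemma integrable (h : LocallyDominated μ U F) {a : ℂ} (ha : a ∈ U) :
    Integrable (fun x => F x a) μ := by
  obtain ⟨ε, hε, hsub, b, hb, hF⟩ := h.bound a ha
  refine hb.mono' (h.measurable a ha) ?_
  filter_upwards [hF] with x hx
  exact hx a (Metric.mem_ball_self hε)

lemma deriv (h : LocallyDominated μ U F) : LocallyDominated μ U (fun x => deriv (F x)) := by
  refine ⟨fun a ha => ?_, ?_, fun a ha => ?_⟩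
  · obtain ⟨ε, hε, hsub, -⟩ := h.bound a ha
    have hlim : Tendsto (fun n : ℕ => a + ((ε / (n + 2) : ℝ) : ℂ)) atTop (𝓝[≠] a) := by
      rw [tendsto_nhdsWithin_iff]
      constructor
      · have h1 : Tendsto (fun n : ℕ => ε / ((n : ℝ) + 2)) atTop (𝓝 0) :=
          tendsto_const_nhds.div_atTop
            (tendsto_atTop_add_const_right _ _ tendsto_natCast_atTop_atTop)
        have h2 := (Complex.continuous_ofReal.tendsto 0).comp h1
        simpa using h2.const_add a
      · refine Eventually.of_forall fun n => ?_
        have : ε / ((n : ℝ) + 2) ≠ 0 := by positivity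
        simpa using Complex.ofReal_ne_zero.mpr this
    refine aestronglyMeasurable_of_tendsto_ae atTop
      (f := fun (n : ℕ) x => slope (F x) a (a + ((ε / (n + 2) : ℝ) : ℂ))) (fun n => ?_) ?_
    · have hmem : a + ((ε / (n + 2) : ℝ) : ℂ) ∈ U := by
        apply hsub
        rw [Metric.mem_ball, dist_self_add_left, Complex.norm_real,
          Real.norm_of_nonneg (by positivity), div_lt_iff₀ (by positivity)]
        nlinarith [(Nat.cast_nonneg n : (0 : ℝ) ≤ n)]
      simp only [slope, vsub_eq_sub]
      simp only [smul_eq_mul]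
      exact ((h.measurable _ hmem).sub (h.measurable _ ha)).const_mul _
    · filter_upwards [h.differentiable] with x hx
      have := (hx.differentiableAt (h.isOpen.mem_nhds ha)).hasDerivAt
      exact (hasDerivAt_iff_tendsto_slope.mp this).comp hlim
  · filter_upwards [h.differentiable] with x hx
    exact hx.deriv h.isOpen
  · obtain ⟨ε, hε, hsub, b, hb, hF⟩ := h.bound a ha
    refine ⟨ε / 2, by positivity, (Metric.ball_subset_ball (by linarith)).trans hsub,
      fun x => b x / (ε / 3), hb.div_const _, ?_⟩
    filter_upwards [h.differentiable, hF] with x hx hFx a' ha'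
    have hball : Metric.closedBall a' (ε / 3) ⊆ Metric.ball a ε := by
      intro w hw
      rw [Metric.mem_ball] at ha' ⊢
      rw [Metric.mem_closedBall] at hw
      linarith [dist_triangle w a' a]
    refine Complex.norm_deriv_le_of_forall_mem_sphere_norm_le (by positivity) ?_ ?_
    · exact (hx.mono (hball.trans hsub)).diffContOnCl_ball subset_rfl
    · exact fun z hz => hFx z (hball (Metric.sphere_subset_closedBall hz))

lemma hasDerivAt_integral (h : LocallyDominated μ U F) {a : ℂ} (ha : a ∈ U) :
    HasDerivAt (fun a => ∫ x, F x a ∂μ) (∫ x, _root_.deriv (F x) a ∂μ) a := by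
  obtain ⟨ε, hε, hsub, b, hb, hF⟩ := h.deriv.bound a ha
  refine (hasDerivAt_integral_of_dominated_loc_of_deriv_le (Metric.ball_mem_nhds a hε) ?_
    (h.integrable ha) (h.deriv.measurable a ha) hF hb ?_).2
  · filter_upwards [h.isOpen.mem_nhds ha] with a' ha' using h.measurable a' ha'
  · filter_upwards [h.differentiable] with x hx a' ha'
    exact (hx.differentiableAt (h.isOpen.mem_nhds (hsub ha'))).hasDerivAt

lemma differentiableOn_integral (h : LocallyDominated μ U F) :
    DifferentiableOn ℂ (fun a => ∫ x, F x a ∂μ) U := fun _ ha =>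
  (h.hasDerivAt_integral ha).differentiableAt.differentiableWithinAt

lemma iteratedDeriv (h : LocallyDominated μ U F) (m : ℕ) :
    LocallyDominated μ U (fun x => iteratedDeriv m (F x)) := by
  induction m with
  | zero => simpa using h
  | succ m ih => simpa only [iteratedDeriv_succ] using ih.deriv

lemma iteratedDeriv_integral (h : LocallyDominated μ U F) (m : ℕ) {a : ℂ} (ha : a ∈ U) :
    _root_.iteratedDeriv m (fun a => ∫ x, F x a ∂μ) a = ∫ x, _root_.iteratedDeriv m (F x) a ∂μ := by
  induction m generalizing a with
  | zero => simp
  | succ m ih =>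
    simp only [iteratedDeriv_succ]
    rw [← ((h.iteratedDeriv m).hasDerivAt_integral ha).deriv]
    apply EventuallyEq.deriv_eq
    filter_upwards [h.isOpen.mem_nhds ha] with a' ha' using ih ha'

end LocallyDominated

section Sums

variable {ι : Type*} {U : Set ℂ} {F : ι → ℂ → ℂ}

/-- A family of holomorphic functions locally dominated by a summable family. -/
def SummablyDominated (U : Set ℂ) (F : ι → ℂ → ℂ) : Prop :=
  (∀ i, DifferentiableOn ℂ (F i) U) ∧
    ∀ a ∈ U, ∃ ε > 0, Metric.ball a ε ⊆ U ∧ ∃ b : ι → ℝ, Summable b ∧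
      ∀ i, ∀ a' ∈ Metric.ball a ε, ‖F i a'‖ ≤ b i

lemma SummablyDominated.summable (h : SummablyDominated U F) {a : ℂ} (ha : a ∈ U) :
    Summable (fun i => F i a) := by
  obtain ⟨ε, hε, hsub, b, hb, hF⟩ := h.2 a ha
  exact Summable.of_norm_bounded hb fun i => hF i a (Metric.mem_ball_self hε)

variable [Countable ι]

lemma SummablyDominated.locallyDominated (h : SummablyDominated U F) :
    @LocallyDominated ι ⊤ (@Measure.count ι ⊤) U F := by
  let _ : MeasurableSpace ι := ⊤
  refine ⟨fun a ha => (measurable_of_countable _).aestronglyMeasurable,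
    Eventually.of_forall h.1, fun a ha => ?_⟩
  obtain ⟨ε, hε, hsub, b, hb, hF⟩ := h.2 a ha
  exact ⟨ε, hε, hsub, b, integrable_count_iff.mpr hb.norm, Eventually.of_forall hF⟩

lemma integral_count_eq_tsum {f : ι → ℂ} (hf : Summable f) :
    @integral ι ℂ _ _ ⊤ (@Measure.count ι ⊤) f = ∑' i, f i := by
  let _ : MeasurableSpace ι := ⊤
  rw [integral_countable (integrable_count_iff.mpr hf.norm)]
  simp

lemma SummablyDominated.differentiableOn_tsum (h : SummablyDominated U F) :
    DifferentiableOn ℂ (fun a => ∑' i, F i a) U := by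
  let _ : MeasurableSpace ι := ⊤
  refine h.locallyDominated.differentiableOn_integral.congr fun a ha => ?_
  exact (integral_count_eq_tsum (h.summable ha)).symm

lemma SummablyDominated.summable_iteratedDeriv (h : SummablyDominated U F) (m : ℕ) {a : ℂ}
    (ha : a ∈ U) : Summable (fun i => iteratedDeriv m (F i) a) := by
  let _ : MeasurableSpace ι := ⊤
  exact (integrable_count_iff.mp ((h.locallyDominated.iteratedDeriv m).integrable ha)).of_norm

lemma SummablyDominated.iteratedDeriv_tsum (h : SummablyDominated U F) (m : ℕ) {a : ℂ}
    (ha : a ∈ U) :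
    iteratedDeriv m (fun a => ∑' i, F i a) a = ∑' i, iteratedDeriv m (F i) a := by
  let _ : MeasurableSpace ι := ⊤
  rw [← integral_count_eq_tsum (h.summable_iteratedDeriv m ha),
    ← h.locallyDominated.iteratedDeriv_integral m ha]
  apply EventuallyEq.iteratedDeriv_eq
  filter_upwards [h.locallyDominated.isOpen.mem_nhds ha] with a' ha'
  exact (integral_count_eq_tsum (h.summable ha')).symm

/-- Measurability of a countable sum with values in `ℂ`. -/
lemma measurable_tsum {β : Type*} [MeasurableSpace β] {F : ι → β → ℂ}
    (hF : ∀ i, Measurable (F i)) (hs : ∀ x, Summable (fun i => F i x)) :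
    Measurable (fun x => ∑' i, F i x) := by
  let _ : MeasurableSpace ι := ⊤
  have h1 : Measurable (Function.uncurry fun (x : β) (i : ι) => F i x) :=
    measurable_from_prod_countable_left fun i => hF i
  have h2 := (h1.stronglyMeasurable.integral_prod_right (ν := Measure.count)).measurable
  convert h2 using 2 with x
  exact (integral_count_eq_tsum (hs x)).symm

end Sums

/-! ### Identities for the linear forms -/

lemma mul_entry (M N : SL(2, ℤ)) (i j : Fin 2) :
    (M * N) i j = M i 0 * N 0 j + M i 1 * N 1 j := by
  simp [Matrix.SpecialLinearGroup.coe_mul, Matrix.mul_apply, Fin.sum_univ_two]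

lemma nu_mul_T (M : SL(2, ℤ)) (z : ℂ) : nu (M * ModularGroup.T) z = nu M (z + 1) := by
  simp [nu, mul_entry, ModularGroup.coe_T]
  ring

lemma de_mul_T (M : SL(2, ℤ)) (z : ℂ) : de (M * ModularGroup.T) z = de M (z + 1) := by
  simp [de, mul_entry, ModularGroup.coe_T]
  ring

lemma nu_mul_S (M : SL(2, ℤ)) {z : ℂ} (hz : z ≠ 0) :
    nu (M * ModularGroup.S) z = z * nu M (-z⁻¹) := by
  simp [nu, mul_entry, ModularGroup.coe_S]
  field_simp
  ring

lemma de_mul_S (M : SL(2, ℤ)) {z : ℂ} (hz : z ≠ 0) :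
    de (M * ModularGroup.S) z = z * de M (-z⁻¹) := by
  simp [de, mul_entry, ModularGroup.coe_S]
  field_simp
  ring

lemma rowWeight_mul_S (M : SL(2, ℤ)) : rowWeight (M * ModularGroup.S) = rowWeight M := by
  simp [rowWeight, mul_entry, ModularGroup.coe_S]
  ring

/-- The real part of `nu * conj de`, as an integral binary form. -/
lemma re_nu_mul_conj_de (M : SL(2, ℤ)) (z : ℂ) :
    (nu M z * conj (de M z)).re = (M 0 0 * M 1 0 : ℤ) * (z.re ^ 2 + z.im ^ 2)
      + (M 0 0 * M 1 1 + M 0 1 * M 1 0 : ℤ) * z.re + (M 0 1 * M 1 1 : ℤ) := by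
  simp [nu, de]
  ring

lemma im_nu_mul_conj_de (M : SL(2, ℤ)) (z : ℂ) : (nu M z * conj (de M z)).im = z.im := by
  have h : (M 0 0 : ℝ) * M 1 1 - M 0 1 * M 1 0 = 1 := by exact_mod_cast det_entries M
  simp [nu, de]
  linear_combination z.im * h

lemma norm_sq_le_norm_nu_add_sq (M : SL(2, ℤ)) {z : ℂ} (hz : 0 < z.im) :
    ‖nu M z‖ ^ 2 + ‖de M z‖ ^ 2 ≤ ‖nu M z + Complex.I * de M z‖ ^ 2 := by
  have h := im_nu_mul_conj_de M z
  have h2 : ‖nu M z + Complex.I * de M z‖ ^ 2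
      = ‖nu M z‖ ^ 2 + ‖de M z‖ ^ 2 + 2 * (nu M z * conj (de M z)).im := by
    simp only [Complex.sq_norm, Complex.normSq_apply]
    simp
    ring
  rw [h2, h]
  linarith

lemma nu_add_ne_zero (M : SL(2, ℤ)) {z : ℂ} (hz : 0 < z.im) : nu M z + Complex.I * de M z ≠ 0 := by
  intro h
  have h1 := norm_sq_le_norm_nu_add_sq M hz
  rw [h] at h1
  have := norm_pos_iff.mpr (nu_ne_zero M hz.ne')
  simp at h1
  nlinarith [sq_nonneg ‖de M z‖]

/-! ### Points off the translates of the imaginary axis -/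

/-- The points of the lower half-plane, and those of the upper half-plane that lie on no translate
of the imaginary axis. -/
def goodSet : Set ℂ :=
  {a | a.im < 0} ∪ {a | 0 < a.im ∧ ∀ M : SL(2, ℤ), (nu M a * conj (de M a)).re ≠ 0}

lemma form_coeff_bound {A B C : ℤ} (hdisc : B ^ 2 - 4 * A * C = 1) {x v v₀ R : ℝ} (hv₀ : 0 < v₀)
    (hv : v₀ / 2 ≤ v) (hR : x ^ 2 + v ^ 2 ≤ R ^ 2) (hR0 : 0 ≤ R)
    (h : A * (x ^ 2 + v ^ 2) + B * x + C = 0) :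
    |(A : ℝ)| ≤ 1 / v₀ ∧ |(B : ℝ)| ≤ 1 + 2 * R / v₀ ∧
      |(C : ℝ)| ≤ R ^ 2 / v₀ + (1 + 2 * R / v₀) * R := by
  have hd : (B : ℝ) ^ 2 - 4 * A * C = 1 := by exact_mod_cast hdisc
  have key : (2 * A * x + B) ^ 2 + 4 * (A : ℝ) ^ 2 * v ^ 2 = 1 := by
    linear_combination 4 * (A : ℝ) * h + hd
  have hx : |x| ≤ R := abs_le_of_sq_le_sq (by nlinarith [sq_nonneg v]) hR0
  have hA : |(A : ℝ)| ≤ 1 / v₀ := by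
    refine abs_le_of_sq_le_sq ?_ (by positivity)
    rw [div_pow, one_pow, le_div_iff₀ (by positivity)]
    have : v₀ ^ 2 ≤ 4 * v ^ 2 := by nlinarith
    nlinarith [sq_nonneg (2 * A * x + B), sq_nonneg (A : ℝ)]
  have hB : |(B : ℝ)| ≤ 1 + 2 * R / v₀ := by
    have h1 : |2 * A * x + B| ≤ 1 := abs_le_of_sq_le_sq (by nlinarith [mul_nonneg (sq_nonneg (A : ℝ)) (sq_nonneg v)]) one_pos.le
    have h2 : |(A : ℝ) * x| ≤ 1 / v₀ * R := by
      rw [abs_mul]; gcongr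
    have h3 : (B : ℝ) = (2 * A * x + B) - 2 * (A * x) := by ring
    calc |(B : ℝ)| = |(2 * A * x + B) - 2 * (A * x)| := by rw [← h3]
      _ ≤ |2 * A * x + B| + |2 * (A * x)| := abs_sub _ _
      _ ≤ 1 + 2 * (1 / v₀ * R) := by
        rw [abs_mul (2 : ℝ), abs_two]; gcongr
      _ = _ := by ring
  refine ⟨hA, hB, ?_⟩
  have h4 : (C : ℝ) = -(A * (x ^ 2 + v ^ 2)) - B * x := by linarith
  calc |(C : ℝ)| = |-(A * (x ^ 2 + v ^ 2)) - B * x| := by rw [← h4]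
    _ ≤ |-(A * (x ^ 2 + v ^ 2))| + |B * x| := abs_sub _ _
    _ = |(A : ℝ)| * (x ^ 2 + v ^ 2) + |(B : ℝ)| * |x| := by
      rw [abs_neg, abs_mul, abs_mul, abs_of_nonneg (by positivity : (0 : ℝ) ≤ x ^ 2 + v ^ 2)]
    _ ≤ 1 / v₀ * R ^ 2 + (1 + 2 * R / v₀) * R := by gcongr
    _ = _ := by ring

theorem isOpen_goodSet : IsOpen goodSet := by
  rw [isOpen_iff_mem_nhds]
  rintro a₀ (ha₀ | ⟨ha₀, hM⟩)
  · exact Filter.mem_of_superset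
      ((isOpen_lt Complex.continuous_im continuous_const).mem_nhds ha₀) Set.subset_union_left
  set v₀ := a₀.im
  set R := ‖a₀‖ + v₀
  have hR : 0 ≤ R := by positivity
  obtain ⟨N, hN⟩ := exists_nat_ge (1 / v₀ + (1 + 2 * R / v₀) + (R ^ 2 / v₀ + (1 + 2 * R / v₀) * R))
  let Q : ℤ × ℤ × ℤ → ℂ → ℝ := fun t a =>
    (t.1 : ℝ) * (a.re ^ 2 + a.im ^ 2) + (t.2.1 : ℝ) * a.re + (t.2.2 : ℝ)
  let T : Finset (ℤ × ℤ × ℤ) := Finset.Icc (-(N : ℤ)) N ×ˢ Finset.Icc (-(N : ℤ)) N ×ˢ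
    Finset.Icc (-(N : ℤ)) N
  have hQ : ∀ t ∈ T, ∀ᶠ a in 𝓝 a₀, Q t a₀ ≠ 0 → Q t a ≠ 0 := by
    intro t _
    by_cases h : Q t a₀ = 0
    · exact Eventually.of_forall fun a h' => absurd h h'
    · have hc : ContinuousAt (Q t) a₀ := by
        simp only [Q]
        fun_prop
      filter_upwards [hc.eventually_ne h] with a ha _ using ha
  have h1 := (Filter.eventually_all_finset T).mpr hQ
  have h2 := Metric.ball_mem_nhds a₀ (half_pos ha₀)
  filter_upwards [h1, h2] with a ha hball
  rw [Metric.mem_ball, dist_eq_norm] at hball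
  have him : v₀ / 2 ≤ a.im := by
    have := (Complex.abs_im_le_norm (a - a₀)).trans hball.le
    rw [Complex.sub_im, abs_le] at this
    linarith [this.1]
  have hnorm : a.re ^ 2 + a.im ^ 2 ≤ R ^ 2 := by
    have h3 : ‖a‖ ≤ R := by
      have := norm_add_le (a - a₀) a₀
      rw [sub_add_cancel] at this
      simp only [R]
      linarith
    have h4 : a.re ^ 2 + a.im ^ 2 = ‖a‖ ^ 2 := by
      rw [Complex.sq_norm, Complex.normSq_apply]; ring
    rw [h4]
    gcongr
  refine Or.inr ⟨lt_of_lt_of_le (half_pos ha₀) him, fun M h0 => ?_⟩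
  rw [re_nu_mul_conj_de] at h0
  have hdet := det_entries M
  have hdisc : (M 0 0 * M 1 1 + M 0 1 * M 1 0) ^ 2 - 4 * (M 0 0 * M 1 0) * (M 0 1 * M 1 1) = 1 := by
    linear_combination (M 0 0 * M 1 1 - M 0 1 * M 1 0 + 1) * hdet
  obtain ⟨hA, hB, hC⟩ := form_coeff_bound hdisc ha₀ him hnorm hR h0
  have p1 : 0 ≤ 1 / v₀ := by positivity
  have p2 : 0 ≤ 1 + 2 * R / v₀ := by positivity
  have p3 : 0 ≤ R ^ 2 / v₀ + (1 + 2 * R / v₀) * R := by positivity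
  have hmem : ∀ A : ℤ, |(A : ℝ)| ≤ N → A ∈ Finset.Icc (-(N : ℤ)) N := by
    intro A hA
    rw [Finset.mem_Icc, ← abs_le]
    exact_mod_cast hA
  refine ha (M 0 0 * M 1 0, M 0 0 * M 1 1 + M 0 1 * M 1 0, M 0 1 * M 1 1) ?_ ?_ h0
  · simp only [T, Finset.mem_product]
    exact ⟨hmem _ (by linarith), hmem _ (by linarith), hmem _ (by linarith)⟩
  · have := hM M
    rwa [re_nu_mul_conj_de] at this

lemma coe_smul_eq (M : SL(2, ℤ)) (τ : ℍ) : ((M • τ : ℍ) : ℂ) = nu M τ / de M τ := by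
  rw [UpperHalfPlane.specialLinearGroup_apply]
  simp [nu, de]

lemma denom_eq_de (M : SL(2, ℤ)) (τ : ℍ) : UpperHalfPlane.denom M τ = de M τ := by
  simp [UpperHalfPlane.denom, de]

lemma re_div_eq (x y : ℂ) : (x / y).re = (x * conj y).re / ‖y‖ ^ 2 := by
  rw [Complex.sq_norm, Complex.div_re]
  simp
  ring

lemma not_mem_exceptionalSet_iff (τ : ℍ) : τ ∉ exceptionalSet ↔ (τ : ℂ) ∈ goodSet := by
  have hτ := τ.im_pos
  have h1 : τ ∈ exceptionalSet ↔ ∃ M : SL(2, ℤ), (nu M τ * conj (de M τ)).re = 0 := by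
    have h2 : ∀ M : SL(2, ℤ), (nu M τ * conj (de M τ)).re = 0 ↔ (M • τ).re = 0 := by
      intro M
      rw [← UpperHalfPlane.coe_re, coe_smul_eq, re_div_eq]
      have := norm_pos_iff.mpr (de_ne_zero M hτ.ne')
      simp at this
      simp [this]
    simp only [h2, exceptionalSet, Set.mem_iUnion, Set.mem_image, Set.mem_ofPred_eq]
    constructor
    · rintro ⟨M, w, hw, rfl⟩
      exact ⟨M⁻¹, by simpa using hw⟩
    · rintro ⟨M, h⟩
      exact ⟨M⁻¹, M • τ, h, by simp⟩
  rw [h1, goodSet]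
  simp only [not_exists, Set.mem_union, Set.mem_ofPred_eq]
  constructor
  · exact fun h => Or.inr ⟨hτ, h⟩
  · rintro (h | h)
    · exact absurd h (not_lt.mpr hτ.le)
    · exact h.2

/-- The point of `goodSet` stay away from the translates of the imaginary axis. -/
lemma orbit_not_mem_goodSet (M : SL(2, ℤ)) {y : ℝ} (hy : 0 < y) :
    nu M (Complex.I * y) / de M (Complex.I * y) ∉ goodSet := by
  let τ : ℍ := ⟨Complex.I * y, by simpa using hy⟩
  have h : ((M • τ : ℍ) : ℂ) = nu M (Complex.I * y) / de M (Complex.I * y) := coe_smul_eq M τ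
  rw [← h, ← not_mem_exceptionalSet_iff, not_not]
  refine Set.mem_iUnion.mpr ⟨M, τ, ?_, rfl⟩
  simp [τ]

lemma exists_separation {a₀ : ℂ} (ha₀ : a₀ ∈ goodSet) :
    ∃ ε > 0, Metric.ball a₀ ε ⊆ goodSet ∧ ∀ a ∈ Metric.ball a₀ ε, ∀ M : SL(2, ℤ), ∀ y : ℝ, 0 < y →
      ε * ‖de M (Complex.I * y)‖ ≤ ‖nu M (Complex.I * y) - a * de M (Complex.I * y)‖ := by
  obtain ⟨δ, hδ, hsub⟩ := Metric.isOpen_iff.mp isOpen_goodSet a₀ ha₀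
  refine ⟨δ / 2, by positivity, (Metric.ball_subset_ball (by linarith)).trans hsub, ?_⟩
  intro a ha M y hy
  have hne : de M (Complex.I * y) ≠ 0 := de_ne_zero M (by simpa using hy.ne')
  have hnot := fun h => orbit_not_mem_goodSet M hy (hsub h)
  replace hnot := not_lt.mp fun h => hnot (Metric.mem_ball.mpr h)
  rw [Metric.mem_ball] at ha
  have h1 : δ / 2 ≤ ‖nu M (Complex.I * y) / de M (Complex.I * y) - a‖ := by
    rw [← dist_eq_norm]
    linarith [dist_triangle (nu M (Complex.I * y) / de M (Complex.I * y)) a a₀]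
  have h2 : nu M (Complex.I * y) - a * de M (Complex.I * y) =
      (nu M (Complex.I * y) / de M (Complex.I * y) - a) * de M (Complex.I * y) := by
    field_simp
  rw [h2, norm_mul]
  gcongr

/-! ### The Cauchy kernel and its derivatives -/

/-- The weight `2k` translate by `M` of the Cauchy kernel `1/(z-a) - 1/(z+i)`. -/
def cauchyTerm (k : ℕ) (M : SL(2, ℤ)) (z a : ℂ) : ℂ :=
  ((de M z) ^ (2 * k - 1))⁻¹ * ((nu M z - a * de M z)⁻¹ - (nu M z + Complex.I * de M z)⁻¹)

/-- The weight `2k` Poincaré series of the Cauchy kernel. -/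
def cauchySeries (k : ℕ) (z a : ℂ) : ℂ := ∑' M : SL(2, ℤ), cauchyTerm k M z a

/-- The weight `2k` translate by `M` of `(z-a)^(-2k)`. -/
def kernelTerm (k : ℕ) (M : SL(2, ℤ)) (z a : ℂ) : ℂ := ((nu M z - a * de M z) ^ (2 * k))⁻¹

/-- The Poincaré series of `(z-a)^(-2k)`, which is symmetric in its variables. -/
def kernelSeries (k : ℕ) (z a : ℂ) : ℂ := ∑' M : SL(2, ℤ), kernelTerm k M z a

lemma cauchyTerm_add_one (k : ℕ) (M : SL(2, ℤ)) (z a : ℂ) :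
    cauchyTerm k M (z + 1) a = cauchyTerm k (M * ModularGroup.T) z a := by
  simp only [cauchyTerm, nu_mul_T, de_mul_T]

lemma kernelTerm_add_one (k : ℕ) (M : SL(2, ℤ)) (z a : ℂ) :
    kernelTerm k M (z + 1) a = kernelTerm k (M * ModularGroup.T) z a := by
  simp only [kernelTerm, nu_mul_T, de_mul_T]

lemma cauchyTerm_mul_S {k : ℕ} (hk : 1 ≤ k) (M : SL(2, ℤ)) {z : ℂ} (hz : z ≠ 0) (a : ℂ) :
    cauchyTerm k (M * ModularGroup.S) z a = (z ^ (2 * k))⁻¹ * cauchyTerm k M (-z⁻¹) a := by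
  simp only [cauchyTerm, nu_mul_S M hz, de_mul_S M hz]
  rw [show z * nu M (-z⁻¹) - a * (z * de M (-z⁻¹)) = z * (nu M (-z⁻¹) - a * de M (-z⁻¹)) by ring,
    show z * nu M (-z⁻¹) + Complex.I * (z * de M (-z⁻¹)) =
      z * (nu M (-z⁻¹) + Complex.I * de M (-z⁻¹)) by ring,
    show 2 * k = 2 * k - 1 + 1 by omega, Nat.add_sub_cancel]
  simp only [mul_inv, mul_pow, pow_succ]
  ring

lemma kernelTerm_mul_S (k : ℕ) (M : SL(2, ℤ)) {z : ℂ} (hz : z ≠ 0) (a : ℂ) :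
    kernelTerm k (M * ModularGroup.S) z a = (z ^ (2 * k))⁻¹ * kernelTerm k M (-z⁻¹) a := by
  simp only [kernelTerm, nu_mul_S M hz, de_mul_S M hz]
  rw [show z * nu M (-z⁻¹) - a * (z * de M (-z⁻¹)) = z * (nu M (-z⁻¹) - a * de M (-z⁻¹)) by ring,
    mul_pow, mul_inv]

lemma cauchySeries_inv {k : ℕ} (hk : 1 ≤ k) {z : ℂ} (hz : z ≠ 0) (a : ℂ) :
    cauchySeries k z a = (z ^ (2 * k))⁻¹ * cauchySeries k (-z⁻¹) a := by
  rw [cauchySeries, cauchySeries, ← tsum_mul_left,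
    ← (Equiv.mulRight ModularGroup.S).tsum_eq (fun M => cauchyTerm k M z a)]
  exact tsum_congr fun M => cauchyTerm_mul_S hk M hz a

lemma kernelSeries_inv (k : ℕ) {z : ℂ} (hz : z ≠ 0) (a : ℂ) :
    kernelSeries k z a = (z ^ (2 * k))⁻¹ * kernelSeries k (-z⁻¹) a := by
  rw [kernelSeries, kernelSeries, ← tsum_mul_left,
    ← (Equiv.mulRight ModularGroup.S).tsum_eq (fun M => kernelTerm k M z a)]
  exact tsum_congr fun M => kernelTerm_mul_S k M hz a

lemma linearForm_inv (M : SL(2, ℤ)) (z a : ℂ) :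
    nu M⁻¹ a - z * de M⁻¹ a = -(nu M z - a * de M z) := by
  simp [nu, de, Matrix.SpecialLinearGroup.SL2_inv_expl]
  ring

lemma kernelTerm_symm (k : ℕ) (M : SL(2, ℤ)) (z a : ℂ) :
    kernelTerm k M⁻¹ a z = kernelTerm k M z a := by
  rw [kernelTerm, linearForm_inv, Even.neg_pow (even_two_mul k), kernelTerm]

lemma kernelSeries_symm (k : ℕ) (z a : ℂ) : kernelSeries k z a = kernelSeries k a z := by
  rw [kernelSeries, kernelSeries, ← (Equiv.inv SL(2, ℤ)).tsum_eq (fun M => kernelTerm k M a z)]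
  exact tsum_congr fun M => (kernelTerm_symm k M z a).symm

lemma kernelSeries_conj (k : ℕ) (z a : ℂ) :
    conj (kernelSeries k z a) = kernelSeries k (conj z) (conj a) := by
  rw [kernelSeries, kernelSeries, Complex.conj_tsum]
  refine tsum_congr fun M => ?_
  simp [kernelTerm, nu, de]

lemma hasDerivAt_inv_pow_form {n d a : ℂ} (h : n - a * d ≠ 0) (j : ℕ) :
    HasDerivAt (fun a => ((n - a * d) ^ (j + 1))⁻¹) ((j + 1 : ℕ) * d * ((n - a * d) ^ (j + 2))⁻¹)
      a := by
  have h1 : HasDerivAt (fun a => n - a * d) (-d) a := by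
    simpa using ((hasDerivAt_id a).mul_const d).const_sub n
  have h2 := (h1.fun_pow (j + 1)).fun_inv (pow_ne_zero _ h)
  refine h2.congr_deriv ?_
  rw [Nat.add_sub_cancel]
  generalize n - a * d = w at h
  have hw : w ^ j ≠ 0 := pow_ne_zero _ h
  have e1 : (w ^ (j + 1)) ^ 2 = w ^ j * w ^ (j + 2) := by
    rw [← pow_mul, ← pow_add]
    congr 1
    ring
  rw [e1, div_eq_mul_inv, mul_inv]
  calc _ = ((j + 1 : ℕ) : ℂ) * d * (w ^ (j + 2))⁻¹ * (w ^ j * (w ^ j)⁻¹) := by ring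
    _ = _ := by rw [mul_inv_cancel₀ hw, mul_one]

lemma iteratedDeriv_cauchyTerm_succ {k : ℕ} {M : SL(2, ℤ)} {z a : ℂ}
    (h : nu M z - a * de M z ≠ 0) (j : ℕ) :
    iteratedDeriv (j + 1) (cauchyTerm k M z) a = (j + 1).factorial * (de M z) ^ (j + 1) *
      ((de M z) ^ (2 * k - 1))⁻¹ * ((nu M z - a * de M z) ^ (j + 2))⁻¹ := by
  induction j generalizing a with
  | zero =>
    rw [zero_add, iteratedDeriv_one]
    have h1 := hasDerivAt_inv_pow_form h 0
    have h2 := (h1.sub_const ((nu M z + Complex.I * de M z)⁻¹)).const_mul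
      ((de M z) ^ (2 * k - 1))⁻¹
    simp only [zero_add, pow_one] at h2
    refine h2.deriv.trans ?_
    simp
    ring
  | succ j ih =>
    rw [iteratedDeriv_succ]
    have hopen : IsOpen {a : ℂ | nu M z - a * de M z ≠ 0} :=
      isOpen_ne_fun (by fun_prop) continuous_const
    have hev : iteratedDeriv (j + 1) (cauchyTerm k M z) =ᶠ[𝓝 a] fun a =>
        (j + 1).factorial * (de M z) ^ (j + 1) *
      ((de M z) ^ (2 * k - 1))⁻¹ * ((nu M z - a * de M z) ^ (j + 2))⁻¹ := by
      filter_upwards [hopen.mem_nhds h] with a' ha' using ih ha'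
    rw [hev.deriv_eq]
    refine ((hasDerivAt_inv_pow_form h (j + 1)).const_mul _).deriv.trans ?_
    rw [Nat.factorial_succ (j + 1)]
    push_cast
    ring

lemma iteratedDeriv_cauchyTerm_top {k : ℕ} (hk : 1 ≤ k) {M : SL(2, ℤ)} {z a : ℂ}
    (h : nu M z - a * de M z ≠ 0) (hde : de M z ≠ 0) :
    iteratedDeriv (2 * k - 1) (cauchyTerm k M z) a =
      (2 * k - 1).factorial * kernelTerm k M z a := by
  obtain ⟨j, rfl⟩ : ∃ j, k = j + 1 := ⟨k - 1, by omega⟩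
  have h1 := iteratedDeriv_cauchyTerm_succ (k := j + 1) h (2 * j)
  rw [show 2 * (j + 1) - 1 = 2 * j + 1 by omega] at *
  rw [h1, kernelTerm, show 2 * j + 2 = 2 * (j + 1) by ring, mul_assoc ((2 * j + 1).factorial : ℂ),
    mul_inv_cancel₀ (pow_ne_zero _ hde), mul_one]

lemma differentiableAt_cauchyTerm {k : ℕ} {M : SL(2, ℤ)} {z a : ℂ}
    (h : nu M z - a * de M z ≠ 0) : DifferentiableAt ℂ (cauchyTerm k M z) a := by
  unfold cauchyTerm
  fun_prop (disch := assumption)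

lemma differentiableAt_nu (M : SL(2, ℤ)) (z : ℂ) : DifferentiableAt ℂ (nu M) z := by
  unfold nu; fun_prop

lemma differentiableAt_de (M : SL(2, ℤ)) (z : ℂ) : DifferentiableAt ℂ (de M) z := by
  unfold de; fun_prop

lemma differentiableAt_cauchyTerm_left {k : ℕ} {M : SL(2, ℤ)} {z a : ℂ} (hz : 0 < z.im)
    (h : nu M z - a * de M z ≠ 0) : DifferentiableAt ℂ (fun z => cauchyTerm k M z a) z := by
  have h1 := differentiableAt_nu M z
  have h2 := differentiableAt_de M z
  have h3 := nu_add_ne_zero M hz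
  have h4 := pow_ne_zero (2 * k - 1) (de_ne_zero M hz.ne')
  unfold cauchyTerm
  fun_prop (disch := assumption)

lemma differentiableAt_kernelTerm_left {k : ℕ} {M : SL(2, ℤ)} {z a : ℂ}
    (h : nu M z - a * de M z ≠ 0) : DifferentiableAt ℂ (fun z => kernelTerm k M z a) z := by
  have h1 := differentiableAt_nu M z
  have h2 := differentiableAt_de M z
  have h4 := pow_ne_zero (2 * k) h
  unfold kernelTerm
  fun_prop (disch := assumption)

/-! ### Bounds on the terms -/

lemma norm_nu_add_le {M : SL(2, ℤ)} {z a : ℂ} {ε A : ℝ} (hε : 0 < ε)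
    (hsep : ε * ‖de M z‖ ≤ ‖nu M z - a * de M z‖) (hA : ‖a + Complex.I‖ ≤ A) :
    ‖nu M z + Complex.I * de M z‖ ≤ (1 + A / ε) * ‖nu M z - a * de M z‖ := by
  have hA0 : 0 ≤ A := (norm_nonneg _).trans hA
  calc ‖nu M z + Complex.I * de M z‖
      = ‖(nu M z - a * de M z) + (a + Complex.I) * de M z‖ := by congr 1; ring
    _ ≤ ‖nu M z - a * de M z‖ + A * ‖de M z‖ := by
      refine (norm_add_le _ _).trans ?_
      rw [norm_mul]
      gcongr
    _ = ‖nu M z - a * de M z‖ + A / ε * (ε * ‖de M z‖) := by field_simp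
    _ ≤ ‖nu M z - a * de M z‖ + A / ε * ‖nu M z - a * de M z‖ := by gcongr
    _ = _ := by ring

lemma norm_cauchyTerm_le {k : ℕ} (hk : 2 ≤ k) {M : SL(2, ℤ)} {z a : ℂ} {ε A : ℝ} (hε : 0 < ε)
    (hz : 1 ≤ z.im) (hsep : ε * ‖de M z‖ ≤ ‖nu M z - a * de M z‖) (hA : ‖a + Complex.I‖ ≤ A) :
    ‖cauchyTerm k M z a‖ ≤ A * (1 + A / ε) * (‖de M z‖ ^ 2 * ‖nu M z‖ ^ 2)⁻¹ := by
  have hz0 : 0 < z.im := by linarith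
  have hA0 : 0 ≤ A := (norm_nonneg _).trans hA
  have hde1 := one_le_de M hz
  have hde := norm_pos_iff.mp (one_pos.trans_le hde1)
  have hpole : nu M z - a * de M z ≠ 0 := by
    rw [← norm_pos_iff]
    exact lt_of_lt_of_le (by positivity) hsep
  have hI := nu_add_ne_zero M hz0
  have h1 := norm_nu_add_le hε hsep hA
  have h2 := norm_sq_le_norm_nu_add_sq M hz0
  set x := ‖nu M z - a * de M z‖ with hx
  set X := ‖nu M z + Complex.I * de M z‖ with hX
  have hx0 : 0 < x := norm_pos_iff.mpr hpole
  have hX0 : 0 < X := norm_pos_iff.mpr hI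
  have hd0 : 0 < ‖de M z‖ := norm_pos_iff.mpr hde
  have hn0 : 0 < ‖nu M z‖ := norm_pos_iff.mpr (nu_ne_zero M hz0.ne')
  have e : cauchyTerm k M z a = (a + Complex.I) * ((de M z ^ (2 * k - 2))⁻¹ *
      ((nu M z - a * de M z)⁻¹ * (nu M z + Complex.I * de M z)⁻¹)) := by
    rw [cauchyTerm, show 2 * k - 1 = 2 * k - 2 + 1 by omega, pow_succ, inv_sub_inv hpole hI,
      show nu M z + Complex.I * de M z - (nu M z - a * de M z) = (a + Complex.I) * de M z by ring,
      mul_inv, div_eq_mul_inv, mul_inv]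
    field_simp
  rw [e, norm_mul, norm_mul, norm_mul, norm_inv, norm_inv, norm_inv, norm_pow, ← hx, ← hX]
  have h3 : (‖de M z‖ ^ (2 * k - 2))⁻¹ ≤ (‖de M z‖ ^ 2)⁻¹ := by
    gcongr
    omega
  have h4 : x⁻¹ * X⁻¹ ≤ (1 + A / ε) * (‖nu M z‖ ^ 2)⁻¹ := by
    have h5 : x⁻¹ ≤ (1 + A / ε) * X⁻¹ := by
      rw [inv_eq_one_div, ← div_eq_mul_inv, div_le_div_iff₀ hx0 hX0, one_mul]
      exact h1
    calc x⁻¹ * X⁻¹ ≤ ((1 + A / ε) * X⁻¹) * X⁻¹ := by gcongr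
      _ = (1 + A / ε) * (X ^ 2)⁻¹ := by rw [pow_two, mul_inv]; ring
      _ ≤ _ := by
        gcongr
        nlinarith [sq_nonneg ‖de M z‖]
  calc _ ≤ A * ((‖de M z‖ ^ 2)⁻¹ * ((1 + A / ε) * (‖nu M z‖ ^ 2)⁻¹)) := by gcongr
    _ = _ := by rw [mul_inv]; ring

lemma separation_of_im_neg (M : SL(2, ℤ)) {z a : ℂ} (hz : 0 < z.im) :
    -a.im * ‖de M z‖ ≤ ‖nu M z - a * de M z‖ := by
  have hde := de_ne_zero M hz.ne'
  have hd0 : 0 < ‖de M z‖ := norm_pos_iff.mpr hde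
  have h1 := im_nu_mul_conj_de M z
  have h2 : ((nu M z - a * de M z) * conj (de M z)).im = z.im - a.im * ‖de M z‖ ^ 2 := by
    rw [sub_mul, Complex.sub_im, h1, mul_assoc, Complex.mul_conj, Complex.sq_norm]
    simp
  have h3 := Complex.abs_im_le_norm ((nu M z - a * de M z) * conj (de M z))
  rw [h2, norm_mul, Complex.norm_conj] at h3
  have h4 := (le_abs_self _).trans h3
  have h5 : -a.im * ‖de M z‖ * ‖de M z‖ ≤ ‖nu M z - a * de M z‖ * ‖de M z‖ := by nlinarith
  exact le_of_mul_le_mul_right h5 hd0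

lemma norm_kernelTerm_le {k : ℕ} (hk : 2 ≤ k) (M : SL(2, ℤ)) {z a : ℂ} (hz : 1 ≤ z.im)
    (ha : a.im < 0) : ‖kernelTerm k M z a‖ ≤
      (1 + ‖a + Complex.I‖ / -a.im) ^ (2 * k) * (‖de M z‖ ^ 2 * ‖nu M z‖ ^ 2)⁻¹ := by
  have hz0 : 0 < z.im := by linarith
  have hε : 0 < -a.im := by linarith
  have hsep := separation_of_im_neg M (a := a) hz0
  have h1 := norm_nu_add_le hε hsep le_rfl
  have h2 := norm_sq_le_norm_nu_add_sq M hz0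
  have hde1 := one_le_de M hz
  have hnu1 := one_le_nu M hz
  set K := 1 + ‖a + Complex.I‖ / -a.im
  set x := ‖nu M z - a * de M z‖ with hx
  set X := ‖nu M z + Complex.I * de M z‖ with hX
  have hK : 0 < K := by positivity
  have hX1 : 1 ≤ X := by nlinarith [norm_nonneg (nu M z + Complex.I * de M z)]
  have hx0 : 0 < x := by
    by_contra! hle
    nlinarith
  rw [kernelTerm, norm_inv, norm_pow, ← hx]
  have h3 : ‖de M z‖ ^ 2 * ‖nu M z‖ ^ 2 ≤ X ^ (2 * k) := by
    calc ‖de M z‖ ^ 2 * ‖nu M z‖ ^ 2 ≤ X ^ 2 * X ^ 2 := by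
          gcongr <;> nlinarith [sq_nonneg ‖nu M z‖, sq_nonneg ‖de M z‖]
      _ = X ^ 4 := by ring
      _ ≤ X ^ (2 * k) := pow_le_pow_right₀ hX1 (by omega)
  have h4 : X ^ (2 * k) ≤ K ^ (2 * k) * x ^ (2 * k) := by
    rw [← mul_pow]; gcongr
  rw [inv_eq_one_div, ← div_eq_mul_inv, div_le_div_iff₀ (by positivity) (by positivity), one_mul]
  exact h3.trans h4

/-! ### Uniform bounds for the Cauchy series -/

lemma im_ne_zero_of_mem_goodSet {a : ℂ} (ha : a ∈ goodSet) : a.im ≠ 0 := by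
  rcases ha with h | h
  · exact ne_of_lt h
  · exact h.1.ne'

lemma im_sub_mul (M : SL(2, ℤ)) (z a : ℂ) :
    ((nu M z - a * de M z) * conj (de M z)).im = z.im - a.im * ‖de M z‖ ^ 2 := by
  rw [sub_mul, Complex.sub_im, im_nu_mul_conj_de, mul_assoc, Complex.mul_conj, Complex.sq_norm]
  simp

lemma separation_of_im_large {a₀ : ℂ} (ha₀ : a₀.im ≠ 0) {a : ℂ}
    (ha : a ∈ Metric.ball a₀ (|a₀.im| / 2)) {z : ℂ} (hz : 1 + 3 * |a₀.im| + 4 / |a₀.im| ≤ z.im)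
    (M : SL(2, ℤ)) : |a₀.im| / 4 * ‖de M z‖ ≤ ‖nu M z - a * de M z‖ := by
  set v := |a₀.im| with hv
  have hv0 : 0 < v := abs_pos.mpr ha₀
  have h4v : 0 < 4 / v := by positivity
  have hz1 : 1 ≤ z.im := by linarith
  have hd1 := one_le_de M hz1
  rw [Metric.mem_ball, dist_eq_norm] at ha
  have him := abs_le.mp ((Complex.abs_im_le_norm (a - a₀)).trans ha.le)
  rw [Complex.sub_im] at him
  have key : v / 4 * ‖de M z‖ ^ 2 ≤ |z.im - a.im * ‖de M z‖ ^ 2| := by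
    by_cases hr : M 1 0 = 0
    · have hs : ‖de M z‖ ^ 2 = 1 := by
        have h := det_entries M
        rw [hr, mul_zero, sub_zero] at h
        have : M 1 1 = 1 ∨ M 1 1 = -1 :=
          Int.eq_one_or_neg_one_of_mul_eq_one (u := M 1 1) (v := M 0 0) (by linarith)
        rw [de, normSq_form, hr]
        rcases this with h | h <;> simp [h]
      rw [hs]
      refine le_trans ?_ (le_abs_self _)
      have := le_abs_self a₀.im
      linarith
    · have hr1 : (1 : ℝ) ≤ (M 1 0 : ℝ) ^ 2 := by
        simpa using one_le_sq_add_sq_of_ne (a := M 1 0) (b := 0) (Or.inl hr)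
      have hde : z.im * z.im ≤ ‖de M z‖ ^ 2 := by
        rw [de, normSq_form]
        nlinarith [sq_nonneg ((M 1 0 : ℝ) * z.re + M 1 1), sq_nonneg z.im]
      have h1 : z.im ≤ v / 4 * ‖de M z‖ ^ 2 := by
        have h2 : 1 ≤ v / 4 * z.im := by
          have : v / 4 * (4 / v) ≤ v / 4 * z.im := by gcongr; linarith
          rwa [show v / 4 * (4 / v) = 1 by field_simp] at this
        calc z.im ≤ (v / 4 * z.im) * z.im := le_mul_of_one_le_left (by linarith) h2
          _ = v / 4 * (z.im * z.im) := by ring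
          _ ≤ _ := by gcongr
      rcases lt_or_gt_of_ne ha₀ with hneg | hpos
      · have hva : v = -a₀.im := abs_of_neg hneg
        refine le_trans ?_ (le_abs_self _)
        nlinarith [sq_nonneg ‖de M z‖]
      · have hva : v = a₀.im := abs_of_pos hpos
        refine le_trans ?_ (neg_le_abs _)
        nlinarith [sq_nonneg ‖de M z‖]
  rw [← im_sub_mul] at key
  have h3 := key.trans (Complex.abs_im_le_norm _)
  rw [norm_mul, Complex.norm_conj] at h3
  refine le_of_mul_le_mul_right ?_ (one_pos.trans_le hd1)
  nlinarith

lemma pow_mul_exp_le (m : ℕ) {y Y : ℝ} (hy : 0 ≤ y) :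
    y ^ m * Real.exp (-2 * Real.pi * (y - Y)) ≤ m.factorial * Real.exp (2 * Real.pi * Y) := by
  have h1 := Real.pow_div_factorial_le_exp y hy m
  rw [div_le_iff₀ (by positivity)] at h1
  have h2 : Real.exp y * Real.exp (-2 * Real.pi * (y - Y)) ≤ Real.exp (2 * Real.pi * Y) := by
    rw [← Real.exp_add]
    apply Real.exp_le_exp.mpr
    nlinarith [Real.pi_gt_three]
  calc _ ≤ Real.exp y * m.factorial * Real.exp (-2 * Real.pi * (y - Y)) := by gcongr
    _ = m.factorial * (Real.exp y * Real.exp (-2 * Real.pi * (y - Y))) := by ring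
    _ ≤ _ := by gcongr

lemma exists_cauchy_bounds {k : ℕ} (hk : 2 ≤ k) {a₀ : ℂ} (ha₀ : a₀ ∈ goodSet) :
    ∃ ε > 0, Metric.ball a₀ ε ⊆ goodSet ∧ ∃ C ≥ 0, ∀ a ∈ Metric.ball a₀ ε, ∀ y : ℝ, 1 ≤ y →
      (∀ M : SL(2, ℤ), ‖cauchyTerm k M (Complex.I * y) a‖ ≤ C * (rowWeight M)⁻¹) ∧
      ‖cauchySeries k (Complex.I * y) a‖ ≤ C * (y ^ (2 * k))⁻¹ := by
  obtain ⟨ε₁, hε₁, hsub, hsep⟩ := exists_separation ha₀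
  have him := im_ne_zero_of_mem_goodSet ha₀
  set v := |a₀.im|
  have hv : 0 < v := abs_pos.mpr him
  set ε := min ε₁ (v / 2)
  have hε : 0 < ε := by positivity
  set A := ‖a₀‖ + ε + 1
  have hA0 : 0 ≤ A := by positivity
  have hA : ∀ a ∈ Metric.ball a₀ ε, ‖a + Complex.I‖ ≤ A := by
    intro a ha
    rw [Metric.mem_ball, dist_eq_norm] at ha
    calc ‖a + Complex.I‖ = ‖(a - a₀) + a₀ + Complex.I‖ := by congr 1; ring
      _ ≤ ‖a - a₀‖ + ‖a₀‖ + ‖Complex.I‖ := norm_add₃_le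
      _ ≤ A := by rw [Complex.norm_I]; simp only [A]; linarith
  set Y := 1 + 3 * v + 4 / v
  have hY1 : 1 ≤ Y := by
    have : 0 < 4 / v := by positivity
    simp only [Y]; linarith
  set C₁ := A * (1 + A / ε₁) * 144
  set C₂ := A * (1 + A / (v / 4))
  set S := ∑' M : SL(2, ℤ), (rowWeight M)⁻¹
  have hS : 0 ≤ S := tsum_nonneg fun M => (inv_pos.mpr (rowWeight_pos M)).le
  have hC₁ : 0 ≤ C₁ := by positivity
  have hC₂ : 0 ≤ C₂ := by positivity
  have b1 : ∀ a ∈ Metric.ball a₀ ε, ∀ y : ℝ, 1 ≤ y → ∀ M : SL(2, ℤ),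
      ‖cauchyTerm k M (Complex.I * y) a‖ ≤ C₁ * (rowWeight M)⁻¹ := by
    intro a ha y hy M
    have hz : 1 ≤ (Complex.I * y).im := by simpa using hy
    have h1 := norm_cauchyTerm_le hk hε₁ hz
      (hsep a (Metric.ball_subset_ball (min_le_left _ _) ha) M y (by linarith)) (hA a ha)
    refine h1.trans ?_
    have h2 := inv_forms_le M (z := Complex.I * y) (by simp) (by linarith)
    calc _ ≤ A * (1 + A / ε₁) * (144 * (rowWeight M)⁻¹) := by gcongr
      _ = _ := by simp only [C₁]; ring
  have hR := rowConst_nonneg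
  set C₃ := C₁ * S * Y ^ (2 * k) +
    C₂ * rowConst * ((2 * k).factorial * Real.exp (2 * Real.pi * Y))
  have hC₃ : 0 ≤ C₃ := by positivity
  refine ⟨ε, hε, (Metric.ball_subset_ball (min_le_left _ _)).trans hsub, C₁ + C₃, by positivity, ?_⟩
  intro a ha y hy
  refine ⟨fun M => (b1 a ha y hy M).trans ?_, ?_⟩
  · have := inv_pos.mpr (rowWeight_pos M)
    gcongr
    linarith
  have hy0 : 0 < y := by linarith
  have hfin : ‖cauchySeries k (Complex.I * y) a‖ ≤ C₃ * (y ^ (2 * k))⁻¹ := by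
    rw [← div_eq_mul_inv, le_div_iff₀ (by positivity)]
    rcases le_or_gt y Y with hle | hgt
    · have h1 : ‖cauchySeries k (Complex.I * y) a‖ ≤ C₁ * S := by
        rw [← tsum_mul_left]
        exact tsum_of_norm_bounded (summable_inv_rowWeight.mul_left C₁).hasSum (b1 a ha y hy)
      calc _ ≤ (C₁ * S) * Y ^ (2 * k) := by gcongr
        _ ≤ C₃ := le_add_of_nonneg_right (by positivity)
    · have hsepz : ∀ (M : SL(2, ℤ)) (z : ℂ), Y ≤ z.im →
          v / 4 * ‖de M z‖ ≤ ‖nu M z - a * de M z‖ := fun M z hz =>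
        separation_of_im_large him (Metric.ball_subset_ball (min_le_right _ _) ha) hz M
      have h1 := (poincare_series_decay (t := fun M z => cauchyTerm k M z a) (C := C₂)
        (by linarith : 1 / 2 ≤ Y) (fun M z => cauchyTerm_add_one k M z a) (fun M z hz => ?_)
        (fun M z hz => norm_cauchyTerm_le hk (by positivity) (hY1.trans hz) (hsepz M z hz)
          (hA a ha)) (z := Complex.I * y) (by simpa using hgt.le)).2
      · have h2 := pow_mul_exp_le (2 * k) (Y := Y) hy0.le
        have e : (Complex.I * y).im = y := by simp
        rw [e] at h1
        calc _ ≤ C₂ * rowConst * Real.exp (-2 * Real.pi * (y - Y)) * y ^ (2 * k) := by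
              gcongr; exact h1
          _ = C₂ * rowConst * (y ^ (2 * k) * Real.exp (-2 * Real.pi * (y - Y))) := by ring
          _ ≤ C₂ * rowConst * ((2 * k).factorial * Real.exp (2 * Real.pi * Y)) := by gcongr
          _ ≤ C₃ := le_add_of_nonneg_left (by positivity)
      · have hz1 : 1 ≤ z.im := by linarith
        refine differentiableAt_cauchyTerm_left (by linarith) ?_
        rw [← norm_pos_iff]
        refine lt_of_lt_of_le ?_ (hsepz M z hz.le)
        have := one_le_de M hz1
        positivity
  refine hfin.trans ?_
  gcongr
  linarith

lemma neg_inv_I_mul {y : ℝ} : -(Complex.I * y)⁻¹ = Complex.I * ((y⁻¹ : ℝ) : ℂ) := by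
  rw [mul_inv, Complex.inv_I, neg_mul, neg_neg, Complex.ofReal_inv]

lemma norm_I_mul_pow_inv {y : ℝ} (hy : 0 < y) (m : ℕ) : ‖((Complex.I * y) ^ m)⁻¹‖ = (y ^ m)⁻¹ := by
  rw [norm_inv, norm_pow, norm_mul, Complex.norm_I, one_mul, Complex.norm_real,
    Real.norm_of_nonneg hy.le]

lemma I_mul_ne_zero {y : ℝ} (hy : 0 < y) : Complex.I * (y : ℂ) ≠ 0 :=
  mul_ne_zero Complex.I_ne_zero (Complex.ofReal_ne_zero.mpr hy.ne')

theorem summablyDominated_cauchyTerm {k : ℕ} (hk : 2 ≤ k) {y : ℝ} (hy : 0 < y) :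
    SummablyDominated goodSet (fun M => cauchyTerm k M (Complex.I * y)) := by
  refine ⟨fun M a ha => ?_, fun a ha => ?_⟩
  · obtain ⟨ε, hε, hsub, hsep⟩ := exists_separation ha
    refine (differentiableAt_cauchyTerm ?_).differentiableWithinAt
    rw [← norm_pos_iff]
    refine lt_of_lt_of_le ?_ (hsep a (Metric.mem_ball_self hε) M y hy)
    have := norm_pos_iff.mpr (de_ne_zero M (z := Complex.I * y) (by simpa using hy.ne'))
    positivity
  · obtain ⟨ε, hε, hsub, C, hC, hb⟩ := exists_cauchy_bounds hk ha
    refine ⟨ε, hε, hsub, ?_⟩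
    rcases le_or_gt 1 y with h1 | h1
    · exact ⟨_, summable_inv_rowWeight.mul_left C, fun M a' ha' => (hb a' ha' y h1).1 M⟩
    · refine ⟨_, (summable_inv_rowWeight.mul_left C).mul_left (y ^ (2 * k))⁻¹, fun M a' ha' => ?_⟩
      have h2 := (hb a' ha' y⁻¹ ((one_le_inv₀ hy).mpr h1.le)).1 (M * ModularGroup.S⁻¹)
      have h3 := cauchyTerm_mul_S (by omega : 1 ≤ k) (M * ModularGroup.S⁻¹) (I_mul_ne_zero hy) a'
      rw [inv_mul_cancel_right, neg_inv_I_mul] at h3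
      change ‖cauchyTerm k M (Complex.I * y) a'‖ ≤ _
      rw [h3, norm_mul, norm_I_mul_pow_inv hy]
      have h4 := rowWeight_mul_S (M * ModularGroup.S⁻¹)
      rw [inv_mul_cancel_right] at h4
      rw [h4]
      gcongr

lemma inv_pow_mul_pow_le {k n : ℕ} (hk : 1 ≤ k) (hn : n ≤ 2 * k - 2) {y : ℝ} (hy : 1 ≤ y) :
    (y ^ (2 * k))⁻¹ * y ^ n ≤ 2 * (1 + y ^ 2)⁻¹ := by
  have hy0 : 0 < y := by linarith
  have h1 : y ^ n * y ^ 2 ≤ y ^ (2 * k) := by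
    rw [← pow_add]; exact pow_le_pow_right₀ hy (by omega)
  have h2 : 1 + y ^ 2 ≤ 2 * y ^ 2 := by nlinarith
  rw [inv_mul_eq_div, ← div_eq_mul_inv, div_le_div_iff₀ (by positivity) (by positivity)]
  calc y ^ n * (1 + y ^ 2) ≤ y ^ n * (2 * y ^ 2) := by gcongr
    _ = 2 * (y ^ n * y ^ 2) := by ring
    _ ≤ _ := by gcongr

/-- A function of weight `2k` with decay at `∞` has integrable moments up to `2k-2`. -/
lemma moment_bound {k n : ℕ} (hk : 1 ≤ k) (hn : n ≤ 2 * k - 2) {φ : ℝ → ℂ} {C : ℝ} (hC : 0 ≤ C)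
    (hb : ∀ y, 1 ≤ y → ‖φ y‖ ≤ C * (y ^ (2 * k))⁻¹)
    (hinv : ∀ y, 0 < y → ‖φ y‖ = (y ^ (2 * k))⁻¹ * ‖φ y⁻¹‖) {y : ℝ} (hy : 0 < y) :
    ‖φ y * (y : ℂ) ^ n‖ ≤ 2 * C * (1 + y ^ 2)⁻¹ := by
  rw [norm_mul, norm_pow, Complex.norm_real, Real.norm_of_nonneg hy.le]
  rcases le_or_gt 1 y with h1 | h1
  · calc _ ≤ C * (y ^ (2 * k))⁻¹ * y ^ n := by gcongr; exact hb y h1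
      _ = C * ((y ^ (2 * k))⁻¹ * y ^ n) := by ring
      _ ≤ C * (2 * (1 + y ^ 2)⁻¹) := mul_le_mul_of_nonneg_left (inv_pow_mul_pow_le hk hn h1) hC
      _ = _ := by ring
  · have h2 := hb y⁻¹ ((one_le_inv₀ hy).mpr h1.le)
    rw [hinv y hy]
    have h3 : y ^ n ≤ 1 := pow_le_one₀ hy.le h1.le
    have h4 : 1 ≤ 2 * (1 + y ^ 2)⁻¹ := by
      rw [← div_eq_mul_inv, le_div_iff₀ (by positivity)]; nlinarith
    calc (y ^ (2 * k))⁻¹ * ‖φ y⁻¹‖ * y ^ n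
        ≤ (y ^ (2 * k))⁻¹ * (C * (y⁻¹ ^ (2 * k))⁻¹) * 1 := by gcongr
      _ = C * 1 := by
        rw [inv_pow, inv_inv]
        field_simp
      _ ≤ C * (2 * (1 + y ^ 2)⁻¹) := by gcongr
      _ = _ := by ring

lemma norm_cauchySeries_inv {k : ℕ} (hk : 1 ≤ k) (a : ℂ) {y : ℝ} (hy : 0 < y) :
    ‖cauchySeries k (Complex.I * y) a‖ =
      (y ^ (2 * k))⁻¹ * ‖cauchySeries k (Complex.I * (y⁻¹ : ℝ)) a‖ := by
  rw [cauchySeries_inv hk (I_mul_ne_zero hy), norm_mul, norm_I_mul_pow_inv hy, neg_inv_I_mul]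

instance : Countable SL(2, ℤ) := columnCoord_injective.countable

lemma aestronglyMeasurable_tsum_Ioi {F : SL(2, ℤ) → ℝ → ℂ} (hF : ∀ M, Measurable (F M))
    (hs : ∀ y, 0 < y → Summable (fun M => F M y)) :
    AEStronglyMeasurable (fun y => ∑' M, F M y) (volume.restrict (Set.Ioi (0 : ℝ))) := by
  have h1 : Measurable fun y => ∑' M, (Set.Ioi (0 : ℝ)).indicator (F M) y := by
    refine measurable_tsum (fun M => (hF M).indicator measurableSet_Ioi) fun y => ?_
    by_cases hy : y ∈ Set.Ioi (0 : ℝ)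
    · simpa [Set.indicator_of_mem hy] using hs y hy
    · simp [Set.indicator_of_notMem hy]
  refine h1.aestronglyMeasurable.congr ?_
  filter_upwards [ae_restrict_mem measurableSet_Ioi] with y hy
  simp [Set.indicator_of_mem hy]

lemma measurable_cauchyTerm (k : ℕ) (M : SL(2, ℤ)) (a : ℂ) :
    Measurable fun y : ℝ => cauchyTerm k M (Complex.I * y) a := by
  unfold cauchyTerm nu de
  fun_prop

theorem locallyDominated_cauchySeries {k n : ℕ} (hk : 2 ≤ k) (hn : n ≤ 2 * k - 2) :
    LocallyDominated (volume.restrict (Set.Ioi (0 : ℝ))) goodSet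
      (fun y a => cauchySeries k (Complex.I * y) a * (y : ℂ) ^ n) := by
  refine ⟨fun a ha => ?_, ?_, fun a ha => ?_⟩
  · refine AEStronglyMeasurable.mul ?_ (by fun_prop)
    exact aestronglyMeasurable_tsum_Ioi (fun M => measurable_cauchyTerm k M a)
      fun y hy => (summablyDominated_cauchyTerm hk hy).summable ha
  · filter_upwards [ae_restrict_mem measurableSet_Ioi] with y hy
    exact (summablyDominated_cauchyTerm hk hy).differentiableOn_tsum.mul_const _
  · obtain ⟨ε, hε, hsub, C, hC, hb⟩ := exists_cauchy_bounds hk ha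
    refine ⟨ε, hε, hsub, fun y => 2 * C * (1 + y ^ 2)⁻¹,
      (integrable_inv_one_add_sq.const_mul _).integrableOn, ?_⟩
    filter_upwards [ae_restrict_mem measurableSet_Ioi] with y hy a' ha'
    exact moment_bound (by omega) hn hC (φ := fun y => cauchySeries k (Complex.I * y) a')
      (fun y hy => (hb a' ha' y hy).2) (fun y hy => norm_cauchySeries_inv (by omega) a' hy) hy

/-! ### The moments of the Cauchy series -/

/-- The `n`-th moment of the Cauchy series along the imaginary axis. -/
def cauchyMoment (k n : ℕ) (a : ℂ) : ℂ :=
  ∫ y in Set.Ioi (0 : ℝ), cauchySeries k (Complex.I * y) a * (y : ℂ) ^ n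

lemma differentiableOn_cauchyMoment {k n : ℕ} (hk : 2 ≤ k) (hn : n ≤ 2 * k - 2) :
    DifferentiableOn ℂ (cauchyMoment k n) goodSet :=
  (locallyDominated_cauchySeries hk hn).differentiableOn_integral

lemma iteratedDeriv_mul_const' (f : ℂ → ℂ) (c : ℂ) (m : ℕ) :
    iteratedDeriv m (fun a => f a * c) = fun a => iteratedDeriv m f a * c := by
  induction m with
  | zero => simp
  | succ m ih =>
    funext a
    rw [iteratedDeriv_succ, ih, iteratedDeriv_succ, deriv_mul_const_field]

lemma iteratedDeriv_cauchyMoment {k n : ℕ} (hk : 2 ≤ k) (hn : n ≤ 2 * k - 2) (m : ℕ) {a : ℂ}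
    (ha : a ∈ goodSet) : iteratedDeriv m (cauchyMoment k n) a =
      ∫ y in Set.Ioi (0 : ℝ), iteratedDeriv m (cauchySeries k (Complex.I * y)) a * (y : ℂ) ^ n := by
  have h := (locallyDominated_cauchySeries hk hn).iteratedDeriv_integral m ha
  simp only [iteratedDeriv_mul_const'] at h
  exact h

lemma integrableOn_iteratedDeriv_cauchySeries {k n : ℕ} (hk : 2 ≤ k) (hn : n ≤ 2 * k - 2) (m : ℕ)
    {a : ℂ} (ha : a ∈ goodSet) : IntegrableOn (fun y : ℝ =>
      iteratedDeriv m (cauchySeries k (Complex.I * y)) a * (y : ℂ) ^ n) (Set.Ioi 0) := by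
  have h := ((locallyDominated_cauchySeries hk hn).iteratedDeriv m).integrable ha
  simp only [iteratedDeriv_mul_const'] at h
  exact h

lemma linearForm_ne_zero {M : SL(2, ℤ)} {a : ℂ} (ha : a ∈ goodSet) {y : ℝ} (hy : 0 < y) :
    nu M (Complex.I * y) - a * de M (Complex.I * y) ≠ 0 := by
  obtain ⟨ε, hε, hsub, hsep⟩ := exists_separation ha
  rw [← norm_pos_iff]
  refine lt_of_lt_of_le ?_ (hsep a (Metric.mem_ball_self hε) M y hy)
  have := norm_pos_iff.mpr (de_ne_zero M (z := Complex.I * y) (by simpa using hy.ne'))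
  positivity

lemma summable_kernelTerm {k : ℕ} (hk : 2 ≤ k) {a : ℂ} (ha : a ∈ goodSet) {y : ℝ} (hy : 0 < y) :
    Summable (fun M => kernelTerm k M (Complex.I * y) a) := by
  have h := (summablyDominated_cauchyTerm hk hy).summable_iteratedDeriv (2 * k - 1) ha
  have h2 := h.mul_left (((2 * k - 1).factorial : ℂ))⁻¹
  refine h2.congr fun M => ?_
  rw [iteratedDeriv_cauchyTerm_top (by omega) (linearForm_ne_zero ha hy)
    (de_ne_zero M (by simpa using hy.ne')), inv_mul_cancel_left₀]
  exact_mod_cast Nat.factorial_ne_zero _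

lemma iteratedDeriv_cauchySeries_top {k : ℕ} (hk : 2 ≤ k) {a : ℂ} (ha : a ∈ goodSet) {y : ℝ}
    (hy : 0 < y) : iteratedDeriv (2 * k - 1) (cauchySeries k (Complex.I * y)) a =
      (2 * k - 1).factorial * kernelSeries k (Complex.I * y) a := by
  rw [show cauchySeries k (Complex.I * y) = fun a => ∑' M, cauchyTerm k M (Complex.I * y) a from rfl,
    (summablyDominated_cauchyTerm hk hy).iteratedDeriv_tsum _ ha, kernelSeries, ← tsum_mul_left]
  exact tsum_congr fun M => iteratedDeriv_cauchyTerm_top (by omega) (linearForm_ne_zero ha hy)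
    (de_ne_zero M (by simpa using hy.ne'))

/-- The `n`-th moment of the kernel series along the imaginary axis. -/
def kernelMoment (k n : ℕ) (a : ℂ) : ℂ :=
  ∫ y in Set.Ioi (0 : ℝ), kernelSeries k (Complex.I * y) a * (y : ℂ) ^ n

theorem iteratedDeriv_cauchyMoment_top {k n : ℕ} (hk : 2 ≤ k) (hn : n ≤ 2 * k - 2) {a : ℂ}
    (ha : a ∈ goodSet) : iteratedDeriv (2 * k - 1) (cauchyMoment k n) a =
      (2 * k - 1).factorial * kernelMoment k n a := by
  rw [iteratedDeriv_cauchyMoment hk hn _ ha, kernelMoment, ← integral_const_mul]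
  refine setIntegral_congr_fun measurableSet_Ioi fun y hy => ?_
  simp only [iteratedDeriv_cauchySeries_top hk ha hy, mul_assoc]

lemma integrableOn_kernelSeries {k n : ℕ} (hk : 2 ≤ k) (hn : n ≤ 2 * k - 2) {a : ℂ}
    (ha : a ∈ goodSet) : IntegrableOn (fun y : ℝ =>
      kernelSeries k (Complex.I * y) a * (y : ℂ) ^ n) (Set.Ioi 0) := by
  have h := (integrableOn_iteratedDeriv_cauchySeries hk hn (2 * k - 1) ha).const_mul
    (((2 * k - 1).factorial : ℂ))⁻¹
  refine IntegrableOn.congr_fun h (fun y hy => ?_) measurableSet_Ioi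
  simp only [iteratedDeriv_cauchySeries_top hk ha hy]
  have : ((2 * k - 1).factorial : ℂ) ≠ 0 := by exact_mod_cast Nat.factorial_ne_zero _
  field_simp

/-! ### Decomposition of Petersson's series -/

lemma poincareTerm_eq {k : ℕ} (hk : 1 ≤ k) (z τ : ℍ) (M : SL(2, ℤ)) :
    poincareTerm (k : ℤ) ((k : ℤ) - 1) z τ M = (τ.im : ℂ) ^ (2 * k - 1) *
      ((nu M⁻¹ z - τ * de M⁻¹ z)⁻¹ * ((nu M⁻¹ z - conj (τ : ℂ) * de M⁻¹ z) ^ (2 * k - 1))⁻¹) := by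
  obtain ⟨j, rfl⟩ : ∃ j, k = j + 1 := ⟨k - 1, by omega⟩
  have hd : de M τ ≠ 0 := de_ne_zero M τ.im_pos.ne'
  have hd' : conj (de M τ) ≠ 0 := (map_ne_zero _).mpr hd
  have hn : conj (nu M τ) = nu M (conj (τ : ℂ)) := by simp [nu]
  have hdc : conj (de M τ) = de M (conj (τ : ℂ)) := by simp [de]
  have hd2 : de M (conj (τ : ℂ)) ≠ 0 := hdc ▸ hd'
  have him : (((M • τ).im : ℝ) : ℂ) = τ.im / (de M τ * de M (conj (τ : ℂ))) := by
    rw [← hdc, ModularGroup.im_smul_eq_div_normSq, denom_eq_de, Complex.mul_conj]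
    push_cast
    rfl
  rw [poincareTerm, ModularForm.SL_slash_apply, him, coe_smul_eq, denom_eq_de, map_div₀,
    linearForm_inv, linearForm_inv, hn, hdc]
  rw [show ((j + 1 : ℕ) : ℤ) + ((j + 1 : ℕ) - 1) = ((2 * j + 1 : ℕ) : ℤ) by push_cast; ring,
    show ((j + 1 : ℕ) : ℤ) - 1 - ((j + 1 : ℕ) : ℤ) = -1 by ring,
    show -(((j + 1 : ℕ) : ℤ) - 1) - ((j + 1 : ℕ) : ℤ) = -((2 * j + 1 : ℕ) : ℤ) by push_cast; ring,
    show -(-2 * (((j + 1 : ℕ) : ℤ) - 1)) = ((2 * j : ℕ) : ℤ) by push_cast; ring,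
    show 2 * (j + 1) - 1 = 2 * j + 1 by omega, zpow_neg, zpow_neg, zpow_one, zpow_natCast,
    zpow_natCast, zpow_natCast]
  rw [show (z : ℂ) - nu M τ / de M τ = -(nu M τ - z * de M τ) / de M τ by field_simp; ring,
    show (z : ℂ) - nu M (conj (τ : ℂ)) / de M (conj (τ : ℂ)) =
      -(nu M (conj (τ : ℂ)) - z * de M (conj (τ : ℂ))) / de M (conj (τ : ℂ)) by field_simp; ring]
  generalize -(nu M τ - z * de M τ) = p
  generalize -(nu M (conj (τ : ℂ)) - z * de M (conj (τ : ℂ))) = p'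
  generalize de M (conj (τ : ℂ)) = d' at hd2 ⊢
  generalize de M τ = d at hd ⊢
  rw [inv_div, div_pow, div_pow, inv_div, mul_pow]
  field_simp
  ring

lemma geom_sum_inv {L L' X : ℂ} (hL : L ≠ 0) (hL' : L' ≠ 0) (hX : L' - L = X) (m : ℕ) :
    ∑ j ∈ Finset.range m, X ^ j * (L' ^ (j + 1))⁻¹ + X ^ m * (L⁻¹ * (L' ^ m)⁻¹) = L⁻¹ := by
  induction m with
  | zero => simp
  | succ m ih =>
    rw [Finset.sum_range_succ, add_assoc]
    refine Eq.trans ?_ ih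
    congr 1
    rw [← hX]
    field_simp
    ring

lemma cauchyTerm_taylor {k : ℕ} {M : SL(2, ℤ)} {z a b : ℂ} (hde : de M z ≠ 0)
    (ha : nu M z - a * de M z ≠ 0) (hb : nu M z - b * de M z ≠ 0) (hk : 1 ≤ k) :
    cauchyTerm k M z a - ∑ j ∈ Finset.range (2 * k - 1),
      (a - b) ^ j / j.factorial * iteratedDeriv j (cauchyTerm k M z) b =
    (a - b) ^ (2 * k - 1) *
      ((nu M z - a * de M z)⁻¹ * ((nu M z - b * de M z) ^ (2 * k - 1))⁻¹) := by
  obtain ⟨m, hm⟩ : ∃ m, 2 * k - 1 = m + 1 := ⟨2 * k - 2, by omega⟩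
  have hX : (nu M z - b * de M z) - (nu M z - a * de M z) = (a - b) * de M z := by ring
  have hg := geom_sum_inv ha hb hX (2 * k - 1)
  have hsum : ∑ j ∈ Finset.range (2 * k - 1),
      (a - b) ^ j / j.factorial * iteratedDeriv j (cauchyTerm k M z) b =
      ((de M z) ^ (2 * k - 1))⁻¹ * (∑ j ∈ Finset.range (2 * k - 1),
        ((a - b) * de M z) ^ j * ((nu M z - b * de M z) ^ (j + 1))⁻¹ -
        (nu M z + Complex.I * de M z)⁻¹) := by
    rw [hm, Finset.sum_range_succ', Finset.sum_range_succ', add_sub_assoc, mul_add, Finset.mul_sum]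
    congr 1
    · refine Finset.sum_congr rfl fun j _ => ?_
      rw [iteratedDeriv_cauchyTerm_succ hb, hm]
      have : ((j + 1).factorial : ℂ) ≠ 0 := by exact_mod_cast Nat.factorial_ne_zero _
      rw [mul_pow]
      field_simp
    · simp [cauchyTerm, hm]
  rw [hsum, cauchyTerm, ← mul_sub, sub_sub_sub_cancel_right, sub_eq_of_eq_add' hg.symm, mul_pow,
    mul_comm ((a - b) ^ (2 * k - 1)), mul_assoc, inv_mul_cancel_left₀ (pow_ne_zero _ hde)]

lemma conj_mem_goodSet (τ : ℍ) : conj (τ : ℂ) ∈ goodSet := by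
  refine Or.inl ?_
  have := τ.im_pos
  simpa using this

lemma coe_imPoint {y : ℝ} (hy : 0 < y) : ((imPoint y : ℍ) : ℂ) = Complex.I * y := by
  rw [imPoint, UpperHalfPlane.ofComplex_apply_of_im_pos (by simpa using hy)]

lemma sub_conj_eq (τ : ℍ) : (τ : ℂ) - conj (τ : ℂ) = 2 * Complex.I * τ.im := by
  rw [Complex.sub_conj]
  simp
  ring

/-- The non-holomorphic combination of derivatives of a function that occurs in the theorem. -/
def taylorDefect (N : ℕ) (f : ℂ → ℂ) (a b : ℂ) : ℂ :=
  f a - ∑ j ∈ Finset.range N, (a - b) ^ j / j.factorial * iteratedDeriv j f b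

theorem hasSum_poincareTerm {k : ℕ} (hk : 2 ≤ k) {τ : ℍ} (hτ : (τ : ℂ) ∈ goodSet) {y : ℝ}
    (hy : 0 < y) : HasSum (fun M => poincareTerm (k : ℤ) ((k : ℤ) - 1) (imPoint y) τ M)
      (((2 * Complex.I) ^ (2 * k - 1))⁻¹ *
        taylorDefect (2 * k - 1) (cauchySeries k (Complex.I * y)) τ (conj (τ : ℂ))) := by
  have hdom := summablyDominated_cauchyTerm hk hy
  have hσ := conj_mem_goodSet τ
  have h1 : HasSum (fun M => taylorDefect (2 * k - 1) (cauchyTerm k M (Complex.I * y)) τ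
      (conj (τ : ℂ)))
      (taylorDefect (2 * k - 1) (cauchySeries k (Complex.I * y)) τ (conj (τ : ℂ))) := by
    refine (hdom.summable hτ).hasSum.sub (hasSum_sum fun j _ => ?_)
    refine HasSum.mul_left _ ?_
    have h2 := (hdom.summable_iteratedDeriv j hσ).hasSum
    rwa [← hdom.iteratedDeriv_tsum j hσ] at h2
  have h3 := h1.mul_left ((2 * Complex.I) ^ (2 * k - 1))⁻¹
  rw [← (Equiv.inv SL(2, ℤ)).hasSum_iff] at h3
  refine h3.congr_fun ?_
  intro M
  rw [poincareTerm_eq (by omega), coe_imPoint hy]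
  simp only [Function.comp, Equiv.inv_apply, taylorDefect]
  rw [cauchyTerm_taylor (de_ne_zero _ (by simpa using hy.ne')) (linearForm_ne_zero hτ hy)
    (linearForm_ne_zero hσ hy) (by omega), sub_conj_eq,
    mul_pow (2 * Complex.I), mul_assoc, inv_mul_cancel_left₀ (pow_ne_zero _ (by simp))]

lemma curlyHIntegrand_eq {k n : ℕ} (hk : 2 ≤ k) {τ : ℍ} (hτ : (τ : ℂ) ∈ goodSet) {y : ℝ}
    (hy : 0 < y) : curlyHIntegrand k n τ y = ((2 * Complex.I) ^ (2 * k - 1))⁻¹ *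
      (cauchySeries k (Complex.I * y) τ * (y : ℂ) ^ n - ∑ j ∈ Finset.range (2 * k - 1),
        ((τ : ℂ) - conj (τ : ℂ)) ^ j / j.factorial *
          (iteratedDeriv j (cauchySeries k (Complex.I * y)) (conj (τ : ℂ)) * (y : ℂ) ^ n)) := by
  rw [curlyHIntegrand, poincare, (hasSum_poincareTerm hk hτ hy).tsum_eq, taylorDefect, mul_assoc,
    sub_mul, Finset.sum_mul]
  simp only [mul_assoc]

theorem integrableOn_curlyHIntegrand {k n : ℕ} (hk : 2 ≤ k) (hn : n ≤ 2 * k - 2) {τ : ℍ}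
    (hτ : (τ : ℂ) ∈ goodSet) : IntegrableOn (curlyHIntegrand k n τ) (Set.Ioi 0) := by
  refine IntegrableOn.congr_fun ?_ (fun y hy => (curlyHIntegrand_eq hk hτ hy).symm)
    measurableSet_Ioi
  have h0 := integrableOn_iteratedDeriv_cauchySeries hk hn 0 hτ
  simp only [iteratedDeriv_zero] at h0
  refine Integrable.const_mul (Integrable.sub h0 ?_) _
  exact integrable_finsetSum _ fun j _ =>
      (integrableOn_iteratedDeriv_cauchySeries hk hn j (conj_mem_goodSet τ)).const_mul _

lemma integral_curlyHIntegrand {k n : ℕ} (hk : 2 ≤ k) (hn : n ≤ 2 * k - 2) {τ : ℍ}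
    (hτ : (τ : ℂ) ∈ goodSet) : ∫ y in Set.Ioi 0, curlyHIntegrand k n τ y =
      ((2 * Complex.I) ^ (2 * k - 1))⁻¹ *
        taylorDefect (2 * k - 1) (cauchyMoment k n) τ (conj (τ : ℂ)) := by
  have hσ := conj_mem_goodSet τ
  have h0 := integrableOn_iteratedDeriv_cauchySeries hk hn 0 hτ
  simp only [iteratedDeriv_zero] at h0
  rw [setIntegral_congr_fun measurableSet_Ioi (fun y hy => curlyHIntegrand_eq hk hτ hy),
    integral_const_mul, integral_sub, integral_finsetSum, taylorDefect]
  · congr 2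
    refine Finset.sum_congr rfl fun j _ => ?_
    rw [integral_const_mul, iteratedDeriv_cauchyMoment hk hn j hσ]
  · exact fun j _ => (integrableOn_iteratedDeriv_cauchySeries hk hn j hσ).const_mul _
  · exact h0
  · exact integrable_finsetSum _ fun j _ =>
      (integrableOn_iteratedDeriv_cauchySeries hk hn j hσ).const_mul _

lemma truncatedAxis_eq {τ : ℍ} (hτ : τ ∉ exceptionalSet) (ε : ℝ) :
    truncatedAxis τ ε = Set.Ioi 0 := by
  ext y
  simp only [truncatedAxis, Set.mem_ofPred_eq, Set.mem_Ioi, and_iff_left_iff_imp]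
  intro _ M hM
  refine absurd ?_ hτ
  exact Set.mem_iUnion.mpr ⟨M⁻¹, M • τ, hM, by simp⟩

theorem curlyH_eq {k n : ℕ} (hk : 2 ≤ k) (hn : n ≤ 2 * k - 2) {τ : ℍ} (hτ : (τ : ℂ) ∈ goodSet) :
    curlyH k n τ = (4 * (Real.pi : ℂ) * Complex.I)⁻¹ *
      taylorDefect (2 * k - 1) (cauchyMoment k n) τ (conj (τ : ℂ)) := by
  have hτ' := (not_mem_exceptionalSet_iff τ).mpr hτ
  simp only [curlyH, truncatedAxis_eq hτ']
  rw [tendsto_const_nhds.limUnder_eq, integral_curlyHIntegrand hk hn hτ,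
    show 2 * k - 1 = 2 * k - 2 + 1 by omega, pow_succ]
  have h1 : ((2 * Complex.I) ^ (2 * k - 2) : ℂ) ≠ 0 := pow_ne_zero _ (by simp)
  have h2 : (Real.pi : ℂ) ≠ 0 := Complex.ofReal_ne_zero.mpr Real.pi_ne_zero
  field_simp
  ring

/-! ### Wirtinger calculus -/

/-- `F` has Wirtinger derivatives `p = ∂F/∂w` and `q = ∂F/∂(conj w)` at `w`. -/
def HasWirtingerAt (F : ℂ → ℂ) (p q w : ℂ) : Prop :=
  HasFDerivAt F (p • (ContinuousLinearMap.id ℝ ℂ) + q • (Complex.conjCLE : ℂ →L[ℝ] ℂ)) w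

namespace HasWirtingerAt

variable {F G : ℂ → ℂ} {p q p' q' w : ℂ}

lemma of_holomorphic (h : HasDerivAt F p w) : HasWirtingerAt F p 0 w := by
  have := h.hasFDerivAt.restrictScalars ℝ
  refine this.congr_fderiv ?_
  ext; simp [mul_comm]

lemma of_antiholomorphic (h : HasDerivAt F q (conj w)) :
    HasWirtingerAt (fun w => F (conj w)) 0 q w := by
  have h1 := h.hasFDerivAt.restrictScalars ℝ
  have h2 : HasFDerivAt (fun w : ℂ => conj w) (Complex.conjCLE : ℂ →L[ℝ] ℂ) w :=
    Complex.conjCLE.hasFDerivAt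
  refine (HasFDerivAt.comp (g := F) w h1 h2).congr_fderiv ?_
  ext; simp [mul_comm]

lemma mul (hF : HasWirtingerAt F p q w) (hG : HasWirtingerAt G p' q' w) :
    HasWirtingerAt (fun w => F w * G w) (F w * p' + G w * p) (F w * q' + G w * q) w := by
  refine (HasFDerivAt.mul hF hG).congr_fderiv ?_
  ext
  simp
  ring

lemma const_mul (hF : HasWirtingerAt F p q w) (c : ℂ) :
    HasWirtingerAt (fun w => c * F w) (c * p) (c * q) w := by
  refine (HasFDerivAt.const_mul hF c).congr_fderiv ?_
  ext
  simp
  ring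

lemma sub (hF : HasWirtingerAt F p q w) (hG : HasWirtingerAt G p' q' w) :
    HasWirtingerAt (fun w => F w - G w) (p - p') (q - q') w := by
  refine (HasFDerivAt.sub hF hG).congr_fderiv ?_
  ext
  simp
  ring

lemma sum {ι : Type*} {s : Finset ι} {F : ι → ℂ → ℂ} {p q : ι → ℂ}
    (h : ∀ i ∈ s, HasWirtingerAt (F i) (p i) (q i) w) :
    HasWirtingerAt (fun w => ∑ i ∈ s, F i w) (∑ i ∈ s, p i) (∑ i ∈ s, q i) w := by
  refine (HasFDerivAt.fun_sum h).congr_fderiv ?_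
  ext; simp [Finset.sum_add_distrib, Finset.sum_mul]

lemma pow_sub_conj (j : ℕ) (w : ℂ) : HasWirtingerAt (fun w => (w - conj w) ^ j)
    (j * (w - conj w) ^ (j - 1)) (-(j * (w - conj w) ^ (j - 1))) w := by
  have h1 := (of_holomorphic (hasDerivAt_id w)).sub (of_antiholomorphic (hasDerivAt_id (conj w)))
  refine (HasFDerivAt.pow h1 j).congr_fderiv ?_
  ext; simp

lemma dTau_eq {f : ℍ → ℂ} {τ : ℍ} (h : HasWirtingerAt (f ∘ UpperHalfPlane.ofComplex) p q τ) :
    dTau f τ = p := by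
  rw [dTau, h.fderiv]
  simp
  linear_combination ((q - p) / 2) * Complex.I_mul_I

lemma dTauBar_eq {f : ℍ → ℂ} {τ : ℍ} (h : HasWirtingerAt (f ∘ UpperHalfPlane.ofComplex) p q τ) :
    dTauBar f τ = q := by
  rw [dTauBar, h.fderiv]
  simp
  linear_combination ((p - q) / 2) * Complex.I_mul_I

end HasWirtingerAt

/-- The `m`-th holomorphic derivative of `taylorDefect N f w (conj w)`. -/
def taylorDefectDeriv (N m : ℕ) (f : ℂ → ℂ) (w : ℂ) : ℂ :=
  iteratedDeriv m f w - ∑ j ∈ Finset.range N,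
    (j.descFactorial m / j.factorial : ℂ) * ((w - conj w) ^ (j - m) * iteratedDeriv j f (conj w))

lemma hasDerivAt_iteratedDeriv {f : ℂ → ℂ} {U : Set ℂ} (hU : IsOpen U)
    (hf : DifferentiableOn ℂ f U) (m : ℕ) {w : ℂ} (hw : w ∈ U) :
    HasDerivAt (iteratedDeriv m f) (iteratedDeriv (m + 1) f w) w := by
  have h1 : ∀ m, DifferentiableOn ℂ (iteratedDeriv m f) U := by
    intro m
    induction m with
    | zero => simpa using hf
    | succ m ih => simpa only [iteratedDeriv_succ] using ih.deriv hU
  rw [iteratedDeriv_succ]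
  exact ((h1 m).differentiableAt (hU.mem_nhds hw)).hasDerivAt

lemma hasWirtingerAt_taylorDefectDeriv {f : ℂ → ℂ} {U : Set ℂ} (hU : IsOpen U)
    (hf : DifferentiableOn ℂ f U) (N m : ℕ) {w : ℂ} (hw : w ∈ U) (hw' : conj w ∈ U) :
    HasWirtingerAt (taylorDefectDeriv N m f) (taylorDefectDeriv N (m + 1) f w)
      (∑ j ∈ Finset.range N, (j.descFactorial m / j.factorial : ℂ) *
        (((j - m : ℕ) : ℂ) * (w - conj w) ^ (j - m - 1) * iteratedDeriv j f (conj w) -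
          (w - conj w) ^ (j - m) * iteratedDeriv (j + 1) f (conj w))) w := by
  have h1 := HasWirtingerAt.of_holomorphic (hasDerivAt_iteratedDeriv hU hf m hw)
  have h2 := HasWirtingerAt.sum (s := Finset.range N) fun j _ =>
    ((HasWirtingerAt.pow_sub_conj (j - m) w).mul (HasWirtingerAt.of_antiholomorphic
      (hasDerivAt_iteratedDeriv hU hf j hw'))).const_mul (j.descFactorial m / j.factorial : ℂ)
  have h3 := h1.sub h2
  have e1 : taylorDefectDeriv N (m + 1) f w = iteratedDeriv (m + 1) f w -
      ∑ j ∈ Finset.range N, (j.descFactorial m / j.factorial : ℂ) *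
        ((w - conj w) ^ (j - m) * 0 + iteratedDeriv j f (conj w) *
          (((j - m : ℕ) : ℂ) * (w - conj w) ^ (j - m - 1))) := by
    rw [taylorDefectDeriv]
    congr 1
    refine Finset.sum_congr rfl fun j _ => ?_
    rw [Nat.descFactorial_succ, Nat.sub_sub]
    push_cast
    ring
  rw [e1]
  convert h3 using 1
  · rfl
  rw [zero_sub, ← Finset.sum_neg_distrib]
  refine Finset.sum_congr rfl fun j _ => ?_
  ring

lemma curlyH_comp_eventuallyEq {k n : ℕ} (hk : 2 ≤ k) (hn : n ≤ 2 * k - 2) {τ : ℍ}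
    (hτ : (τ : ℂ) ∈ goodSet) : curlyH k n ∘ UpperHalfPlane.ofComplex =ᶠ[𝓝 (τ : ℂ)] fun w =>
      (4 * (Real.pi : ℂ) * Complex.I)⁻¹ *
        taylorDefect (2 * k - 1) (cauchyMoment k n) w (conj w) := by
  filter_upwards [isOpen_goodSet.mem_nhds hτ,
    (isOpen_lt continuous_const Complex.continuous_im).mem_nhds τ.im_pos] with w hw him
  have h1 : ((UpperHalfPlane.ofComplex w : ℍ) : ℂ) = w := by
    rw [UpperHalfPlane.ofComplex_apply_of_im_pos him]
  rw [Function.comp, curlyH_eq hk hn (by rwa [h1]), h1]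

lemma dOp_iterate_curlyH {k n : ℕ} (hk : 2 ≤ k) (hn : n ≤ 2 * k - 2) (m : ℕ) {τ : ℍ}
    (hτ : (τ : ℂ) ∈ goodSet) : (dOp^[m]) (curlyH k n) τ =
      (1 / (2 * (Real.pi : ℂ) * Complex.I)) ^ m * ((4 * (Real.pi : ℂ) * Complex.I)⁻¹ *
        taylorDefectDeriv (2 * k - 1) m (cauchyMoment k n) τ) := by
  induction m generalizing τ with
  | zero =>
    rw [Function.iterate_zero, id, curlyH_eq hk hn hτ]
    simp [taylorDefectDeriv, taylorDefect, div_eq_mul_inv]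
    refine Finset.sum_congr rfl fun j _ => by ring
  | succ m ih =>
    rw [Function.iterate_succ_apply', dOp]
    have hw := ((hasWirtingerAt_taylorDefectDeriv isOpen_goodSet
      (differentiableOn_cauchyMoment hk hn) (2 * k - 1) m hτ (conj_mem_goodSet τ)).const_mul
        ((4 * (Real.pi : ℂ) * Complex.I)⁻¹)).const_mul ((1 / (2 * (Real.pi : ℂ) * Complex.I)) ^ m)
    have hev : (dOp^[m]) (curlyH k n) ∘ UpperHalfPlane.ofComplex =ᶠ[𝓝 (τ : ℂ)] fun w =>
        (1 / (2 * (Real.pi : ℂ) * Complex.I)) ^ m * ((4 * (Real.pi : ℂ) * Complex.I)⁻¹ *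
        taylorDefectDeriv (2 * k - 1) m (cauchyMoment k n) w) := by
      filter_upwards [isOpen_goodSet.mem_nhds hτ,
        (isOpen_lt continuous_const Complex.continuous_im).mem_nhds τ.im_pos] with w hw him
      have h1 : ((UpperHalfPlane.ofComplex w : ℍ) : ℂ) = w := by
        rw [UpperHalfPlane.ofComplex_apply_of_im_pos him]
      rw [Function.comp, ih (by rwa [h1]), h1]
    rw [HasWirtingerAt.dTau_eq (HasFDerivAt.congr_of_eventuallyEq hw hev), pow_succ]
    ring

theorem dOp_iterate_curlyH_top {k n : ℕ} (hk : 2 ≤ k) (hn : n ≤ 2 * k - 2) {τ : ℍ}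
    (hτ : (τ : ℂ) ∈ goodSet) : (dOp^[2 * k - 1]) (curlyH k n) τ =
      (1 / (2 * (Real.pi : ℂ) * Complex.I)) ^ (2 * k - 1) * ((4 * (Real.pi : ℂ) * Complex.I)⁻¹ *
        ((2 * k - 1).factorial * kernelMoment k n τ)) := by
  rw [dOp_iterate_curlyH hk hn _ hτ, taylorDefectDeriv, iteratedDeriv_cauchyMoment_top hk hn hτ,
    Finset.sum_eq_zero, sub_zero]
  intro j hj
  rw [Nat.descFactorial_eq_zero_iff_lt.mpr (Finset.mem_range.mp hj)]
  simp

lemma dTauBar_curlyH {k n : ℕ} (hk : 2 ≤ k) (hn : n ≤ 2 * k - 2) {τ : ℍ}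
    (hτ : (τ : ℂ) ∈ goodSet) : dTauBar (curlyH k n) τ = -((4 * (Real.pi : ℂ) * Complex.I)⁻¹ *
      ((2 * k - 1 : ℕ) * (2 * Complex.I * τ.im) ^ (2 * k - 2) *
        kernelMoment k n (conj (τ : ℂ)))) := by
  have hσ := conj_mem_goodSet τ
  have hw := (hasWirtingerAt_taylorDefectDeriv isOpen_goodSet
      (differentiableOn_cauchyMoment hk hn) (2 * k - 1) 0 hτ hσ).const_mul
        ((4 * (Real.pi : ℂ) * Complex.I)⁻¹)
  have hev : curlyH k n ∘ UpperHalfPlane.ofComplex =ᶠ[𝓝 (τ : ℂ)] fun w =>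
      (4 * (Real.pi : ℂ) * Complex.I)⁻¹ *
        taylorDefectDeriv (2 * k - 1) 0 (cauchyMoment k n) w := by
    filter_upwards [curlyH_comp_eventuallyEq hk hn hτ] with w hw
    rw [hw, taylorDefect, taylorDefectDeriv]
    simp [div_eq_mul_inv]
    refine Finset.sum_congr rfl fun j _ => by ring
  rw [HasWirtingerAt.dTauBar_eq (HasFDerivAt.congr_of_eventuallyEq hw hev), ← mul_neg]
  congr 1
  let t : ℕ → ℂ := fun j => (j : ℂ) * ((τ : ℂ) - conj (τ : ℂ)) ^ (j - 1) / j.factorial *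
    iteratedDeriv j (cauchyMoment k n) (conj (τ : ℂ))
  have ht : ∀ j ∈ Finset.range (2 * k - 1), (j.descFactorial 0 / j.factorial : ℂ) *
        (((j - 0 : ℕ) : ℂ) * ((τ : ℂ) - conj (τ : ℂ)) ^ (j - 0 - 1) *
          iteratedDeriv j (cauchyMoment k n) (conj (τ : ℂ)) -
          ((τ : ℂ) - conj (τ : ℂ)) ^ (j - 0) *
            iteratedDeriv (j + 1) (cauchyMoment k n) (conj (τ : ℂ))) = -(t (j + 1) - t j) := by
    intro j _
    have h1 : (j.factorial : ℂ) ≠ 0 := by exact_mod_cast Nat.factorial_ne_zero _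
    have h2 : ((j : ℂ) + 1) ≠ 0 := by exact_mod_cast Nat.succ_ne_zero j
    simp only [t, Nat.descFactorial_zero, Nat.sub_zero, Nat.add_sub_cancel, Nat.factorial_succ]
    push_cast
    field_simp
    ring
  rw [Finset.sum_congr rfl ht, Finset.sum_neg_distrib, Finset.sum_range_sub]
  congr 1
  simp only [t]
  rw [iteratedDeriv_cauchyMoment_top hk hn hσ, sub_conj_eq, show 2 * k - 1 - 1 = 2 * k - 2 by omega]
  have h1 : ((2 * k - 1).factorial : ℂ) ≠ 0 := by exact_mod_cast Nat.factorial_ne_zero _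
  field_simp
  simp

theorem contDiffAt_curlyH {k n : ℕ} (hk : 2 ≤ k) (hn : n ≤ 2 * k - 2) {τ : ℍ}
    (hτ : (τ : ℂ) ∈ goodSet) :
    ContDiffAt ℝ ∞ (curlyH k n ∘ UpperHalfPlane.ofComplex) (τ : ℂ) := by
  have hσ := conj_mem_goodSet τ
  have hd := differentiableOn_cauchyMoment hk hn
  have h1 : ∀ m, ∀ w ∈ goodSet, ContDiffAt ℝ ∞ (iteratedDeriv m (cauchyMoment k n)) w := by
    intro m w hw
    have h2 : DifferentiableOn ℂ (iteratedDeriv m (cauchyMoment k n)) goodSet := fun w hw =>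
      (hasDerivAt_iteratedDeriv isOpen_goodSet hd m hw).differentiableAt.differentiableWithinAt
    exact ((h2.analyticAt (isOpen_goodSet.mem_nhds hw)).contDiffAt (n := ∞)).restrict_scalars ℝ
  have hconj : ContDiffAt ℝ ∞ (fun w : ℂ => conj w) τ := Complex.conjCLE.contDiff.contDiffAt
  refine ContDiffAt.congr_of_eventuallyEq ?_ (curlyH_comp_eventuallyEq hk hn hτ)
  unfold taylorDefect
  refine contDiffAt_const.mul (ContDiffAt.sub (by simpa using h1 0 τ hτ) ?_)
  refine ContDiffAt.sum fun j _ => ContDiffAt.mul ?_ ?_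
  · exact ((contDiffAt_id.sub hconj).pow j).div_const _
  · exact ContDiffAt.comp (g := iteratedDeriv j (cauchyMoment k n)) (τ : ℂ) (h1 j _ hσ) hconj

/-! ### The moment as a function on the lower half-plane -/

lemma kernelTerm_moebius (k : ℕ) (γ M : SL(2, ℤ)) (z a : ℂ) (ha : de γ a ≠ 0) :
    kernelTerm k M z (nu γ a / de γ a) = de γ a ^ (2 * k) * kernelTerm k (γ⁻¹ * M) z a := by
  have h : nu M z - nu γ a / de γ a * de M z =
      (nu (γ⁻¹ * M) z - a * de (γ⁻¹ * M) z) / de γ a := by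
    rw [eq_div_iff ha, sub_mul, mul_right_comm, div_mul_cancel₀ _ ha]
    simp only [nu, de, mul_entry]
    simp [Matrix.SpecialLinearGroup.SL2_inv_expl]
    ring
  rw [kernelTerm, kernelTerm, h, div_pow, inv_div, div_eq_mul_inv]

lemma kernelSeries_moebius (k : ℕ) (γ : SL(2, ℤ)) (z a : ℂ) (ha : de γ a ≠ 0) :
    kernelSeries k z (nu γ a / de γ a) = de γ a ^ (2 * k) * kernelSeries k z a := by
  rw [kernelSeries, kernelSeries, ← tsum_mul_left,
    ← (Equiv.mulLeft γ⁻¹).tsum_eq (fun M => de γ a ^ (2 * k) * kernelTerm k M z a)]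
  exact tsum_congr fun M => kernelTerm_moebius k γ M z a ha

lemma kernelMoment_moebius (k n : ℕ) (γ : SL(2, ℤ)) (a : ℂ) (ha : de γ a ≠ 0) :
    kernelMoment k n (nu γ a / de γ a) = de γ a ^ (2 * k) * kernelMoment k n a := by
  simp only [kernelMoment, kernelSeries_moebius k γ _ a ha, mul_assoc, integral_const_mul]

lemma conj_nu (M : SL(2, ℤ)) (z : ℂ) : conj (nu M z) = nu M (conj z) := by simp [nu]

lemma conj_de (M : SL(2, ℤ)) (z : ℂ) : conj (de M z) = de M (conj z) := by simp [de]

/-- The moment of the kernel series, reflected to the upper half-plane. -/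
def dualMoment (k n : ℕ) (τ : ℂ) : ℂ := conj (kernelMoment k n (conj τ))

lemma dualMoment_smul (k n : ℕ) (γ : SL(2, ℤ)) (τ : ℍ) :
    dualMoment k n (γ • τ : ℍ) = de γ τ ^ (2 * k) * dualMoment k n τ := by
  have hd := de_ne_zero γ τ.im_pos.ne'
  rw [dualMoment, dualMoment, coe_smul_eq, map_div₀, conj_nu, conj_de, kernelMoment_moebius,
    map_mul, map_pow, conj_de, Complex.conj_conj]
  rwa [← conj_de, map_ne_zero]

lemma differentiableAt_kernelMoment {k n : ℕ} (hk : 2 ≤ k) (hn : n ≤ 2 * k - 2) {a : ℂ}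
    (ha : a ∈ goodSet) : DifferentiableAt ℂ (kernelMoment k n) a := by
  have h1 := (hasDerivAt_iteratedDeriv isOpen_goodSet (differentiableOn_cauchyMoment hk hn)
    (2 * k - 1) ha).differentiableAt.const_mul (((2 * k - 1).factorial : ℂ))⁻¹
  refine h1.congr_of_eventuallyEq ?_
  filter_upwards [isOpen_goodSet.mem_nhds ha] with b hb
  rw [iteratedDeriv_cauchyMoment_top hk hn hb, inv_mul_cancel_left₀]
  exact_mod_cast Nat.factorial_ne_zero _

lemma differentiableAt_dualMoment {k n : ℕ} (hk : 2 ≤ k) (hn : n ≤ 2 * k - 2) {τ : ℂ}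
    (hτ : 0 < τ.im) : DifferentiableAt ℂ (dualMoment k n) τ := by
  have h := differentiableAt_kernelMoment hk hn (a := conj τ) (conj_mem_goodSet ⟨τ, hτ⟩)
  have h2 := DifferentiableAt.conj_conj h
  rwa [Complex.conj_conj] at h2

/-! ### Bounds in the lower half-plane -/

lemma norm_kernelTerm_le_of_strip {k : ℕ} (hk : 2 ≤ k) (M : SL(2, ℤ)) {z τ : ℂ} (hz : 1 ≤ z.im)
    (hre : |τ.re| ≤ 1 / 2) (him : 1 / 2 ≤ τ.im) :
    ‖kernelTerm k M z (conj τ)‖ ≤ 5 ^ (2 * k) * (‖de M z‖ ^ 2 * ‖nu M z‖ ^ 2)⁻¹ := by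
  refine (norm_kernelTerm_le hk M hz (by simp; linarith)).trans ?_
  have h1 : ‖conj τ + Complex.I‖ ≤ 4 * τ.im := by
    refine (Complex.norm_le_abs_re_add_abs_im _).trans ?_
    simp only [Complex.add_re, Complex.conj_re, Complex.I_re, add_zero, Complex.add_im,
      Complex.conj_im, Complex.I_im]
    have : |(-τ.im + 1)| ≤ 3 * τ.im := abs_le.mpr ⟨by linarith, by linarith⟩
    linarith
  have h2 : 1 + ‖conj τ + Complex.I‖ / -(conj τ).im ≤ 5 := by
    rw [Complex.conj_im, neg_neg]
    have : ‖conj τ + Complex.I‖ / τ.im ≤ 4 := (div_le_iff₀ (by linarith)).mpr h1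
    linarith
  have h3 : 0 ≤ 1 + ‖conj τ + Complex.I‖ / -(conj τ).im := by
    rw [Complex.conj_im, neg_neg]
    have : 0 < τ.im := by linarith
    positivity
  gcongr

lemma linearForm_ne_zero_of_im {M : SL(2, ℤ)} {z a : ℂ} (hz : 0 < z.im) (ha : a.im < 0) :
    nu M z - a * de M z ≠ 0 := by
  rw [← norm_pos_iff]
  have := norm_pos_iff.mpr (de_ne_zero M hz.ne')
  have h0 : 0 < -a.im := by linarith
  exact lt_of_lt_of_le (by positivity) (separation_of_im_neg M hz)

lemma norm_kernelSeries_le_exp {k : ℕ} (hk : 2 ≤ k) {z a : ℂ} (hz : 1 ≤ z.im) (ha : a.im < 0) :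
    ‖kernelSeries k z a‖ ≤ (1 + ‖a + Complex.I‖ / -a.im) ^ (2 * k) * rowConst *
      Real.exp (-2 * Real.pi * (z.im - 1)) :=
  (poincare_series_decay (t := fun M z => kernelTerm k M z a) (by norm_num)
    (fun M z => kernelTerm_add_one k M z a)
    (fun M z hz => differentiableAt_kernelTerm_left (linearForm_ne_zero_of_im (by linarith) ha))
    (fun M z hz => norm_kernelTerm_le hk M hz ha) hz).2

/-- The constant in the bound for the kernel series on the strip. -/
def seriesConst (k : ℕ) : ℝ :=
  5 ^ (2 * k) * rowConst * ((2 * k).factorial * Real.exp (2 * Real.pi * 1))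

lemma seriesConst_nonneg (k : ℕ) : 0 ≤ seriesConst k := by
  have := rowConst_nonneg
  unfold seriesConst
  positivity

lemma norm_kernelSeries_le_of_strip {k : ℕ} (hk : 2 ≤ k) {τ : ℂ}
    (hre : |τ.re| ≤ 1 / 2) (him : 1 / 2 ≤ τ.im) {y : ℝ} (hy : 1 ≤ y) :
    ‖kernelSeries k (Complex.I * y) (conj τ)‖ ≤ seriesConst k * (y ^ (2 * k))⁻¹ := by
  have hneg : (conj τ).im < 0 := by simp; linarith
  have h1 := (poincare_series_decay (t := fun M z => kernelTerm k M z (conj τ)) (Y := 1)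
    (by norm_num) (fun M z => kernelTerm_add_one k M z _)
    (fun M z hz => differentiableAt_kernelTerm_left
      (linearForm_ne_zero_of_im (by linarith) hneg))
    (fun M z hz => norm_kernelTerm_le_of_strip hk M hz hre him)
    (z := Complex.I * y) (by simpa using hy)).2
  have e : (Complex.I * y).im = y := by simp
  rw [e] at h1
  have h2 := pow_mul_exp_le (2 * k) (Y := 1) (by linarith : 0 ≤ y)
  have hy0 : 0 < y := by linarith
  have hR := rowConst_nonneg
  rw [← div_eq_mul_inv, le_div_iff₀ (by positivity)]
  calc _ ≤ 5 ^ (2 * k) * rowConst * Real.exp (-2 * Real.pi * (y - 1)) * y ^ (2 * k) := by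
        gcongr; exact h1
    _ = 5 ^ (2 * k) * rowConst * (y ^ (2 * k) * Real.exp (-2 * Real.pi * (y - 1))) := by ring
    _ ≤ _ := by unfold seriesConst; gcongr

lemma norm_kernelSeries_inv (k : ℕ) (a : ℂ) {y : ℝ} (hy : 0 < y) :
    ‖kernelSeries k (Complex.I * y) a‖ =
      (y ^ (2 * k))⁻¹ * ‖kernelSeries k (Complex.I * (y⁻¹ : ℝ)) a‖ := by
  rw [kernelSeries_inv k (I_mul_ne_zero hy), norm_mul, norm_I_mul_pow_inv hy, neg_inv_I_mul]

lemma norm_kernelSeries_mul_pow_le {k n : ℕ} (hk : 2 ≤ k) (hn : n ≤ 2 * k - 2) {τ : ℂ}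
    (hre : |τ.re| ≤ 1 / 2) (him : 1 / 2 ≤ τ.im) {y : ℝ} (hy : 0 < y) :
    ‖kernelSeries k (Complex.I * y) (conj τ) * (y : ℂ) ^ n‖ ≤
      2 * seriesConst k * (1 + y ^ 2)⁻¹ :=
  moment_bound (by omega) hn (seriesConst_nonneg k)
    (φ := fun y => kernelSeries k (Complex.I * y) (conj τ))
    (fun _ hy => norm_kernelSeries_le_of_strip hk hre him hy)
    (fun _ hy => norm_kernelSeries_inv k _ hy) hy

lemma measurable_kernelTerm (k : ℕ) (M : SL(2, ℤ)) :
    Measurable fun p : ℂ × ℂ => kernelTerm k M p.1 p.2 := by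
  unfold kernelTerm nu de
  fun_prop

lemma tendsto_kernelSeries_atImInfty {k : ℕ} (hk : 2 ≤ k) {y : ℝ} (hy : 0 < y) :
    Tendsto (fun τ : ℍ => kernelSeries k (Complex.I * y) (conj (τ : ℂ)))
      UpperHalfPlane.atImInfty (𝓝 0) := by
  have hc : ∀ τ : ℍ, ‖kernelSeries k (Complex.I * y) (conj (τ : ℂ))‖ =
      ‖kernelSeries k τ (conj (Complex.I * y))‖ := by
    intro τ
    rw [kernelSeries_symm, ← Complex.norm_conj, kernelSeries_conj, Complex.conj_conj]
  rw [tendsto_zero_iff_norm_tendsto_zero]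
  simp only [hc]
  have hneg : (conj (Complex.I * y)).im < 0 := by simpa using hy
  set C := (1 + ‖conj (Complex.I * y) + Complex.I‖ / -(conj (Complex.I * y)).im) ^ (2 * k) * rowConst
  have h1 : Tendsto (fun v : ℝ => C * Real.exp (-2 * Real.pi * (v - 1))) atTop (𝓝 0) := by
    rw [show (0 : ℝ) = C * 0 by simp]
    refine Tendsto.const_mul C (Real.tendsto_exp_atBot.comp ?_)
    refine Tendsto.const_mul_atTop_of_neg (by have := Real.pi_pos; linarith) ?_
    exact tendsto_atTop_add_const_right _ _ tendsto_id
  have h2 : Tendsto (fun τ : ℍ => τ.im) UpperHalfPlane.atImInfty atTop := tendsto_comap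
  refine squeeze_zero' (Eventually.of_forall fun _ => norm_nonneg _) ?_ (h1.comp h2)
  filter_upwards [h2.eventually_ge_atTop 1] with τ hτ
  exact norm_kernelSeries_le_exp hk hτ hneg

lemma tendsto_kernelMoment_strip {k n : ℕ} (hk : 2 ≤ k) (hn : n ≤ 2 * k - 2) :
    Tendsto (fun τ : ℍ => kernelMoment k n (conj (τ : ℂ)))
      (UpperHalfPlane.atImInfty ⊓ 𝓟 {τ : ℍ | |τ.re| ≤ 1 / 2}) (𝓝 0) := by
  have : (UpperHalfPlane.atImInfty ⊓ 𝓟 {τ : ℍ | |τ.re| ≤ 1 / 2}).IsCountablyGenerated := by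
    unfold UpperHalfPlane.atImInfty
    infer_instance
  have h2 : Tendsto (fun τ : ℍ => τ.im) UpperHalfPlane.atImInfty atTop := tendsto_comap
  have key := tendsto_integral_filter_of_dominated_convergence
    (l := UpperHalfPlane.atImInfty ⊓ 𝓟 {τ : ℍ | |τ.re| ≤ 1 / 2})
    (μ := volume.restrict (Set.Ioi (0 : ℝ)))
    (F := fun (τ : ℍ) (y : ℝ) => kernelSeries k (Complex.I * y) (conj (τ : ℂ)) * (y : ℂ) ^ n)
    (f := fun _ => 0) (fun y => 2 * seriesConst k * (1 + y ^ 2)⁻¹) ?_ ?_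
    (integrable_inv_one_add_sq.const_mul _).integrableOn ?_
  · simpa [kernelMoment] using key
  · exact Eventually.of_forall fun τ => (integrableOn_kernelSeries hk hn
      (conj_mem_goodSet τ)).aestronglyMeasurable
  · rw [eventually_inf_principal]
    filter_upwards [h2.eventually_ge_atTop 1] with τ hτ hre
    filter_upwards [ae_restrict_mem measurableSet_Ioi] with y hy
    exact norm_kernelSeries_mul_pow_le hk hn hre (by change 1 / 2 ≤ τ.im; linarith) hy
  · filter_upwards [ae_restrict_mem measurableSet_Ioi] with y hy
    have := ((tendsto_kernelSeries_atImInfty hk hy).mul_const ((y : ℂ) ^ n)).mono_left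
      (inf_le_left (b := 𝓟 {τ : ℍ | |τ.re| ≤ 1 / 2}))
    simpa using this

lemma exists_T_zpow_smul (τ : ℍ) : ∃ m : ℤ, |(ModularGroup.T ^ m • τ).re| ≤ 1 / 2 := by
  refine ⟨-round τ.re, ?_⟩
  rw [ModularGroup.re_T_zpow_smul]
  push_cast
  rw [← sub_eq_add_neg]
  exact abs_sub_round τ.re

lemma dualMoment_T_zpow (k n : ℕ) (m : ℤ) (τ : ℍ) :
    dualMoment k n (ModularGroup.T ^ m • τ : ℍ) = dualMoment k n τ := by
  rw [dualMoment_smul]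
  simp [de, ModularGroup.coe_T_zpow]

lemma tendsto_dualMoment {k n : ℕ} (hk : 2 ≤ k) (hn : n ≤ 2 * k - 2) :
    Tendsto (fun τ : ℍ => dualMoment k n τ) UpperHalfPlane.atImInfty (𝓝 0) := by
  have h := tendsto_kernelMoment_strip hk hn
  rw [Metric.tendsto_nhds] at h ⊢
  intro ε hε
  have h1 := h ε hε
  rw [eventually_inf_principal] at h1
  have h2 := UpperHalfPlane.atImInfty_mem _ |>.mp h1
  obtain ⟨A, hA⟩ := h2
  refine UpperHalfPlane.atImInfty_mem _ |>.mpr ⟨A, fun τ hτ => ?_⟩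
  obtain ⟨m, hm⟩ := exists_T_zpow_smul τ
  have h3 := hA (ModularGroup.T ^ m • τ) (by rwa [ModularGroup.im_T_zpow_smul]) hm
  rw [Set.mem_ofPred_eq, ← dualMoment_T_zpow k n m τ]
  simpa [dualMoment] using h3

/-- The cusp form of weight `2k` given by the moments of the kernel series. -/
def momentCuspForm {k n : ℕ} (hk : 2 ≤ k) (hn : n ≤ 2 * k - 2) : CuspForm 𝒮ℒ (2 * (k : ℤ)) where
  toFun τ := dualMoment k n τ
  slash_action_eq' A hA := by
    obtain ⟨γ, rfl⟩ := hA
    ext τ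
    have h := ModularForm.SL_slash_apply (k := 2 * (k : ℤ)) (fun τ : ℍ => dualMoment k n τ) γ τ
    refine Eq.trans h ?_
    rw [dualMoment_smul, denom_eq_de, show -(2 * (k : ℤ)) = -((2 * k : ℕ) : ℤ) by push_cast; rfl,
      zpow_neg, zpow_natCast]
    have := pow_ne_zero (2 * k) (de_ne_zero γ τ.im_pos.ne')
    field_simp
  holo' := by
    rw [UpperHalfPlane.mdifferentiable_iff]
    intro z hz
    refine DifferentiableAt.differentiableWithinAt ?_
    refine (differentiableAt_dualMoment hk hn hz).congr_of_eventuallyEq ?_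
    filter_upwards [(isOpen_lt continuous_const Complex.continuous_im).mem_nhds hz] with w hw
    simp [UpperHalfPlane.ofComplex_apply_of_im_pos hw]
  zero_at_cusps' := by
    intro c hc
    rw [Subgroup.IsArithmetic.isCusp_iff_isCusp_SL2Z] at hc
    rw [OnePoint.isZeroAt_iff_forall_SL2Z hc]
    intro γ _
    have : (fun τ : ℍ => dualMoment k n τ) ∣[2 * (k : ℤ)] γ = fun τ : ℍ => dualMoment k n τ := by
      ext τ
      rw [ModularForm.SL_slash_apply, dualMoment_smul, denom_eq_de,
        show -(2 * (k : ℤ)) = -((2 * k : ℕ) : ℤ) by push_cast; rfl, zpow_neg, zpow_natCast]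
      have := pow_ne_zero (2 * k) (de_ne_zero γ τ.im_pos.ne')
      field_simp
    rw [this]
    exact tendsto_dualMoment hk hn

/-! ### Weighted mean values on the unit disc -/

lemma polarCoord_symm_eq_circleMap (r θ : ℝ) : Complex.polarCoord.symm (r, θ) = circleMap 0 r θ := by
  simp [circleMap, Complex.exp_mul_I]

lemma integral_circleMap_eq {h : ℂ → ℂ} (hd : DifferentiableOn ℂ h (Metric.ball 0 1)) {r : ℝ}
    (hr : r ∈ Set.Ioo (0 : ℝ) 1) :
    ∫ θ in Set.Ioo (-Real.pi) Real.pi, h (Complex.polarCoord.symm (r, θ)) =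
      2 * (Real.pi : ℂ) * h 0 := by
  have h1 : Real.circleAverage h 0 r = h 0 := by
    refine DiffContOnCl.circleAverage ?_
    rw [abs_of_pos hr.1]
    exact (hd.mono (Metric.closedBall_subset_ball hr.2)).diffContOnCl_ball subset_rfl
  rw [Real.circleAverage_def] at h1
  have hper : Function.Periodic (fun θ => h (circleMap 0 r θ)) (2 * Real.pi) := fun θ => by
    simp only [periodic_circleMap 0 r θ]
  have h2 := hper.intervalIntegral_add_eq (-Real.pi) 0
  rw [show -Real.pi + 2 * Real.pi = Real.pi by ring, zero_add] at h2
  rw [← h2, intervalIntegral.integral_of_le (by linarith [Real.pi_pos]),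
    integral_Ioc_eq_integral_Ioo] at h1
  simp only [polarCoord_symm_eq_circleMap]
  rw [← h1, Complex.real_smul]
  have : (Real.pi : ℂ) ≠ 0 := Complex.ofReal_ne_zero.mpr Real.pi_ne_zero
  push_cast
  field_simp

lemma integral_weight (m : ℕ) :
    ∫ r in Set.Ioo (0 : ℝ) 1, r * (1 - r ^ 2) ^ m = 1 / (2 * ((m : ℝ) + 1)) := by
  rw [← integral_Ioc_eq_integral_Ioo, ← intervalIntegral.integral_of_le zero_le_one]
  have hm : (2 * ((m : ℝ) + 1)) ≠ 0 := by positivity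
  rw [intervalIntegral.integral_eq_sub_of_hasDerivAt
    (f := fun r => -((1 - r ^ 2) ^ (m + 1) / (2 * ((m : ℝ) + 1))))]
  · simp
  · intro r _
    have h1 := (((hasDerivAt_pow 2 r).const_sub 1).fun_pow (m + 1)).div_const (2 * ((m : ℝ) + 1))
    refine h1.fun_neg.congr_deriv ?_
    rw [Nat.add_sub_cancel]
    push_cast
    field_simp
  · exact Continuous.intervalIntegrable (by fun_prop) _ _

theorem integral_disc_weighted {h : ℂ → ℂ} (hd : DifferentiableOn ℂ h (Metric.ball 0 1)) {m : ℕ}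
    {C : ℝ} (hb : ∀ ζ ∈ Metric.ball (0 : ℂ) 1, ‖h ζ‖ * (1 - ‖ζ‖ ^ 2) ^ m ≤ C) :
    ∫ ζ in Metric.ball (0 : ℂ) 1, h ζ * (((1 - ‖ζ‖ ^ 2) ^ m : ℝ) : ℂ) =
      (Real.pi : ℂ) / (m + 1) * h 0 := by
  set F : ℂ → ℂ := fun ζ => h ζ * (((1 - ‖ζ‖ ^ 2) ^ m : ℝ) : ℂ)
  have hC : 0 ≤ C := by
    have := hb 0 (by simp)
    simp at this
    exact (norm_nonneg _).trans this
  set S : Set (ℝ × ℝ) := Set.Ioo (0 : ℝ) 1 ×ˢ Set.Ioo (-Real.pi) Real.pi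
  have hSm : MeasurableSet S := measurableSet_Ioo.prod measurableSet_Ioo
  have hmaps : ∀ p ∈ S, Complex.polarCoord.symm p ∈ Metric.ball (0 : ℂ) 1 := by
    rintro ⟨r, θ⟩ ⟨hr, _⟩
    rw [mem_ball_zero_iff, Complex.norm_polarCoord_symm, abs_of_pos hr.1]
    exact hr.2
  have e1 : ∫ ζ in Metric.ball (0 : ℂ) 1, F ζ =
      ∫ p in S, p.1 • F (Complex.polarCoord.symm p) := by
    rw [← integral_indicator Metric.isOpen_ball.measurableSet,
      ← Complex.integral_comp_polarCoord_symm]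
    have hS : S = polarCoord.target ∩ (Set.Iio (1 : ℝ) ×ˢ Set.univ) := by
      ext ⟨r, θ⟩
      simp [S, polarCoord]
      tauto
    rw [hS, ← setIntegral_indicator (measurableSet_Iio.prod MeasurableSet.univ)]
    refine setIntegral_congr_fun polarCoord.open_target.measurableSet ?_
    rintro ⟨r, θ⟩ ⟨hr, _⟩
    have hr : 0 < r := hr
    beta_reduce
    by_cases h1 : r < 1
    · rw [Set.indicator_of_mem, Set.indicator_of_mem]
      · exact ⟨h1, trivial⟩
      · rwa [mem_ball_zero_iff, Complex.norm_polarCoord_symm, abs_of_pos hr]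
    · rw [Set.indicator_of_notMem, Set.indicator_of_notMem, smul_zero]
      · exact fun h => h1 h.1
      · rwa [mem_ball_zero_iff, Complex.norm_polarCoord_symm, abs_of_pos hr]
  have hpol : Continuous fun p : ℝ × ℝ => Complex.polarCoord.symm p := by
    simp only [Complex.polarCoord_symm_apply]
    fun_prop
  have hcont : ContinuousOn (fun p : ℝ × ℝ => p.1 • F (Complex.polarCoord.symm p)) S := by
    have hF : ContinuousOn F (Metric.ball 0 1) := by
      refine hd.continuousOn.mul (Continuous.continuousOn ?_)
      fun_prop
    exact continuous_fst.continuousOn.smul (hF.comp hpol.continuousOn hmaps)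
  have hint : IntegrableOn (fun p : ℝ × ℝ => p.1 • F (Complex.polarCoord.symm p)) S
      (volume.prod volume) := by
    have : IsFiniteMeasure (((volume : Measure ℝ).prod (volume : Measure ℝ)).restrict S) := by
      refine ⟨?_⟩
      rw [Measure.restrict_apply_univ, Measure.prod_prod]
      exact ENNReal.mul_lt_top measure_Ioo_lt_top measure_Ioo_lt_top
    refine Integrable.of_bound (hcont.aestronglyMeasurable hSm) C ?_
    · filter_upwards [ae_restrict_mem hSm] with p hp
      have h1 := hb _ (hmaps p hp)
      have h2 : 0 ≤ (1 - ‖Complex.polarCoord.symm p‖ ^ 2) := by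
        have := mem_ball_zero_iff.mp (hmaps p hp)
        nlinarith [norm_nonneg (Complex.polarCoord.symm p)]
      have h3 : ‖F (Complex.polarCoord.symm p)‖ ≤ C := by
        simp only [F]
        rwa [norm_mul, Complex.norm_real, Real.norm_of_nonneg (pow_nonneg h2 m)]
      rw [norm_smul, Real.norm_of_nonneg hp.1.1.le]
      calc p.1 * ‖F (Complex.polarCoord.symm p)‖ ≤ 1 * C := by
            gcongr
            exact hp.1.2.le
        _ = C := one_mul C
  rw [e1, Measure.volume_eq_prod, setIntegral_prod _ hint]
  have e2 : ∀ r ∈ Set.Ioo (0 : ℝ) 1, ∫ θ in Set.Ioo (-Real.pi) Real.pi,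
      r • F (Complex.polarCoord.symm (r, θ)) =
        ((r * (1 - r ^ 2) ^ m : ℝ) : ℂ) * (2 * (Real.pi : ℂ) * h 0) := by
    intro r hr
    rw [← integral_circleMap_eq hd hr, ← integral_const_mul]
    refine integral_congr_ae (Eventually.of_forall fun θ => ?_)
    simp only [F, Complex.norm_polarCoord_symm, sq_abs, Complex.real_smul]
    push_cast
    ring
  rw [setIntegral_congr_fun measurableSet_Ioo e2, integral_mul_const, integral_complex_ofReal,
    integral_weight]
  have : ((m : ℂ) + 1) ≠ 0 := by exact_mod_cast Nat.succ_ne_zero m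
  push_cast
  field_simp

/-! ### The Cayley transform -/

/-- The Cayley transform of the unit disc to the upper half-plane that maps `0` to `iy`. -/
def cayley (y : ℝ) (ζ : ℂ) : ℂ := Complex.I * y * (1 + ζ) / (1 - ζ)

lemma one_sub_ne_zero {ζ : ℂ} (hζ : ζ ∈ Metric.ball (0 : ℂ) 1) : 1 - ζ ≠ 0 := by
  intro h
  rw [sub_eq_zero] at h
  simp [← h] at hζ

lemma hasDerivAt_cayley (y : ℝ) {ζ : ℂ} (hζ : 1 - ζ ≠ 0) :
    HasDerivAt (cayley y) (2 * Complex.I * y / (1 - ζ) ^ 2) ζ := by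
  have h1 := ((hasDerivAt_id ζ).const_add 1).const_mul (Complex.I * (y : ℂ))
  have h2 := (hasDerivAt_id ζ).const_sub 1
  refine (h1.div h2 hζ).congr_deriv ?_
  simp only [id]
  congr 1
  ring

lemma im_cayley (y : ℝ) {ζ : ℂ} (hζ : 1 - ζ ≠ 0) :
    (cayley y ζ).im = y * (1 - ‖ζ‖ ^ 2) / ‖1 - ζ‖ ^ 2 := by
  have h1 : cayley y ζ = Complex.I * y * (1 + ζ) * conj (1 - ζ) / ((‖1 - ζ‖ ^ 2 : ℝ) : ℂ) := by
    have hc : conj (1 - ζ) ≠ 0 := (map_ne_zero _).mpr hζ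
    rw [Complex.sq_norm, ← Complex.mul_conj, mul_div_mul_right _ _ hc, cayley]
  rw [h1, Complex.div_ofReal_im, Complex.sq_norm ζ, Complex.normSq_apply]
  congr 1
  simp
  ring

lemma cayley_image {y : ℝ} (hy : 0 < y) :
    cayley y '' Metric.ball 0 1 = {z : ℂ | 0 < z.im} := by
  ext z
  constructor
  · rintro ⟨ζ, hζ, rfl⟩
    have h1 := one_sub_ne_zero hζ
    rw [mem_ball_zero_iff] at hζ
    rw [Set.mem_ofPred_eq, im_cayley y h1]
    have := norm_pos_iff.mpr h1
    have h3 : 0 < 1 - ‖ζ‖ ^ 2 := by nlinarith [norm_nonneg ζ]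
    positivity
  · intro hz
    rw [Set.mem_ofPred_eq] at hz
    have hne : z + Complex.I * y ≠ 0 := by
      intro h
      have := congrArg Complex.im h
      simp at this
      linarith
    have hI := I_mul_ne_zero hy
    refine ⟨(z - Complex.I * y) / (z + Complex.I * y), ?_, ?_⟩
    · rw [mem_ball_zero_iff, norm_div, div_lt_one (norm_pos_iff.mpr hne)]
      refine lt_of_pow_lt_pow_left₀ 2 (norm_nonneg _) ?_
      rw [Complex.sq_norm, Complex.sq_norm, Complex.normSq_apply, Complex.normSq_apply]
      simp
      nlinarith
    · rw [cayley]
      have hy' : (y : ℂ) ≠ 0 := Complex.ofReal_ne_zero.mpr hy.ne'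
      have e1 : 1 - (z - Complex.I * y) / (z + Complex.I * y) =
          2 * (Complex.I * y) / (z + Complex.I * y) := by
        field_simp
        ring
      have e2 : 1 + (z - Complex.I * y) / (z + Complex.I * y) = 2 * z / (z + Complex.I * y) := by
        field_simp
        ring
      rw [e1, e2]
      field_simp

lemma cayley_injOn {y : ℝ} (hy : 0 < y) : Set.InjOn (cayley y) (Metric.ball 0 1) := by
  intro a ha b hb h
  have h1 := one_sub_ne_zero ha
  have h2 := one_sub_ne_zero hb
  have hI := I_mul_ne_zero hy
  rw [cayley, cayley, div_eq_div_iff h1 h2] at h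
  have h3 : 2 * (Complex.I * y) * (a - b) = 0 := by linear_combination h
  rw [mul_eq_zero, sub_eq_zero] at h3
  exact h3.resolve_left (mul_ne_zero two_ne_zero hI)

lemma abs_det_restrictScalars_smulRight (c : ℂ) :
    |((ContinuousLinearMap.toSpanSingleton ℂ c).restrictScalars ℝ : ℂ →L[ℝ] ℂ).det| =
      ‖c‖ ^ 2 := by
  have h2 : ((ContinuousLinearMap.toSpanSingleton ℂ c).restrictScalars ℝ : ℂ →L[ℝ] ℂ).det =
    LinearMap.det ((LinearMap.toSpanSingleton ℂ ℂ c).restrictScalars ℝ) := rfl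
  rw [h2, LinearMap.det_restrictScalars, LinearMap.det_ring]
  simp [Algebra.norm_complex_apply, Complex.sq_norm, abs_of_nonneg, Complex.normSq_nonneg]

lemma integral_upperHalf_eq_disc {y : ℝ} (hy : 0 < y) (G : ℂ → ℂ) :
    ∫ z in {z : ℂ | 0 < z.im}, G z = ∫ ζ in Metric.ball (0 : ℂ) 1,
      ((‖2 * Complex.I * y / (1 - ζ) ^ 2‖ ^ 2 : ℝ) : ℂ) * G (cayley y ζ) := by
  rw [← cayley_image hy, integral_image_eq_integral_abs_det_fderiv_smul volume
    Metric.isOpen_ball.measurableSet (fun ζ hζ =>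
      ((hasDerivAt_cayley y (one_sub_ne_zero hζ)).hasFDerivAt.restrictScalars ℝ).hasFDerivWithinAt)
    (cayley_injOn hy)]
  refine setIntegral_congr_fun Metric.isOpen_ball.measurableSet fun ζ _ => ?_
  simp only [abs_det_restrictScalars_smulRight, Complex.real_smul]

/-- The reproducing formula for holomorphic functions of moderate growth on the upper half-plane,
at points of the imaginary axis. -/
theorem integral_reproducing {f : ℂ → ℂ} (hf : DifferentiableOn ℂ f {z | 0 < z.im}) {k : ℕ}
    (hk : 2 ≤ k) {C : ℝ} (hC : ∀ z : ℂ, 0 < z.im → ‖f z‖ * z.im ^ k ≤ C) {y : ℝ} (hy : 0 < y) :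
    ∫ z in {z : ℂ | 0 < z.im}, (((z.im ^ 2)⁻¹ : ℝ) : ℂ) *
      (f z * (z.im : ℂ) ^ (2 * k) * ((Complex.I * y - conj z) ^ (2 * k))⁻¹) =
      4 * (Real.pi : ℂ) / ((2 * k - 1) * (2 * Complex.I) ^ (2 * k)) * f (Complex.I * y) := by
  set h : ℂ → ℂ := fun ζ => f (cayley y ζ) * ((1 - ζ) ^ (2 * k))⁻¹
  have him : ∀ ζ ∈ Metric.ball (0 : ℂ) 1, 0 < (cayley y ζ).im := fun ζ hζ => by
    have := (cayley_image hy).le ⟨ζ, hζ, rfl⟩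
    exact this
  have hd : DifferentiableOn ℂ h (Metric.ball 0 1) := by
    intro ζ hζ
    have h1 := one_sub_ne_zero hζ
    have h2 : DifferentiableAt ℂ f (cayley y ζ) := (hf _ (him ζ hζ)).differentiableAt
      ((isOpen_lt continuous_const Complex.continuous_im).mem_nhds (him ζ hζ))
    have h3 := h2.comp ζ (hasDerivAt_cayley y h1).differentiableAt
    have h4 : DifferentiableAt ℂ (fun ζ : ℂ => ((1 - ζ) ^ (2 * k))⁻¹) ζ := by
      have := pow_ne_zero (2 * k) h1
      fun_prop (disch := assumption)
    exact (h3.mul h4).differentiableWithinAt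
  have hpos : ∀ ζ ∈ Metric.ball (0 : ℂ) 1, 0 < 1 - ‖ζ‖ ^ 2 := fun ζ hζ => by
    rw [mem_ball_zero_iff] at hζ
    nlinarith [norm_nonneg ζ]
  have hb : ∀ ζ ∈ Metric.ball (0 : ℂ) 1, ‖h ζ‖ * (1 - ‖ζ‖ ^ 2) ^ (2 * k - 2) ≤ C / y ^ k := by
    intro ζ hζ
    have h1 := one_sub_ne_zero hζ
    have h2 := norm_pos_iff.mpr h1
    have h3 := hC _ (him ζ hζ)
    have h4 := hpos ζ hζ
    rw [im_cayley y h1, div_pow, mul_pow, ← pow_mul] at h3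
    simp only [h]
    rw [norm_mul, norm_inv, norm_pow]
    have h5 : (1 - ‖ζ‖ ^ 2) ^ (2 * k - 2) ≤ (1 - ‖ζ‖ ^ 2) ^ k :=
      pow_le_pow_of_le_one h4.le (by nlinarith [sq_nonneg ‖ζ‖]) (by omega)
    calc _ ≤ ‖f (cayley y ζ)‖ * (‖1 - ζ‖ ^ (2 * k))⁻¹ * (1 - ‖ζ‖ ^ 2) ^ k := by gcongr
      _ = ‖f (cayley y ζ)‖ * (y ^ k * (1 - ‖ζ‖ ^ 2) ^ k / ‖1 - ζ‖ ^ (2 * k)) / y ^ k := by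
        field_simp
      _ ≤ C / y ^ k := by gcongr
  have key := integral_disc_weighted hd hb
  rw [integral_upperHalf_eq_disc hy]
  have e : ∀ ζ ∈ Metric.ball (0 : ℂ) 1, ((‖2 * Complex.I * y / (1 - ζ) ^ 2‖ ^ 2 : ℝ) : ℂ) *
      (((((cayley y ζ).im ^ 2)⁻¹ : ℝ) : ℂ) * (f (cayley y ζ) * ((cayley y ζ).im : ℂ) ^ (2 * k) *
        ((Complex.I * y - conj (cayley y ζ)) ^ (2 * k))⁻¹)) =
      4 / (2 * Complex.I) ^ (2 * k) * (h ζ * (((1 - ‖ζ‖ ^ 2) ^ (2 * k - 2) : ℝ) : ℂ)) := by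
    intro ζ hζ
    have h1 := one_sub_ne_zero hζ
    have hc1 : conj (1 - ζ) ≠ 0 := (map_ne_zero _).mpr h1
    have hc2 : 1 - conj ζ ≠ 0 := by simpa using hc1
    have h2 := norm_pos_iff.mpr h1
    have h4 := hpos ζ hζ
    have hI := I_mul_ne_zero hy
    have ea : Complex.I * y - conj (cayley y ζ) = 2 * (Complex.I * y) / (1 - conj ζ) := by
      simp only [cayley, map_div₀, map_mul, map_add, map_sub, map_one, Complex.conj_I,
        Complex.conj_ofReal]
      field_simp
      ring
    have eb : ((‖1 - ζ‖ : ℝ) : ℂ) ^ 2 = (1 - ζ) * (1 - conj ζ) := by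
      rw [← Complex.ofReal_pow, Complex.sq_norm, ← Complex.mul_conj]
      simp
    have hn : ‖2 * Complex.I * y / (1 - ζ) ^ 2‖ = 2 * y / ‖1 - ζ‖ ^ 2 := by
      rw [norm_div, norm_pow, norm_mul, norm_mul, Complex.norm_I, Complex.norm_real,
        Real.norm_of_nonneg hy.le]
      norm_num
    rw [hn, im_cayley y h1, ea]
    obtain ⟨j, rfl⟩ : ∃ j, k = j + 1 := ⟨k - 1, by omega⟩
    rw [show 2 * (j + 1) - 2 = 2 * j by omega]
    simp only [h]
    push_cast
    rw [eb]
    have hy' : (y : ℂ) ≠ 0 := Complex.ofReal_ne_zero.mpr hy.ne'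
    have h4' : ((1 : ℂ) - (‖ζ‖ : ℂ) ^ 2) ≠ 0 := by
      have : ((1 - ‖ζ‖ ^ 2 : ℝ) : ℂ) ≠ 0 := Complex.ofReal_ne_zero.mpr h4.ne'
      push_cast at this
      exact this
    generalize (1 : ℂ) - (‖ζ‖ : ℂ) ^ 2 = w at h4' ⊢
    generalize 1 - conj ζ = d' at hc2 ⊢
    generalize f (cayley y ζ) = u
    generalize (1 - ζ) = d at h1 ⊢
    have hII := Complex.I_ne_zero
    simp only [mul_add, mul_one, pow_add, mul_pow, div_pow, mul_inv, inv_div]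
    field_simp
    ring
  rw [setIntegral_congr_fun Metric.isOpen_ball.measurableSet e, integral_const_mul, key]
  have e0 : h 0 = f (Complex.I * y) := by simp [h, cayley]
  rw [e0]
  have : ((2 * k - 2 : ℕ) : ℂ) + 1 = 2 * k - 1 := by
    rw [Nat.cast_sub (by omega)]
    push_cast
    ring
  have h1 : (2 * (k : ℂ) - 1) ≠ 0 := this ▸ Nat.cast_add_one_ne_zero _
  rw [this]
  field_simp

/-! ### Integration over the fundamental domain -/

lemma integral_upperHalfPlane (F : ℍ → ℂ) : ∫ τ : ℍ, F τ = ∫ z in {z : ℂ | 0 < z.im},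
    (((z.im ^ 2)⁻¹ : ℝ) : ℂ) * F (UpperHalfPlane.ofComplex z) := by
  have hr : Set.range UpperHalfPlane.coe = {z : ℂ | 0 < z.im} := UpperHalfPlane.range_coe
  rw [UpperHalfPlane.volume_def, integral_withDensity_eq_integral_smul, ← hr,
    ← UpperHalfPlane.measurableEmbedding_coe.map_comap,
    UpperHalfPlane.measurableEmbedding_coe.integral_map]
  · refine integral_congr_ae (Eventually.of_forall fun τ => ?_)
    simp only [UpperHalfPlane.ofComplex_apply, NNReal.smul_def, Complex.real_smul]
    simp
  · refine Continuous.measurable ?_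
    refine .pow (.div₀ continuous_const ?_ ?_) _
    · exact UpperHalfPlane.continuous_im.subtype_mk _
    · exact fun x => NNReal.ne_iff.mp x.im_ne_zero

lemma half_le_im_of_mem_fd {τ : ℍ} (hτ : τ ∈ ModularGroup.fd) : 1 / 2 ≤ τ.im := by
  have h := ModularGroup.three_le_four_mul_im_sq_of_mem_fd hτ
  nlinarith [τ.im_pos]

instance isFiniteMeasure_fd :
    IsFiniteMeasure ((volume : Measure ℍ).restrict ModularGroup.fd) := by
  refine ⟨?_⟩
  rw [Measure.restrict_apply_univ, UpperHalfPlane.volume_eq_lintegral]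
  set g : ℝ × ℝ → ℝ := fun p => (Set.Icc (-(1 / 2) : ℝ) (1 / 2)).indicator 1 p.1 *
    (5 * (1 + p.2 ^ 2)⁻¹) with hg
  have h1 : Integrable g (volume.prod volume) := by
    refine Integrable.mul_prod ?_ (integrable_inv_one_add_sq.const_mul 5)
    exact (integrable_indicator_iff measurableSet_Icc).mpr (integrableOn_const (by simp))
  have h2 := (Complex.volume_preserving_equiv_real_prod.integrable_comp_emb
    Complex.measurableEquivRealProd.measurableEmbedding).mpr h1
  have hfd : MeasurableSet (UpperHalfPlane.coe '' ModularGroup.fd) :=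
    UpperHalfPlane.measurableEmbedding_coe.measurableSet_image.mpr
      ModularGroup.isClosed_fd.measurableSet
  have h3 := h2.lintegral_lt_top
  refine lt_of_le_of_lt ?_ h3
  refine (setLIntegral_mono' hfd ?_).trans (setLIntegral_le_lintegral _ _)
  rintro _ ⟨τ, hτ, rfl⟩
  have him := half_le_im_of_mem_fd hτ
  have h4 : g (Complex.measurableEquivRealProd (τ : ℂ)) = 5 * (1 + τ.im ^ 2)⁻¹ := by
    simp only [hg, Complex.measurableEquivRealProd_apply]
    rw [Set.indicator_of_mem]
    · simp
    · exact abs_le.mp hτ.2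
  simp only [Function.comp, h4]
  rw [← ENNReal.ofReal_coe_nnreal]
  refine ENNReal.ofReal_le_ofReal ?_
  have h5 : |τ.im| = τ.im := abs_of_pos τ.im_pos
  simp [h5]
  rw [← div_eq_mul_inv, inv_eq_one_div, div_le_div_iff₀ (by positivity) (by positivity)]
  nlinarith

lemma volume_fd_diff_fdo : volume (ModularGroup.fd \ ModularGroup.fdo) = 0 := by
  have hsub : UpperHalfPlane.coe '' (ModularGroup.fd \ ModularGroup.fdo) ⊆
      Metric.sphere (0 : ℂ) 1 ∪ (Complex.reCLM ⁻¹' {1 / 2} ∪ Complex.reCLM ⁻¹' {-(1 / 2)}) := by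
    rintro _ ⟨τ, ⟨⟨h1, h2⟩, h3⟩, rfl⟩
    by_cases h4 : 1 < Complex.normSq (τ : ℂ)
    · have h5 : |τ.re| = 1 / 2 := le_antisymm h2 (not_lt.mp fun h => h3 ⟨h4, h⟩)
      rcases abs_eq (by norm_num : (0 : ℝ) ≤ 1 / 2) |>.mp h5 with h | h
      · exact Or.inr (Or.inl (by simpa using h))
      · exact Or.inr (Or.inr (by simpa using h))
    · refine Or.inl ?_
      rw [mem_sphere_zero_iff_norm, ← sq_eq_sq₀ (norm_nonneg _) zero_le_one, Complex.sq_norm,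
        one_pow]
      exact le_antisymm (not_lt.mp h4) h1
  have hre : ∀ c : ℝ, volume (Complex.reCLM ⁻¹' {c}) = 0 := by
    intro c
    have h1 : Complex.reCLM ⁻¹' {c} =
        Complex.measurableEquivRealProd ⁻¹' ({c} ×ˢ (Set.univ : Set ℝ)) := by
      ext z
      simp [Complex.measurableEquivRealProd_apply]
    rw [h1, Complex.volume_preserving_equiv_real_prod.measure_preimage_equiv,
      Measure.volume_eq_prod, Measure.prod_prod]
    simp
  have h0 : volume (UpperHalfPlane.coe '' (ModularGroup.fd \ ModularGroup.fdo)) = 0 := by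
    refine measure_mono_null hsub (measure_union_null (Measure.addHaar_sphere _ _ _)
      (measure_union_null (hre _) (hre _)))
  rw [UpperHalfPlane.volume_eq_lintegral, Measure.restrict_eq_zero.mpr h0, lintegral_zero_measure]

lemma measurePreserving_smul_int (M : SL(2, ℤ)) :
    MeasurePreserving (fun τ : ℍ => M • τ) volume volume :=
  measurePreserving_smul (Matrix.SpecialLinearGroup.mapGL ℝ M : GL (Fin 2) ℝ) (volume : Measure ℍ)

lemma measurableEmbedding_smul_int (M : SL(2, ℤ)) :
    MeasurableEmbedding (fun τ : ℍ => M • τ) :=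
  measurableEmbedding_const_smul (Matrix.SpecialLinearGroup.mapGL ℝ M : GL (Fin 2) ℝ)

/-- Almost every point lies in exactly two of the translates of the fundamental domain that are
indexed by the elements of `SL₂(ℤ)`. -/
lemma tsum_indicator_fd (G : ℍ → ℂ) : ∀ᵐ τ : ℍ,
    ∑' M : SL(2, ℤ), ((fun τ : ℍ => M • τ) '' ModularGroup.fd).indicator G τ = 2 * G τ := by
  have hnull : ∀ᵐ τ : ℍ, ∀ M : SL(2, ℤ), M • τ ∉ ModularGroup.fd \ ModularGroup.fdo := by
    rw [ae_all_iff]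
    intro M
    have h1 := (measurePreserving_smul_int M).quasiMeasurePreserving.preimage_null
      volume_fd_diff_fdo
    exact measure_eq_zero_iff_ae_notMem.mp h1
  filter_upwards [hnull] with τ hτ
  obtain ⟨g, hg⟩ := ModularGroup.exists_smul_mem_fd τ
  have hgo : g • τ ∈ ModularGroup.fdo := by
    by_contra h
    exact hτ g ⟨hg, h⟩
  have hmem : ∀ M : SL(2, ℤ), τ ∈ (fun τ : ℍ => M • τ) '' ModularGroup.fd ↔
      M = g⁻¹ ∨ M = -g⁻¹ := by
    intro M
    constructor
    · rintro ⟨w, hw, hwτ⟩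
      have h2 : (M⁻¹ * g⁻¹) • (g • τ) ∈ ModularGroup.fd := by
        rw [mul_smul, inv_smul_smul, ← hwτ]
        simpa using hw
      rcases ModularGroup.eq_one_or_neg_one_of_mem_fdo_mem_fd hgo h2 with h | h
      · left
        rw [inv_mul_eq_one] at h
        exact h
      · right
        rw [inv_mul_eq_iff_eq_mul] at h
        rw [h]
        simp
    · rintro (rfl | rfl)
      · exact ⟨g • τ, hg, by simp⟩
      · refine ⟨g • τ, hg, ?_⟩
        simp
  have hne : g⁻¹ ≠ -g⁻¹ := by
    intro h
    have h2 := congrArg (fun M : SL(2, ℤ) => g * M) h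
    have h3 := congrArg (fun M : SL(2, ℤ) => M 0 0) h2
    simp at h3
  rw [tsum_eq_sum (s := {g⁻¹, -g⁻¹}), Finset.sum_pair hne, Set.indicator_of_mem ((hmem _).mpr (Or.inl rfl)),
    Set.indicator_of_mem ((hmem _).mpr (Or.inr rfl)), two_mul]
  intro M hM
  refine Set.indicator_of_notMem (fun h => hM ?_) _
  simpa using (hmem M).mp h

theorem integral_fd_tsum_smul {G : ℍ → ℂ} (hG : Continuous G) {b : SL(2, ℤ) → ℝ} (hb : Summable b)
    (h : ∀ M, ∀ τ ∈ ModularGroup.fd, ‖G (M • τ)‖ ≤ b M) :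
    ∫ τ in ModularGroup.fd, ∑' M : SL(2, ℤ), G (M • τ) = 2 * ∫ τ : ℍ, G τ := by
  have hfd : MeasurableSet ModularGroup.fd := ModularGroup.isClosed_fd.measurableSet
  have hsm : ∀ M : SL(2, ℤ), Continuous fun τ : ℍ => M • τ := fun M =>
    continuous_const_smul (Matrix.SpecialLinearGroup.mapGL ℝ M : GL (Fin 2) ℝ)
  have hint : ∀ M : SL(2, ℤ), IntegrableOn (fun τ => G (M • τ)) ModularGroup.fd := fun M =>
    Integrable.of_bound (hG.comp (hsm M)).aestronglyMeasurable (b M)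
      ((ae_restrict_mem hfd).mono fun τ hτ => h M τ hτ)
  have hnorm : Summable fun M : SL(2, ℤ) => ∫ τ in ModularGroup.fd, ‖G (M • τ)‖ := by
    refine Summable.of_nonneg_of_le (fun M => integral_nonneg fun τ => norm_nonneg _) (fun M => ?_)
      (hb.mul_right (volume.real ModularGroup.fd))
    have h1 := norm_setIntegral_le_of_norm_le_const (μ := (volume : Measure ℍ))
      (f := fun τ => ‖G (M • τ)‖) (C := b M) (s := ModularGroup.fd)
      (by simpa using (isFiniteMeasure_fd.measure_univ_lt_top)) (fun τ hτ => by
        rw [norm_norm]; exact h M τ hτ)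
    exact (le_abs_self _).trans h1
  have e1 := (hasSum_integral_of_summable_integral_norm hint hnorm).tsum_eq
  have him : ∀ (M : SL(2, ℤ)), MeasurableSet ((fun τ : ℍ => M • τ) '' ModularGroup.fd) := fun M =>
    (measurableEmbedding_smul_int M).measurableSet_image.mpr hfd
  have ecv : ∀ (M : SL(2, ℤ)), IntegrableOn G ((fun τ : ℍ => M • τ) '' ModularGroup.fd) := fun M =>
    ((measurePreserving_smul_int M).integrableOn_image (measurableEmbedding_smul_int M)).mpr
      (hint M)
  have e2 := (hasSum_integral_of_summable_integral_norm (μ := (volume : Measure ℍ))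
    (F := fun M : SL(2, ℤ) => ((fun τ : ℍ => M • τ) '' ModularGroup.fd).indicator G)
    (fun M => (integrable_indicator_iff (him M)).mpr (ecv M)) ?_).tsum_eq
  · rw [integral_congr_ae (tsum_indicator_fd G), integral_const_mul] at e2
    rw [← e1, ← e2]
    refine tsum_congr fun M => ?_
    rw [integral_indicator (him M), (measurePreserving_smul_int M).setIntegral_image_emb
      (measurableEmbedding_smul_int M)]
  · refine hnorm.congr fun M => ?_
    simp only [norm_indicator_eq_indicator_norm]
    rw [integral_indicator (him M), (measurePreserving_smul_int M).setIntegral_image_emb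
      (measurableEmbedding_smul_int M)]

/-! ### The Petersson product with the kernel series -/

section

variable {k : ℕ} (f : CuspForm 𝒮ℒ (2 * (k : ℤ)))

lemma cuspForm_smul (M : SL(2, ℤ)) (τ : ℍ) : f (M • τ) = de M τ ^ (2 * k) * f τ := by
  have hmem : (Matrix.SpecialLinearGroup.mapGL ℝ M : GL (Fin 2) ℝ) ∈ 𝒮ℒ := ⟨M, rfl⟩
  have h := SlashInvariantForm.slash_action_eqn'' f hmem τ
  have h2 : ∀ x : ℂ, x ^ (2 * (k : ℤ)) = x ^ (2 * k) := fun x => by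
    exact_mod_cast zpow_natCast x (2 * k)
  rw [h2] at h
  rw [← denom_eq_de M τ]
  exact h

lemma cuspForm_continuous : Continuous f := f.holo'.continuous

lemma cuspForm_differentiableOn :
    DifferentiableOn ℂ (f ∘ UpperHalfPlane.ofComplex) {z : ℂ | 0 < z.im} :=
  UpperHalfPlane.mdifferentiable_iff.mp f.holo'

lemma exists_cuspForm_bound : ∃ C, ∀ τ : ℍ, ‖f τ‖ * τ.im ^ k ≤ C := by
  obtain ⟨C, hC⟩ := CuspFormClass.exists_bound f
  refine ⟨C, fun τ => ?_⟩
  have h := hC τ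
  have e : (((2 * (k : ℤ) : ℤ) : ℝ) / 2) = (k : ℝ) := by push_cast; ring
  rw [e, Real.rpow_natCast, le_div_iff₀ (pow_pos τ.im_pos k)] at h
  exact h

lemma exists_cuspForm_bound_fd : ∃ B ≥ 0, ∀ τ ∈ ModularGroup.fd,
    ‖f τ * (τ.im : ℂ) ^ (2 * k)‖ ≤ B := by
  have h0 := CuspFormClass.exp_decay_atImInfty (h := 1) f one_pos one_mem_strictPeriods_SL
  have hcont : Continuous fun τ : ℍ => f τ * (τ.im : ℂ) ^ (2 * k) := by
    have := cuspForm_continuous f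
    have h2 := UpperHalfPlane.continuous_im
    fun_prop
  have hO : (fun τ : ℍ => f τ * (τ.im : ℂ) ^ (2 * k)) =O[UpperHalfPlane.atImInfty]
      fun τ : ℍ => τ.im ^ (0 : ℝ) := by
    have h1 : (fun τ : ℍ => (τ.im : ℂ) ^ (2 * k)) =O[UpperHalfPlane.atImInfty]
        fun τ : ℍ => τ.im ^ (2 * k) :=
      Asymptotics.IsBigO.of_norm_eventuallyLE (Eventually.of_forall fun τ => by
        simp [abs_of_pos τ.im_pos])
    refine (h0.mul h1).trans ?_
    refine Asymptotics.IsBigO.of_bound ((2 * k).factorial * Real.exp (2 * Real.pi * 0))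
      (Eventually.of_forall fun τ => ?_)
    have h3 := pow_mul_exp_le (2 * k) (Y := 0) τ.im_pos.le
    rw [sub_zero] at h3
    rw [Real.rpow_zero, norm_one, mul_one, Real.norm_of_nonneg (by have := τ.im_pos; positivity),
      mul_comm]
    refine le_trans (le_of_eq ?_) h3
    congr 2
    ring
  obtain ⟨F, hF⟩ := ModularGroup.exists_bound_fundamental_domain_of_isBigO hcont hO
  refine ⟨max F 0, le_max_right _ _, fun τ hτ => ?_⟩
  have := hF τ hτ
  rw [Real.rpow_zero, mul_one] at this
  exact this.trans (le_max_left _ _)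

/-- The function on the upper half-plane whose average is the product with the kernel series. -/
def kernelLift (y : ℝ) (τ : ℍ) : ℂ :=
  f τ * (τ.im : ℂ) ^ (2 * k) * ((Complex.I * y - conj (τ : ℂ)) ^ (2 * k))⁻¹

lemma kernelLift_smul {y : ℝ} (M : SL(2, ℤ)) (τ : ℍ) : kernelLift f y (M • τ) =
    f τ * (τ.im : ℂ) ^ (2 * k) * kernelTerm k M⁻¹ (Complex.I * y) (conj (τ : ℂ)) := by
  have hd : de M τ ≠ 0 := de_ne_zero M τ.im_pos.ne'
  have hd2 : de M (conj (τ : ℂ)) ≠ 0 := by rwa [← conj_de, map_ne_zero]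
  have him : (((M • τ).im : ℝ) : ℂ) = τ.im / (de M τ * de M (conj (τ : ℂ))) := by
    rw [← conj_de, ModularGroup.im_smul_eq_div_normSq, denom_eq_de, Complex.mul_conj]
    push_cast
    rfl
  rw [kernelLift, kernelTerm_symm, kernelTerm, cuspForm_smul, him, coe_smul_eq, map_div₀, conj_nu,
    conj_de]
  have e : Complex.I * y - nu M (conj (τ : ℂ)) / de M (conj (τ : ℂ)) =
      -(nu M (conj (τ : ℂ)) - Complex.I * y * de M (conj (τ : ℂ))) / de M (conj (τ : ℂ)) := by
    field_simp
    ring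
  rw [div_pow, e, div_pow, Even.neg_pow (even_two_mul k), inv_div, mul_pow]
  have h1 := pow_ne_zero (2 * k) hd
  have h2 := pow_ne_zero (2 * k) hd2
  field_simp

lemma continuous_kernelLift {y : ℝ} (hy : 0 < y) : Continuous (kernelLift f y) := by
  have h1 := cuspForm_continuous f
  have h2 := UpperHalfPlane.continuous_im
  have h3 : Continuous fun τ : ℍ => conj (τ : ℂ) :=
    Complex.continuous_conj.comp UpperHalfPlane.continuous_coe
  have h4 : ∀ τ : ℍ, (Complex.I * y - conj (τ : ℂ)) ^ (2 * k) ≠ 0 := by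
    intro τ
    refine pow_ne_zero _ fun h => ?_
    have := congrArg Complex.im h
    simp at this
    linarith [τ.im_pos]
  unfold kernelLift
  fun_prop (disch := assumption)

end

lemma norm_kernelTerm_I_le {k : ℕ} (hk : 2 ≤ k) (M : SL(2, ℤ)) {τ : ℂ} (hre : |τ.re| ≤ 1 / 2)
    (him : 1 / 2 ≤ τ.im) {y : ℝ} (hy : 0 < y) : ‖kernelTerm k M (Complex.I * y) (conj τ)‖ ≤
      (1 + (y ^ (2 * k))⁻¹) * (5 ^ (2 * k) * 144) * (rowWeight M)⁻¹ := by
  have h1 : ∀ (N : SL(2, ℤ)) (t : ℝ), 1 ≤ t → ‖kernelTerm k N (Complex.I * t) (conj τ)‖ ≤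
      5 ^ (2 * k) * 144 * (rowWeight N)⁻¹ := by
    intro N t ht
    refine (norm_kernelTerm_le_of_strip hk N (by simpa using ht) hre him).trans ?_
    have h2 := inv_forms_le N (z := Complex.I * t) (by simp) (by simp; linarith)
    calc _ ≤ (5 : ℝ) ^ (2 * k) * (144 * (rowWeight N)⁻¹) := by gcongr
      _ = _ := by ring
  have hw := inv_pos.mpr (rowWeight_pos M)
  rcases le_or_gt 1 y with h | h
  · refine (h1 M y h).trans ?_
    have : (1 : ℝ) ≤ 1 + (y ^ (2 * k))⁻¹ := le_add_of_nonneg_right (by positivity)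
    rw [mul_assoc (1 + _)]
    exact le_mul_of_one_le_left (by positivity) this
  · have h3 := kernelTerm_mul_S k (M * ModularGroup.S⁻¹) (I_mul_ne_zero hy) (conj τ)
    rw [inv_mul_cancel_right, neg_inv_I_mul] at h3
    have h4 := rowWeight_mul_S (M * ModularGroup.S⁻¹)
    rw [inv_mul_cancel_right] at h4
    rw [h3, norm_mul, norm_I_mul_pow_inv hy]
    have h5 := h1 (M * ModularGroup.S⁻¹) y⁻¹ ((one_le_inv₀ hy).mpr h.le)
    rw [← h4] at h5
    calc _ ≤ (y ^ (2 * k))⁻¹ * (5 ^ (2 * k) * 144 * (rowWeight M)⁻¹) := by gcongr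
      _ ≤ (1 + (y ^ (2 * k))⁻¹) * (5 ^ (2 * k) * 144 * (rowWeight M)⁻¹) := by
        gcongr
        linarith
      _ = _ := by ring

lemma kernelSeries_eq_tsum_inv (k : ℕ) (z a : ℂ) :
    kernelSeries k z a = ∑' M : SL(2, ℤ), kernelTerm k M⁻¹ z a :=
  ((Equiv.inv SL(2, ℤ)).tsum_eq (fun M => kernelTerm k M z a)).symm

lemma abs_re_le_of_mem_fd {τ : ℍ} (hτ : τ ∈ ModularGroup.fd) : |(τ : ℂ).re| ≤ 1 / 2 := hτ.2

theorem integral_fd_kernelSeries {k : ℕ} (hk : 2 ≤ k) (f : CuspForm 𝒮ℒ (2 * (k : ℤ))) {y : ℝ}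
    (hy : 0 < y) : ∫ τ in ModularGroup.fd, f τ * (τ.im : ℂ) ^ (2 * k) *
      kernelSeries k (Complex.I * y) (conj (τ : ℂ)) =
      8 * (Real.pi : ℂ) / ((2 * k - 1) * (2 * Complex.I) ^ (2 * k)) * f (imPoint y) := by
  obtain ⟨B, hB0, hB⟩ := exists_cuspForm_bound_fd f
  set K := (1 + (y ^ (2 * k))⁻¹) * (5 ^ (2 * k) * 144)
  have hsum : Summable fun M : SL(2, ℤ) => B * (K * (rowWeight M⁻¹)⁻¹) :=
    (((Equiv.inv SL(2, ℤ)).summable_iff.mpr summable_inv_rowWeight).mul_left K).mul_left B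
  have h1 := integral_fd_tsum_smul (continuous_kernelLift f hy) hsum fun M τ hτ => by
    rw [kernelLift_smul, norm_mul]
    have h2 := hB τ hτ
    have h3 := norm_kernelTerm_I_le hk M⁻¹ (abs_re_le_of_mem_fd hτ) (half_le_im_of_mem_fd hτ) hy
    gcongr
  simp only [kernelLift_smul, tsum_mul_left, ← kernelSeries_eq_tsum_inv] at h1
  rw [h1, integral_upperHalfPlane]
  obtain ⟨C, hC⟩ := exists_cuspForm_bound f
  have h2 := integral_reproducing (cuspForm_differentiableOn f) hk (C := C) (fun z hz => by
    have := hC ⟨z, hz⟩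
    rwa [Function.comp, UpperHalfPlane.ofComplex_apply_of_im_pos hz]) hy
  have e : Set.EqOn (fun z : ℂ => (((z.im ^ 2)⁻¹ : ℝ) : ℂ) *
        kernelLift f y (UpperHalfPlane.ofComplex z)) (fun z => (((z.im ^ 2)⁻¹ : ℝ) : ℂ) *
      ((f ∘ UpperHalfPlane.ofComplex) z * (z.im : ℂ) ^ (2 * k) *
        ((Complex.I * y - conj z) ^ (2 * k))⁻¹)) {z : ℂ | 0 < z.im} := by
    intro z hz
    have h3 : ((UpperHalfPlane.ofComplex z : ℍ) : ℂ) = z := by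
      rw [UpperHalfPlane.ofComplex_apply_of_im_pos hz]
    simp only [kernelLift, Function.comp, h3, ← UpperHalfPlane.coe_im]
  rw [setIntegral_congr_fun (isOpen_lt continuous_const Complex.continuous_im).measurableSet e, h2,
    Function.comp, imPoint]
  ring

/-! ### The cusp form representing the period -/

lemma measurable_kernelTerm_I (k : ℕ) (M : SL(2, ℤ)) : Measurable fun p : ℍ × ℝ =>
    kernelTerm k M (Complex.I * p.2) (conj (p.1 : ℂ)) := by
  have h0 : Measurable fun p : ℍ × ℝ => conj (p.1 : ℂ) :=
    Complex.continuous_conj.measurable.comp (UpperHalfPlane.measurable_coe.comp measurable_fst)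
  have h2 : Measurable fun p : ℍ × ℝ => Complex.I * (p.2 : ℂ) :=
    (Complex.measurable_ofReal.comp measurable_snd).const_mul _
  have h3 := (measurable_kernelTerm k M).comp (h2.prodMk h0)
  simpa only [Function.comp_def] using h3

lemma measurable_indicator_kernelSeries {k : ℕ} (hk : 2 ≤ k) : Measurable fun p : ℍ × ℝ =>
    ∑' M, (Set.univ ×ˢ Set.Ioi 0 : Set (ℍ × ℝ)).indicator
      (fun p => kernelTerm k M (Complex.I * p.2) (conj (p.1 : ℂ))) p := by
  refine measurable_tsum (fun M => (measurable_kernelTerm_I k M).indicator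
      (MeasurableSet.univ.prod measurableSet_Ioi)) fun p => ?_
  by_cases hp : p ∈ (Set.univ ×ˢ Set.Ioi 0 : Set (ℍ × ℝ))
  · refine (summable_kernelTerm hk (conj_mem_goodSet p.1) hp.2).congr fun M => ?_
    rw [Set.indicator_of_mem hp]
  · refine summable_zero.congr fun M => ?_
    rw [Set.indicator_of_notMem hp]

lemma aestronglyMeasurable_kernelSeries {k : ℕ} (hk : 2 ≤ k) :
    AEStronglyMeasurable (fun p : ℍ × ℝ => kernelSeries k (Complex.I * p.2) (conj (p.1 : ℂ)))
      (((volume : Measure ℍ).restrict ModularGroup.fd).prod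
        ((volume : Measure ℝ).restrict (Set.Ioi 0))) := by
  refine (measurable_indicator_kernelSeries hk).aestronglyMeasurable.congr ?_
  rw [Measure.prod_restrict]
  filter_upwards [ae_restrict_mem
    (ModularGroup.isClosed_fd.measurableSet.prod measurableSet_Ioi)] with p hp
  have hp' : p ∈ (Set.univ ×ˢ Set.Ioi 0 : Set (ℍ × ℝ)) := ⟨trivial, hp.2⟩
  rw [kernelSeries]
  refine tsum_congr fun M => ?_
  rw [Set.indicator_of_mem hp']

theorem integral_fd_kernelMoment {k n : ℕ} (hk : 2 ≤ k) (hn : n ≤ 2 * k - 2)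
    (f : CuspForm 𝒮ℒ (2 * (k : ℤ))) :
    ∫ τ in ModularGroup.fd, f τ * (τ.im : ℂ) ^ (2 * k) * kernelMoment k n (conj (τ : ℂ)) =
      8 * (Real.pi : ℂ) / ((2 * k - 1) * (2 * Complex.I) ^ (2 * k)) * period n f := by
  obtain ⟨B, hB0, hB⟩ := exists_cuspForm_bound_fd f
  have hfd : MeasurableSet ModularGroup.fd := ModularGroup.isClosed_fd.measurableSet
  set P : ℍ → ℝ → ℂ := fun τ y => f τ * (τ.im : ℂ) ^ (2 * k) *
    (kernelSeries k (Complex.I * y) (conj (τ : ℂ)) * (y : ℂ) ^ n) with hP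
  have hint : Integrable (Function.uncurry P)
      (((volume : Measure ℍ).restrict ModularGroup.fd).prod
        ((volume : Measure ℝ).restrict (Set.Ioi 0))) := by
    have hb : Integrable (fun p : ℍ × ℝ => B * (2 * seriesConst k * (1 + p.2 ^ 2)⁻¹))
        (((volume : Measure ℍ).restrict ModularGroup.fd).prod
          ((volume : Measure ℝ).restrict (Set.Ioi 0))) :=
      Integrable.mul_prod (f := fun _ : ℍ => B)
        (g := fun y : ℝ => 2 * seriesConst k * (1 + y ^ 2)⁻¹) (integrable_const B)
        (integrable_inv_one_add_sq.const_mul _).integrableOn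
    refine hb.mono' ?_ ?_
    · have h1 : Continuous fun p : ℍ × ℝ => f p.1 * (p.1.im : ℂ) ^ (2 * k) := by
        have := cuspForm_continuous f
        have h2 := UpperHalfPlane.continuous_im
        fun_prop
      have h2 : Continuous fun p : ℍ × ℝ => (p.2 : ℂ) ^ n := by fun_prop
      exact h1.aestronglyMeasurable.mul
        ((aestronglyMeasurable_kernelSeries hk).mul h2.aestronglyMeasurable)
    · rw [Measure.prod_restrict]
      filter_upwards [ae_restrict_mem (hfd.prod measurableSet_Ioi)] with p hp
      have h1 := hB p.1 hp.1
      have h2 := norm_kernelSeries_mul_pow_le hk hn (abs_re_le_of_mem_fd hp.1)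
        (half_le_im_of_mem_fd hp.1) hp.2
      simp only [Function.uncurry, hP]
      rw [norm_mul]
      gcongr
  have h1 := integral_integral_swap hint
  have e1 : ∀ τ, ∫ y in Set.Ioi (0 : ℝ), P τ y =
      f τ * (τ.im : ℂ) ^ (2 * k) * kernelMoment k n (conj (τ : ℂ)) := fun τ => by
    simp only [hP, integral_const_mul, kernelMoment]
  have e2 : ∀ y ∈ Set.Ioi (0 : ℝ), ∫ τ in ModularGroup.fd, P τ y =
      8 * (Real.pi : ℂ) / ((2 * k - 1) * (2 * Complex.I) ^ (2 * k)) *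
        (f (imPoint y) * (y : ℂ) ^ n) := fun y hy => by
    rw [← mul_assoc, ← integral_fd_kernelSeries hk f hy, ← integral_mul_const]
    simp only [hP, mul_assoc]
  simp only [e1] at h1
  rw [h1, setIntegral_congr_fun measurableSet_Ioi e2, integral_const_mul, period]

/-- The normalizing factor of the period cusp form. -/
def periodScale (k : ℕ) : ℝ := -((-4) ^ (k - 1) * (2 * k - 1) / (2 * Real.pi))

/-- The cusp form that represents the `n`-th period. -/
def periodCuspForm {k n : ℕ} (hk : 2 ≤ k) (hn : n ≤ 2 * k - 2) : CuspForm 𝒮ℒ (2 * (k : ℤ)) :=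
  periodScale k • momentCuspForm hk hn

lemma periodCuspForm_apply {k n : ℕ} (hk : 2 ≤ k) (hn : n ≤ 2 * k - 2) (τ : ℍ) :
    periodCuspForm hk hn τ = periodScale k * conj (kernelMoment k n (conj (τ : ℂ))) := by
  change (periodScale k • momentCuspForm hk hn τ : ℂ) = _
  rw [Complex.real_smul]
  rfl

lemma two_I_pow (k : ℕ) : (2 * Complex.I) ^ (2 * k) = (-4) ^ k := by
  rw [pow_mul, mul_pow, Complex.I_sq]
  norm_num

theorem representsPeriod_periodCuspForm {k n : ℕ} (hk : 2 ≤ k) (hn : n ≤ 2 * k - 2) :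
    RepresentsPeriod k n (periodCuspForm hk hn) := by
  intro f
  have h1 : ∀ τ : ℍ, f τ * conj (periodCuspForm hk hn τ) * (τ.im : ℂ) ^ (2 * k) =
      periodScale k * (f τ * (τ.im : ℂ) ^ (2 * k) * kernelMoment k n (conj (τ : ℂ))) := fun τ => by
    rw [periodCuspForm_apply, map_mul, Complex.conj_ofReal, Complex.conj_conj]
    ring
  simp only [peterssonInner, h1]
  rw [integral_const_mul, integral_fd_kernelMoment hk hn f, ← mul_assoc]
  have h2 : (2 * (k : ℂ) - 1) ≠ 0 := by
    have : ((2 * k - 2 : ℕ) : ℂ) + 1 = 2 * k - 1 := by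
      rw [Nat.cast_sub (by omega)]
      push_cast
      ring
    exact this ▸ Nat.cast_add_one_ne_zero _
  have hpi : (Real.pi : ℂ) ≠ 0 := Complex.ofReal_ne_zero.mpr Real.pi_ne_zero
  convert one_mul (period n f)
  obtain ⟨j, rfl⟩ : ∃ j, k = j + 1 := ⟨k - 1, by omega⟩
  rw [two_I_pow, periodScale, Nat.add_sub_cancel, pow_succ]
  have h4 : ((-4 : ℂ) ^ j) ≠ 0 := pow_ne_zero _ (by norm_num)
  push_cast at h2 ⊢
  field_simp
  norm_num

/-! ### Uniqueness -/

instance : (volume : Measure ℍ).IsOpenPosMeasure := by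
  have h1 : (Measure.comap UpperHalfPlane.coe (volume : Measure ℂ)).IsOpenPosMeasure :=
    Measure.IsOpenPosMeasure.comap volume UpperHalfPlane.isOpenEmbedding_coe
  refine Measure.AbsolutelyContinuous.isOpenPosMeasure
    (μ := Measure.comap UpperHalfPlane.coe (volume : Measure ℂ)) ?_
  rw [UpperHalfPlane.volume_def]
  refine withDensity_absolutelyContinuous' ?_ ?_
  · refine Measurable.aemeasurable ?_
    refine measurable_coe_nnreal_ennreal.comp (Continuous.measurable ?_)
    refine .pow (.div₀ continuous_const ?_ ?_) _
    · exact UpperHalfPlane.continuous_im.subtype_mk _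
    · exact fun x => NNReal.ne_iff.mp x.im_ne_zero
  · refine Eventually.of_forall fun τ => ?_
    simp
    exact NNReal.ne_iff.mp (inv_ne_zero τ.im_ne_zero)

lemma integrableOn_petersson {k : ℕ} (f g : CuspForm 𝒮ℒ (2 * (k : ℤ))) :
    IntegrableOn (fun τ : ℍ => f τ * conj (g τ) * (τ.im : ℂ) ^ (2 * k)) ModularGroup.fd := by
  obtain ⟨C, hC⟩ := exists_cuspForm_bound f
  obtain ⟨D, hD⟩ := exists_cuspForm_bound g
  have hcont : Continuous fun τ : ℍ => f τ * conj (g τ) * (τ.im : ℂ) ^ (2 * k) := by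
    have h1 := cuspForm_continuous f
    have h2 := Complex.continuous_conj.comp (cuspForm_continuous g)
    have h3 := UpperHalfPlane.continuous_im
    simp only [Function.comp_def] at h2
    fun_prop
  refine Integrable.of_bound hcont.aestronglyMeasurable (C * D) (Eventually.of_forall fun τ => ?_)
  rw [norm_mul, norm_mul, norm_pow, Complex.norm_conj, Complex.norm_real,
    Real.norm_of_nonneg τ.im_pos.le]
  have h1 := hC τ
  have h2 := hD τ
  have h3 := pow_pos τ.im_pos k
  calc ‖f τ‖ * ‖g τ‖ * τ.im ^ (2 * k) = (‖f τ‖ * τ.im ^ k) * (‖g τ‖ * τ.im ^ k) := by ring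
    _ ≤ C * D := by
      gcongr
      exact (by positivity : (0 : ℝ) ≤ ‖f τ‖ * τ.im ^ k).trans h1

lemma peterssonInner_sub_right {k : ℕ} (f g h : CuspForm 𝒮ℒ (2 * (k : ℤ))) :
    peterssonInner k f (g - h) = peterssonInner k f g - peterssonInner k f h := by
  rw [peterssonInner, peterssonInner, peterssonInner,
    ← integral_sub (integrableOn_petersson f g) (integrableOn_petersson f h)]
  refine integral_congr_ae (Eventually.of_forall fun τ => ?_)
  have : (g - h) τ = g τ - h τ := rfl
  simp only [this, map_sub]
  ring

lemma eq_zero_of_peterssonInner_self {k : ℕ} {f : CuspForm 𝒮ℒ (2 * (k : ℤ))}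
    (h : peterssonInner k f f = 0) : f = 0 := by
  have hfd : MeasurableSet ModularGroup.fd := ModularGroup.isClosed_fd.measurableSet
  have e : ∀ τ : ℍ, f τ * conj (f τ) * (τ.im : ℂ) ^ (2 * k) =
      ((‖f τ‖ ^ 2 * τ.im ^ (2 * k) : ℝ) : ℂ) := fun τ => by
    rw [Complex.mul_conj, Complex.sq_norm]
    push_cast
    rfl
  have hint : IntegrableOn (fun τ : ℍ => ‖f τ‖ ^ 2 * τ.im ^ (2 * k)) ModularGroup.fd :=
    (integrableOn_petersson f f).re.congr (Eventually.of_forall fun τ => by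
      simp only [e]
      exact Complex.ofReal_re _)
  simp only [peterssonInner, e] at h
  rw [integral_complex_ofReal, Complex.ofReal_eq_zero] at h
  have h1 : (fun τ : ℍ => ‖f τ‖ ^ 2 * τ.im ^ (2 * k)) =ᵐ[volume.restrict ModularGroup.fd] 0 := by
    refine (integral_eq_zero_iff_of_nonneg (fun τ => ?_) ?_).mp h
    · have := τ.im_pos
      simp only [Pi.zero_apply]
      positivity
    · exact hint
  have h2 : (f : ℍ → ℂ) =ᵐ[volume.restrict ModularGroup.fdo] 0 := by
    have h3 := ae_restrict_of_ae_restrict_of_subset ModularGroup.fdo_subset_fd h1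
    filter_upwards [h3] with τ hτ
    have := pow_pos τ.im_pos (2 * k)
    simpa [this.ne'] using hτ
  have h4 := Measure.eqOn_open_of_ae_eq h2 ModularGroup.isOpen_fdo
    (cuspForm_continuous f).continuousOn continuousOn_const
  have h5 := h4.closure (cuspForm_continuous f) continuous_const
  rw [← ModularGroup.fd_eq_closure_fdo] at h5
  ext τ
  obtain ⟨M, hM⟩ := ModularGroup.exists_smul_mem_fd τ
  have h6 := h5 hM
  rw [cuspForm_smul] at h6
  exact (mul_eq_zero.mp h6).resolve_left (pow_ne_zero _ (de_ne_zero M τ.im_pos.ne'))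

theorem representsPeriod_unique {k n : ℕ} {R R' : CuspForm 𝒮ℒ (2 * (k : ℤ))}
    (hR : RepresentsPeriod k n R) (hR' : RepresentsPeriod k n R') : R' = R := by
  rw [← sub_eq_zero]
  refine eq_zero_of_peterssonInner_self ?_
  rw [peterssonInner_sub_right, hR, hR', sub_self]

theorem xiOp_curlyH {k n : ℕ} (hk : 2 ≤ k) (hn : n ≤ 2 * k - 2) {τ : ℍ} (hτ : (τ : ℂ) ∈ goodSet) :
    xiOp (2 - 2 * (k : ℤ)) (curlyH k n) τ = -periodCuspForm hk hn τ := by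
  rw [xiOp, dTauBar_curlyH hk hn hτ, periodCuspForm_apply,
    show 2 - 2 * (k : ℤ) = -((2 * (k - 1) : ℕ) : ℤ) by
      rw [Nat.cast_mul, Nat.cast_sub (by omega)]
      push_cast
      ring,
    zpow_neg, zpow_natCast, show 2 * k - 2 = 2 * (k - 1) by omega, mul_pow, two_I_pow, periodScale]
  have h1 : (τ.im : ℂ) ^ (2 * (k - 1)) ≠ 0 :=
    pow_ne_zero _ (Complex.ofReal_ne_zero.mpr τ.im_pos.ne')
  have hpi : (Real.pi : ℂ) ≠ 0 := Complex.ofReal_ne_zero.mpr Real.pi_ne_zero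
  have h3 : ((2 * k - 1 : ℕ) : ℂ) = 2 * k - 1 := by
    rw [Nat.cast_sub (by omega)]
    push_cast
    ring
  simp only [map_neg, map_mul, map_inv₀, map_pow, Complex.conj_I, Complex.conj_ofReal, h3, map_sub,
    map_one, map_natCast, map_ofNat]
  generalize conj (kernelMoment k n (conj (τ : ℂ))) = X
  have hI := Complex.I_ne_zero
  push_cast
  field_simp
  norm_num

/-! ### Moments along the whole imaginary line -/

/-- The values of the kernel series along the imaginary line. -/
def lineKernel (k : ℕ) (τ : ℂ) (t : ℝ) : ℂ := kernelSeries k τ (Complex.I * t)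

lemma conj_kernelSeries_line (k : ℕ) (τ : ℂ) (y : ℝ) :
    conj (kernelSeries k (Complex.I * y) (conj τ)) = lineKernel k τ (-y) := by
  rw [kernelSeries_conj, Complex.conj_conj, kernelSeries_symm, lineKernel]
  congr 1
  simp

lemma conj_kernelMoment (k n : ℕ) (τ : ℂ) : conj (kernelMoment k n (conj τ)) =
    ∫ y in Set.Ioi (0 : ℝ), lineKernel k τ (-y) * (y : ℂ) ^ n := by
  rw [kernelMoment, ← integral_conj]
  refine setIntegral_congr_fun measurableSet_Ioi fun y _ => ?_
  simp only [map_mul, map_pow, Complex.conj_ofReal, conj_kernelSeries_line]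

lemma kernelMoment_eq_line (k n : ℕ) (τ : ℂ) : kernelMoment k n τ =
    ∫ y in Set.Ioi (0 : ℝ), lineKernel k τ y * (y : ℂ) ^ n := by
  simp only [kernelMoment, lineKernel, kernelSeries_symm k τ]

lemma integrableOn_lineKernel_Ioi {k n : ℕ} (hk : 2 ≤ k) (hn : n ≤ 2 * k - 2) {τ : ℂ}
    (hτ : τ ∈ goodSet) :
    IntegrableOn (fun t : ℝ => lineKernel k τ t * (t : ℂ) ^ n) (Set.Ioi 0) := by
  simpa only [lineKernel, kernelSeries_symm k τ] using integrableOn_kernelSeries hk hn hτ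

lemma integrableOn_lineKernel_Iic {k n : ℕ} (hk : 2 ≤ k) (hn : n ≤ 2 * k - 2) (τ : ℍ) :
    IntegrableOn (fun t : ℝ => lineKernel k τ t * (t : ℂ) ^ n) (Set.Iic 0) := by
  have h1 := (integrableOn_kernelSeries hk hn (conj_mem_goodSet τ))
  have h2 : IntegrableOn (fun y : ℝ => lineKernel k τ (-y) * ((-y : ℝ) : ℂ) ^ n) (Set.Ioi 0) := by
    refine ((Complex.conjCLE.toContinuousLinearMap.integrable_comp h1).const_mul
      ((-1 : ℂ) ^ n)).congr (Eventually.of_forall fun y => ?_)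
    have h3 : conj (kernelSeries k (Complex.I * y) (conj (τ : ℂ)) * (y : ℂ) ^ n) =
        lineKernel k τ (-y) * (y : ℂ) ^ n := by
      rw [map_mul, conj_kernelSeries_line, map_pow, Complex.conj_ofReal]
    change (-1 : ℂ) ^ n * conj _ = _
    beta_reduce
    rw [h3, Complex.ofReal_neg, neg_pow (y : ℂ)]
    ring
  rw [integrableOn_Iic_iff_integrableOn_Iio]
  have h3 := h2.comp_neg
  simpa using h3

lemma integrable_lineKernel {k n : ℕ} (hk : 2 ≤ k) (hn : n ≤ 2 * k - 2) {τ : ℍ}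
    (hτ : (τ : ℂ) ∈ goodSet) : Integrable fun t : ℝ => lineKernel k τ t * (t : ℂ) ^ n := by
  rw [← integrableOn_univ, ← Set.Iic_union_Ioi (a := (0 : ℝ))]
  exact (integrableOn_lineKernel_Iic hk hn τ).union (integrableOn_lineKernel_Ioi hk hn hτ)

theorem kernelMoment_add_conj {k n : ℕ} (hk : 2 ≤ k) (hn : n ≤ 2 * k - 2) {τ : ℍ}
    (hτ : (τ : ℂ) ∈ goodSet) :
    kernelMoment k n τ + (-1) ^ n * conj (kernelMoment k n (conj (τ : ℂ))) =
      ∫ t : ℝ, lineKernel k τ t * (t : ℂ) ^ n := by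
  rw [← integral_add_compl measurableSet_Ioi (integrable_lineKernel hk hn hτ), Set.compl_Ioi,
    conj_kernelMoment, kernelMoment_eq_line, ← integral_const_mul]
  congr 1
  have h1 := integral_comp_neg_Ioi (0 : ℝ) (fun t : ℝ => lineKernel k τ t * (t : ℂ) ^ n)
  rw [neg_zero] at h1
  rw [← h1]
  refine setIntegral_congr_fun measurableSet_Ioi fun y _ => ?_
  rw [Complex.ofReal_neg, neg_pow (y : ℂ)]
  ring

/-- The summand of `lineKernel` that belongs to a matrix. -/
def lineTerm (k : ℕ) (τ : ℂ) (M : SL(2, ℤ)) (t : ℝ) : ℂ :=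
  ((nu M τ - Complex.I * t * de M τ) ^ (2 * k))⁻¹

lemma lineKernel_eq_tsum (k : ℕ) (τ : ℂ) (t : ℝ) : lineKernel k τ t = ∑' M, lineTerm k τ M t := rfl

/-! ### Separation of the orbit from the imaginary line -/

lemma norm_sq_line (M : SL(2, ℤ)) (τ : ℂ) (t : ℝ) : ‖nu M τ - Complex.I * t * de M τ‖ ^ 2 =
    ‖nu M τ‖ ^ 2 + t ^ 2 * ‖de M τ‖ ^ 2 - 2 * t * τ.im := by
  rw [← im_nu_mul_conj_de M τ]
  simp only [Complex.sq_norm, Complex.normSq_apply]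
  simp
  ring

lemma norm_sq_line_inv (M : SL(2, ℤ)) (τ : ℂ) (t : ℝ) :
    ‖nu M τ‖ ^ 2 + t ^ 2 * ‖de M τ‖ ^ 2 ≤ 2 * (1 + ‖τ‖ ^ 2) *
      (‖de M⁻¹ (Complex.I * t)‖ ^ 2 + ‖nu M⁻¹ (Complex.I * t)‖ ^ 2) := by
  have h1 : ∀ a b : ℤ, ‖(a : ℂ) * τ + b‖ ^ 2 ≤ 2 * (1 + ‖τ‖ ^ 2) * ((a : ℝ) ^ 2 + (b : ℝ) ^ 2) := by
    intro a b
    have h2 := norm_add_le ((a : ℂ) * τ) b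
    rw [norm_mul, Complex.norm_intCast, Complex.norm_intCast] at h2
    have h3 : ‖(a : ℂ) * τ + b‖ ^ 2 ≤ (|(a : ℝ)| * ‖τ‖ + |(b : ℝ)|) ^ 2 := by gcongr
    refine h3.trans ?_
    rw [← sq_abs (a : ℝ), ← sq_abs (b : ℝ)]
    nlinarith [sq_nonneg (|(a : ℝ)| * ‖τ‖ - |(b : ℝ)|), sq_nonneg (|(b : ℝ)| * ‖τ‖),
      sq_nonneg |(a : ℝ)|]
  have h4 := h1 (M 0 0) (M 0 1)
  have h5 := h1 (M 1 0) (M 1 1)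
  have e1 : ‖de M⁻¹ (Complex.I * t)‖ ^ 2 = (M 0 0 : ℝ) ^ 2 + t ^ 2 * (M 1 0 : ℝ) ^ 2 := by
    rw [de]
    simp [Matrix.SpecialLinearGroup.SL2_inv_expl, Complex.sq_norm, Complex.normSq_apply]
    ring
  have e2 : ‖nu M⁻¹ (Complex.I * t)‖ ^ 2 = (M 0 1 : ℝ) ^ 2 + t ^ 2 * (M 1 1 : ℝ) ^ 2 := by
    rw [nu]
    simp [Matrix.SpecialLinearGroup.SL2_inv_expl, Complex.sq_norm, Complex.normSq_apply]
    ring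
  rw [e1, e2, nu, de]
  have h6 := mul_le_mul_of_nonneg_left h5 (sq_nonneg t)
  linarith

lemma exists_line_separation {τ : ℍ} (hτ : (τ : ℂ) ∈ goodSet) : ∃ c > 0, ∀ M : SL(2, ℤ), ∀ t : ℝ,
    c * (‖nu M τ‖ ^ 2 + t ^ 2 * ‖de M τ‖ ^ 2) ≤ ‖nu M τ - Complex.I * t * de M τ‖ ^ 2 := by
  obtain ⟨ε, hε, -, hsep⟩ := exists_separation hτ
  have hsep := hsep τ (Metric.mem_ball_self hε)
  set K := 2 * (1 + ‖(τ : ℂ)‖ ^ 2) * ((1 / ε) ^ 2 + (1 + ‖(τ : ℂ)‖ / ε) ^ 2)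
  have hK : 0 < K := by positivity
  refine ⟨min 1 (1 / K), by positivity, fun M t => ?_⟩
  have hX : 0 ≤ ‖nu M τ‖ ^ 2 + t ^ 2 * ‖de M τ‖ ^ 2 := by positivity
  rcases le_or_gt t 0 with ht | ht
  · refine (mul_le_mul_of_nonneg_right (min_le_left _ _) hX).trans ?_
    have h0 : (0 : ℝ) < (τ : ℂ).im := τ.im_pos
    rw [norm_sq_line]
    nlinarith
  · refine (mul_le_mul_of_nonneg_right (min_le_right _ _) hX).trans ?_
    have e : ‖nu M τ - Complex.I * t * de M τ‖ =
        ‖nu M⁻¹ (Complex.I * t) - τ * de M⁻¹ (Complex.I * t)‖ := by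
      have := linearForm_inv M⁻¹ (Complex.I * t) τ
      rw [inv_inv] at this
      rw [this, norm_neg]
    have h1 := hsep M⁻¹ t ht
    rw [← e] at h1
    set x := ‖nu M τ - Complex.I * t * de M τ‖ with hx
    have h2 : ‖de M⁻¹ (Complex.I * t)‖ ≤ 1 / ε * x := by
      rw [one_div, ← div_eq_inv_mul, le_div_iff₀ hε]
      linarith
    have h3 : ‖nu M⁻¹ (Complex.I * t)‖ ≤ (1 + ‖(τ : ℂ)‖ / ε) * x := by
      calc ‖nu M⁻¹ (Complex.I * t)‖ = ‖(nu M⁻¹ (Complex.I * t) - τ * de M⁻¹ (Complex.I * t)) +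
            τ * de M⁻¹ (Complex.I * t)‖ := by rw [sub_add_cancel]
        _ ≤ x + ‖(τ : ℂ)‖ * ‖de M⁻¹ (Complex.I * t)‖ := by
          rw [e, ← norm_mul]
          exact norm_add_le _ _
        _ ≤ x + ‖(τ : ℂ)‖ * (1 / ε * x) := by gcongr
        _ = _ := by ring
    rw [one_div, ← div_eq_inv_mul, div_le_iff₀ hK]
    calc _ ≤ _ := norm_sq_line_inv M τ t
      _ ≤ 2 * (1 + ‖(τ : ℂ)‖ ^ 2) * ((1 / ε * x) ^ 2 + ((1 + ‖(τ : ℂ)‖ / ε) * x) ^ 2) := by gcongr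
      _ = _ := by simp only [K]; ring

lemma lineForm_ne_zero {τ : ℍ} (hτ : (τ : ℂ) ∈ goodSet) (M : SL(2, ℤ)) (t : ℝ) :
    nu M τ - Complex.I * t * de M τ ≠ 0 := by
  obtain ⟨c, hc, h⟩ := exists_line_separation hτ
  have h1 := h M t
  have h2 := norm_pos_iff.mpr (nu_ne_zero M τ.im_pos.ne')
  intro h0
  rw [h0, norm_zero] at h1
  have : 0 < c * (‖nu M τ‖ ^ 2 + t ^ 2 * ‖de M τ‖ ^ 2) := by positivity
  norm_num at h1
  linarith

lemma norm_lineTerm_le {k : ℕ} {τ : ℂ} {M : SL(2, ℤ)} {t c : ℝ} (hc : 0 < c) (hnu : nu M τ ≠ 0)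
    (h : c * (‖nu M τ‖ ^ 2 + t ^ 2 * ‖de M τ‖ ^ 2) ≤ ‖nu M τ - Complex.I * t * de M τ‖ ^ 2) :
    ‖lineTerm k τ M t‖ ≤ (c ^ k)⁻¹ * ((‖nu M τ‖ ^ 2 + t ^ 2 * ‖de M τ‖ ^ 2) ^ k)⁻¹ := by
  have h1 := norm_pos_iff.mpr hnu
  rw [lineTerm, norm_inv, norm_pow, pow_mul, ← mul_inv, ← mul_pow]
  gcongr

lemma norm_forms_of_strip (M : SL(2, ℤ)) {z : ℂ} (hre : |z.re| ≤ 1 / 2) (him : 1 / 2 ≤ z.im) :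
    1 / 12 ≤ ‖nu M z‖ ^ 2 ∧ 1 / 12 ≤ ‖de M z‖ ^ 2 := by
  have h0 : |z.re| ≤ 1 := by linarith
  have h1 := form_ge_of_strip (M 0 0) (M 0 1) h0 him
  have h2 := form_ge_of_strip (M 1 0) (M 1 1) h0 him
  have h3 := one_le_row_zero M
  have h4 := one_le_row_one M
  exact ⟨by rw [nu]; linarith, by rw [de]; linarith⟩

lemma summable_inv_forms {z : ℂ} (hre : |z.re| ≤ 1 / 2) (him : 1 / 2 ≤ z.im) :
    Summable fun M : SL(2, ℤ) => (‖de M z‖ ^ 2 * ‖nu M z‖ ^ 2)⁻¹ :=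
  Summable.of_nonneg_of_le (fun M => by positivity)
    (fun M => inv_forms_le M (by linarith) him) (summable_inv_rowWeight.mul_left 144)

/-! ### The inner moments -/

lemma inv_add_sq_eq {p q : ℝ} (hp : 0 < p) (t : ℝ) :
    (p ^ 2 + t ^ 2 * q ^ 2)⁻¹ = (p ^ 2)⁻¹ * (1 + (q / p * t) ^ 2)⁻¹ := by
  rw [← mul_inv]
  congr 1
  field_simp

lemma integrable_inv_add_sq {p q : ℝ} (hp : 0 < p) (hq : 0 < q) :
    Integrable fun t : ℝ => (p ^ 2 + t ^ 2 * q ^ 2)⁻¹ := by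
  simp only [inv_add_sq_eq hp]
  exact (integrable_inv_one_add_sq.comp_mul_left' (by positivity : q / p ≠ 0)).const_mul _

lemma integral_inv_add_sq {p q : ℝ} (hp : 0 < p) (hq : 0 < q) :
    ∫ t : ℝ, (p ^ 2 + t ^ 2 * q ^ 2)⁻¹ = Real.pi / (p * q) := by
  simp only [inv_add_sq_eq hp]
  rw [integral_const_mul, Measure.integral_comp_mul_left (fun x : ℝ => (1 + x ^ 2)⁻¹),
    integral_univ_inv_one_add_sq, abs_of_pos (by positivity), smul_eq_mul]
  field_simp

lemma tendsto_line_quotient {n d : ℂ} (hd : d ≠ 0) (l : Filter ℝ)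
    (hl : Tendsto (fun t : ℝ => (t : ℂ)⁻¹) l (𝓝 0)) (hl0 : ∀ᶠ t : ℝ in l, t ≠ 0) :
    Tendsto (fun t : ℝ => (t : ℂ) / (n - Complex.I * t * d)) l (𝓝 (-(Complex.I * d))⁻¹) := by
  have h1 : Tendsto (fun t : ℝ => (n * (t : ℂ)⁻¹ - Complex.I * d)⁻¹) l
      (𝓝 (n * 0 - Complex.I * d)⁻¹) := by
    refine Tendsto.inv₀ ((hl.const_mul n).sub tendsto_const_nhds) ?_
    simpa using hd
  rw [mul_zero, zero_sub] at h1
  refine h1.congr' ?_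
  filter_upwards [hl0] with t ht
  have : (t : ℂ) ≠ 0 := Complex.ofReal_ne_zero.mpr ht
  rw [show n * (t : ℂ)⁻¹ - Complex.I * d = (n - Complex.I * t * d) / t by field_simp, inv_div]

/-- The integral along the imaginary line of a polynomial times a high negative power of a linear
form vanishes, as the integrand has a primitive that extends continuously to the infinite point. -/
lemma integral_line_eq_zero {n d : ℂ} (hn : n ≠ 0) (hd : d ≠ 0)
    (hne : ∀ t : ℝ, n - Complex.I * t * d ≠ 0) (a m : ℕ)
    (hint : Integrable fun t : ℝ => (t : ℂ) ^ a * ((n - Complex.I * t * d) ^ (a + m + 2))⁻¹) :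
    ∫ t : ℝ, (t : ℂ) ^ a * ((n - Complex.I * t * d) ^ (a + m + 2))⁻¹ = 0 := by
  set s : ℝ → ℂ := fun t => (t : ℂ) / (n - Complex.I * t * d)
  set P : ℂ → ℂ := fun s => (n ^ (m + 1))⁻¹ * ∑ j ∈ Finset.range (m + 1),
    (Complex.I * d) ^ j * (m.choose j) / (a + j + 1 : ℕ) * s ^ (a + j + 1)
  have hP : ∀ s, HasDerivAt P ((n ^ (m + 1))⁻¹ * (s ^ a * (Complex.I * d * s + 1) ^ m)) s := by
    intro s
    refine HasDerivAt.const_mul _ ?_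
    have h1 : s ^ a * (Complex.I * d * s + 1) ^ m = ∑ j ∈ Finset.range (m + 1),
        (Complex.I * d) ^ j * (m.choose j) / (a + j + 1 : ℕ) * ((a + j + 1 : ℕ) * s ^ (a + j)) := by
      rw [add_pow, Finset.mul_sum]
      refine Finset.sum_congr rfl fun j _ => ?_
      have : ((a + j + 1 : ℕ) : ℂ) ≠ 0 := Nat.cast_ne_zero.mpr (by omega)
      field_simp
      ring
    rw [h1]
    exact HasDerivAt.fun_sum fun j _ => (hasDerivAt_pow (a + j + 1) s).const_mul _
  have hs : ∀ t : ℝ, HasDerivAt s (n / (n - Complex.I * t * d) ^ 2) t := by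
    intro t
    have h1 : HasDerivAt (fun t : ℝ => (t : ℂ)) 1 t := Complex.ofRealCLM.hasDerivAt
    have h2 := ((h1.const_mul Complex.I).mul_const d).const_sub n
    refine (h1.div h2 (hne t)).congr_deriv ?_
    congr 1
    ring
  have hF : ∀ t : ℝ, HasDerivAt (fun t => P (s t))
      ((t : ℂ) ^ a * ((n - Complex.I * t * d) ^ (a + m + 2))⁻¹) t := by
    intro t
    refine ((hP (s t)).comp t (hs t)).congr_deriv ?_
    have h1 : Complex.I * d * s t + 1 = n / (n - Complex.I * t * d) := by
      have := hne t
      simp only [s]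
      rw [← mul_div_assoc, div_add_one this]
      congr 1
      ring
    have h0 := hne t
    rw [h1]
    simp only [s]
    rw [div_pow, div_pow, pow_add, pow_add, pow_succ]
    field_simp
    ring
  have hlim : ∀ l : Filter ℝ, Tendsto (fun t : ℝ => (t : ℂ)⁻¹) l (𝓝 0) → (∀ᶠ t : ℝ in l, t ≠ 0) →
      Tendsto (fun t => P (s t)) l (𝓝 (P (-(Complex.I * d))⁻¹)) := fun l hl hl0 =>
    (hP _).continuousAt.tendsto.comp (tendsto_line_quotient hd l hl hl0)
  have hinv : Tendsto (fun x : ℝ => ((x⁻¹ : ℝ) : ℂ)) atTop (𝓝 0) :=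
    (Complex.continuous_ofReal.tendsto' 0 0 (by simp)).comp tendsto_inv_atTop_zero
  have hinv' : Tendsto (fun x : ℝ => ((x⁻¹ : ℝ) : ℂ)) atBot (𝓝 0) :=
    (Complex.continuous_ofReal.tendsto' 0 0 (by simp)).comp tendsto_inv_atBot_zero
  simp only [Complex.ofReal_inv] at hinv hinv'
  rw [integral_of_hasDerivAt_of_tendsto hF hint
    (hlim atBot hinv' (eventually_ne_atBot 0)) (hlim atTop hinv (eventually_ne_atTop 0)), sub_self]

lemma norm_pow_mul_le {k n : ℕ} (hn0 : 0 < n) (hn : n < 2 * k - 2) {p q t c₀ : ℝ} (hc₀ : 0 < c₀)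
    (hp : c₀ ≤ p) (hq : c₀ ≤ q) : |t| ^ n * ((p ^ 2 + t ^ 2 * q ^ 2) ^ k)⁻¹ ≤
      (c₀ ^ (2 * k - 4))⁻¹ * ((p * q)⁻¹ * (p ^ 2 + t ^ 2 * q ^ 2)⁻¹) := by
  have hp0 : 0 < p := hc₀.trans_le hp
  have hq0 : 0 < q := hc₀.trans_le hq
  set X := p ^ 2 + t ^ 2 * q ^ 2 with hX
  have hXpos : 0 < X := by positivity
  set x := Real.sqrt X with hx
  have hx2 : x ^ 2 = X := Real.sq_sqrt hXpos.le
  have hxpos : 0 < x := Real.sqrt_pos.mpr hXpos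
  have hpx : p ≤ x := Real.le_sqrt_of_sq_le (by rw [hX]; nlinarith [sq_nonneg (t * q)])
  have hqx : |t| * q ≤ x := Real.le_sqrt_of_sq_le (by
    rw [hX, mul_pow, sq_abs]; nlinarith [sq_nonneg p])
  obtain ⟨a, rfl⟩ : ∃ a, n = a + 1 := ⟨n - 1, by omega⟩
  obtain ⟨b, hb⟩ : ∃ b, 2 * k = a + 1 + (b + 1) + 2 := ⟨2 * k - 2 - (a + 1) - 1, by omega⟩
  have hXk : X ^ k = x ^ (a + 1) * x ^ (b + 1) * X := by
    rw [← hx2, ← pow_mul, hb]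
    ring
  have h1 : |t| ^ (a + 1) * q ^ (a + 1) ≤ x ^ (a + 1) := by
    rw [← mul_pow]
    gcongr
  have h2 : p ^ (b + 1) ≤ x ^ (b + 1) := by gcongr
  have h3 : c₀ ^ a ≤ q ^ a := by gcongr
  have h4 : c₀ ^ b ≤ p ^ b := by gcongr
  have e : c₀ ^ (2 * k - 4) = c₀ ^ a * c₀ ^ b := by
    rw [← pow_add]
    congr 1
    omega
  rw [hXk, e]
  have h5 : |t| ^ (a + 1) ≤ x ^ (a + 1) / q ^ (a + 1) := by
    rw [le_div_iff₀ (by positivity)]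
    exact h1
  calc |t| ^ (a + 1) * (x ^ (a + 1) * x ^ (b + 1) * X)⁻¹
      ≤ (x ^ (a + 1) / q ^ (a + 1)) * (x ^ (a + 1) * p ^ (b + 1) * X)⁻¹ := by gcongr
    _ = (q ^ a * p ^ b)⁻¹ * ((p * q)⁻¹ * X⁻¹) := by
      rw [pow_succ q, pow_succ p]
      field_simp
    _ ≤ _ := by gcongr

lemma integral_lineKernel_inner {k n : ℕ} (hn0 : 0 < n) (hn : n < 2 * k - 2) {τ : ℍ}
    (hτ : (τ : ℂ) ∈ goodSet) (hre : |(τ : ℂ).re| ≤ 1 / 2) (him : 1 / 2 ≤ (τ : ℂ).im) :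
    ∫ t : ℝ, lineKernel k τ t * (t : ℂ) ^ n = 0 := by
  obtain ⟨c, hc, hsep⟩ := exists_line_separation hτ
  have hnu : ∀ M, nu M (τ : ℂ) ≠ 0 := fun M => nu_ne_zero M τ.im_pos.ne'
  have hde : ∀ M, de M (τ : ℂ) ≠ 0 := fun M => de_ne_zero M τ.im_pos.ne'
  have hlow : ∀ M : SL(2, ℤ), 1 / 4 ≤ ‖nu M (τ : ℂ)‖ ∧ 1 / 4 ≤ ‖de M (τ : ℂ)‖ := fun M => by
    obtain ⟨h1, h2⟩ := norm_forms_of_strip M hre him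
    exact ⟨by nlinarith [norm_nonneg (nu M (τ : ℂ))], by nlinarith [norm_nonneg (de M (τ : ℂ))]⟩
  set C : ℝ := (c ^ k)⁻¹ * (((1 / 4 : ℝ) ^ (2 * k - 4))⁻¹)
  set B : SL(2, ℤ) → ℝ → ℝ := fun M t => C * (‖nu M (τ : ℂ)‖ * ‖de M (τ : ℂ)‖)⁻¹ *
    (‖nu M (τ : ℂ)‖ ^ 2 + t ^ 2 * ‖de M (τ : ℂ)‖ ^ 2)⁻¹
  have hb : ∀ M t, ‖lineTerm k τ M t * (t : ℂ) ^ n‖ ≤ B M t := by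
    intro M t
    obtain ⟨h1, h2⟩ := hlow M
    rw [norm_mul, norm_pow, Complex.norm_real, Real.norm_eq_abs]
    have h3 := norm_lineTerm_le (k := k) hc (hnu M) (hsep M t)
    have h4 := norm_pow_mul_le hn0 hn (t := t) (by norm_num : (0 : ℝ) < 1 / 4) h1 h2
    calc _ ≤ (c ^ k)⁻¹ * ((‖nu M (τ : ℂ)‖ ^ 2 + t ^ 2 * ‖de M (τ : ℂ)‖ ^ 2) ^ k)⁻¹ * |t| ^ n := by
          gcongr
      _ = (c ^ k)⁻¹ * (|t| ^ n * ((‖nu M (τ : ℂ)‖ ^ 2 + t ^ 2 * ‖de M (τ : ℂ)‖ ^ 2) ^ k)⁻¹) := by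
          ring
      _ ≤ _ := mul_le_mul_of_nonneg_left h4 (by positivity)
      _ = _ := by simp only [B, C]; ring
  have hBint : ∀ M, Integrable (B M) := fun M =>
    (integrable_inv_add_sq (norm_pos_iff.mpr (hnu M)) (norm_pos_iff.mpr (hde M))).const_mul _
  have hcont : ∀ M, Continuous fun t : ℝ => lineTerm k τ M t * (t : ℂ) ^ n := fun M => by
    have h1 : ∀ t : ℝ, (nu M (τ : ℂ) - Complex.I * t * de M τ) ^ (2 * k) ≠ 0 := fun t =>
      pow_ne_zero _ (lineForm_ne_zero hτ M t)
    unfold lineTerm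
    fun_prop (disch := assumption)
  have hint : ∀ M, Integrable fun t : ℝ => lineTerm k τ M t * (t : ℂ) ^ n := fun M =>
    (hBint M).mono' (hcont M).aestronglyMeasurable (Eventually.of_forall (hb M))
  have hnorm : Summable fun M : SL(2, ℤ) => ∫ t : ℝ, ‖lineTerm k τ M t * (t : ℂ) ^ n‖ := by
    refine Summable.of_nonneg_of_le (fun M => integral_nonneg fun t => norm_nonneg _) (fun M => ?_)
      ((summable_inv_forms hre him).mul_left (C * Real.pi))
    refine (integral_mono (hint M).norm (hBint M) (hb M)).trans (le_of_eq ?_)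
    simp only [B]
    rw [integral_const_mul,
      integral_inv_add_sq (norm_pos_iff.mpr (hnu M)) (norm_pos_iff.mpr (hde M))]
    have h1 := norm_pos_iff.mpr (hnu M)
    have h2 := norm_pos_iff.mpr (hde M)
    field_simp
  have key := (hasSum_integral_of_summable_integral_norm hint hnorm).tsum_eq
  simp only [lineKernel_eq_tsum, ← tsum_mul_right]
  rw [← key]
  refine (tsum_congr fun M => ?_).trans tsum_zero
  have h1 := integral_line_eq_zero (hnu M) (hde M) (lineForm_ne_zero hτ M) n (2 * k - 2 - n) ?_
  · rw [show n + (2 * k - 2 - n) + 2 = 2 * k by omega] at h1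
    simpa only [lineTerm, mul_comm] using h1
  · rw [show n + (2 * k - 2 - n) + 2 = 2 * k by omega]
    simpa only [lineTerm, mul_comm] using hint M

/-! ### A Riemann sum -/

/-- The product of powers `(1 + iu)^(-a-1) (1 - iu)^(-b-1)`. -/
def mixedPower (a b : ℕ) (u : ℂ) : ℂ :=
  (1 + Complex.I * u)⁻¹ ^ (a + 1) * (1 - Complex.I * u)⁻¹ ^ (b + 1)

/-- The function `((1 + iu)^(-r) - (1 - iu)^(-r)) / u`, with its removable singularity removed. -/
def powerQuotient (r : ℕ) (u : ℂ) : ℂ :=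
  ∑ i ∈ Finset.range r, -2 * Complex.I * mixedPower i (r - 1 - i) u

/-- The derivative of `powerQuotient`. -/
def powerQuotientDeriv (r : ℕ) (u : ℂ) : ℂ :=
  ∑ i ∈ Finset.range r, (-2 * (i + 1 : ℕ) * mixedPower (i + 1) (r - 1 - i) u +
    2 * (r - 1 - i + 1 : ℕ) * mixedPower i (r - 1 - i + 1) u)

lemma normSq_one_add_ge {u : ℂ} (hu : |u.im| ≤ 1 / 2) :
    (1 + u.re ^ 2) / 4 ≤ ‖1 + Complex.I * u‖ ^ 2 := by
  obtain ⟨h1, h2⟩ := abs_le.mp hu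
  rw [Complex.sq_norm, Complex.normSq_apply]
  simp
  nlinarith [sq_nonneg u.re]

lemma norm_one_add_ge {u : ℂ} (hu : |u.im| ≤ 1 / 2) :
    Real.sqrt (1 + u.re ^ 2) / 2 ≤ ‖1 + Complex.I * u‖ := by
  refine le_of_sq_le_sq ?_ (norm_nonneg _)
  rw [div_pow, Real.sq_sqrt (by positivity)]
  exact le_trans (by norm_num) (normSq_one_add_ge hu)

lemma norm_one_sub_ge {u : ℂ} (hu : |u.im| ≤ 1 / 2) :
    Real.sqrt (1 + u.re ^ 2) / 2 ≤ ‖1 - Complex.I * u‖ := by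
  have h := norm_one_add_ge (u := -u) (by simpa using hu)
  simpa [sub_eq_add_neg] using h

lemma one_add_ne_zero_of_im {u : ℂ} (hu : |u.im| ≤ 1 / 2) : 1 + Complex.I * u ≠ 0 := by
  have h := norm_one_add_ge hu
  have h2 : 0 < Real.sqrt (1 + u.re ^ 2) / 2 := by positivity
  exact norm_pos_iff.mp (h2.trans_le h)

lemma one_sub_ne_zero_of_im {u : ℂ} (hu : |u.im| ≤ 1 / 2) : 1 - Complex.I * u ≠ 0 := by
  have h := norm_one_sub_ge hu
  have h2 : 0 < Real.sqrt (1 + u.re ^ 2) / 2 := by positivity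
  exact norm_pos_iff.mp (h2.trans_le h)

lemma norm_mixedPower_le (a b : ℕ) {u : ℂ} (hu : |u.im| ≤ 1 / 2) :
    ‖mixedPower a b u‖ ≤ 2 ^ a * 2 ^ b * 4 * (1 + u.re ^ 2)⁻¹ := by
  set s := Real.sqrt (1 + u.re ^ 2) with hs
  have hs1 : 1 ≤ s := Real.one_le_sqrt.mpr (by nlinarith [sq_nonneg u.re])
  have hs2 : s ^ 2 = 1 + u.re ^ 2 := Real.sq_sqrt (by positivity)
  have key : ∀ (x : ℂ) (n : ℕ), s / 2 ≤ ‖x‖ → ‖x⁻¹ ^ (n + 1)‖ ≤ 2 ^ n * 2 * s⁻¹ := by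
    intro x n hx
    have h1 : ‖x⁻¹‖ ≤ 2 * s⁻¹ := by
      rw [norm_inv, show 2 * s⁻¹ = (s / 2)⁻¹ by field_simp]
      gcongr
    have h2 : ‖x⁻¹‖ ≤ 2 := h1.trans (by
      have := inv_le_one_of_one_le₀ hs1
      linarith)
    rw [norm_pow, pow_succ, mul_assoc]
    gcongr
  rw [mixedPower, norm_mul, ← hs2]
  calc _ ≤ (2 ^ a * 2 * s⁻¹) * (2 ^ b * 2 * s⁻¹) := by
        gcongr
        · exact key _ _ (norm_one_add_ge hu)
        · exact key _ _ (norm_one_sub_ge hu)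
    _ = _ := by
      rw [sq s, mul_inv]
      ring

lemma exists_powerQuotient_bound (r : ℕ) : ∃ C : ℝ, 0 ≤ C ∧ ∀ u : ℂ, |u.im| ≤ 1 / 2 →
    ‖powerQuotient r u‖ ≤ C * (1 + u.re ^ 2)⁻¹ ∧
    ‖powerQuotientDeriv r u‖ ≤ C * (1 + u.re ^ 2)⁻¹ := by
  set C₁ : ℝ := ∑ i ∈ Finset.range r, 2 * (2 ^ i * 2 ^ (r - 1 - i) * 4) with hC₁
  set C₂ : ℝ := ∑ i ∈ Finset.range r, (2 * (i + 1 : ℕ) * (2 ^ (i + 1) * 2 ^ (r - 1 - i) * 4) +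
    2 * (r - 1 - i + 1 : ℕ) * (2 ^ i * 2 ^ (r - 1 - i + 1) * 4)) with hC₂
  have h1 : 0 ≤ C₁ := Finset.sum_nonneg fun i _ => by positivity
  have h2 : 0 ≤ C₂ := Finset.sum_nonneg fun i _ => by positivity
  refine ⟨C₁ + C₂, by positivity, fun u hu => ⟨?_, ?_⟩⟩
  · refine le_trans ?_ (mul_le_mul_of_nonneg_right (by linarith : C₁ ≤ C₁ + C₂) (by positivity))
    rw [powerQuotient, hC₁, Finset.sum_mul]
    refine norm_sum_le_of_le _ fun i _ => ?_
    rw [norm_mul, norm_mul, Complex.norm_I, norm_neg, Complex.norm_ofNat, mul_one, mul_assoc]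
    gcongr
    exact norm_mixedPower_le _ _ hu
  · refine le_trans ?_ (mul_le_mul_of_nonneg_right (by linarith : C₂ ≤ C₁ + C₂) (by positivity))
    rw [powerQuotientDeriv, hC₂, Finset.sum_mul]
    refine norm_sum_le_of_le _ fun i _ => (norm_add_le _ _).trans ?_
    rw [norm_mul, norm_mul, norm_neg, Complex.norm_ofNat, norm_mul, norm_mul, Complex.norm_ofNat,
      Complex.norm_natCast, Complex.norm_natCast, add_mul, mul_assoc (2 * _) _ (_)⁻¹,
      mul_assoc (2 * _) _ (_)⁻¹]
    gcongr
    · exact norm_mixedPower_le _ _ hu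
    · exact norm_mixedPower_le _ _ hu

lemma hasDerivAt_inv_one_add {u : ℂ} (hu : 1 + Complex.I * u ≠ 0) :
    HasDerivAt (fun u => (1 + Complex.I * u)⁻¹) (-Complex.I * (1 + Complex.I * u)⁻¹ ^ 2) u := by
  have h := (((hasDerivAt_id u).const_mul Complex.I).const_add 1).inv hu
  refine h.congr_deriv ?_
  simp [div_eq_mul_inv]

lemma hasDerivAt_inv_one_sub {u : ℂ} (hu : 1 - Complex.I * u ≠ 0) :
    HasDerivAt (fun u => (1 - Complex.I * u)⁻¹) (Complex.I * (1 - Complex.I * u)⁻¹ ^ 2) u := by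
  have h := (((hasDerivAt_id u).const_mul Complex.I).const_sub 1).inv hu
  refine h.congr_deriv ?_
  simp [div_eq_mul_inv]

lemma hasDerivAt_mixedPower (a b : ℕ) {u : ℂ} (hu : |u.im| ≤ 1 / 2) :
    HasDerivAt (mixedPower a b) (-Complex.I * (a + 1 : ℕ) * mixedPower (a + 1) b u +
      Complex.I * (b + 1 : ℕ) * mixedPower a (b + 1) u) u := by
  have h := ((hasDerivAt_inv_one_add (one_add_ne_zero_of_im hu)).pow (a + 1)).mul
    ((hasDerivAt_inv_one_sub (one_sub_ne_zero_of_im hu)).pow (b + 1))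
  refine h.congr_deriv ?_
  simp only [mixedPower, Nat.add_sub_cancel, Pi.pow_apply]
  ring

lemma hasDerivAt_powerQuotient (r : ℕ) {u : ℂ} (hu : |u.im| ≤ 1 / 2) :
    HasDerivAt (powerQuotient r) (powerQuotientDeriv r u) u := by
  have h := HasDerivAt.fun_sum (u := Finset.range r) fun i _ =>
    (hasDerivAt_mixedPower i (r - 1 - i) hu).const_mul (-2 * Complex.I)
  refine h.congr_deriv (Finset.sum_congr rfl fun i _ => ?_)
  ring_nf
  simp only [Complex.I_sq]
  ring

lemma continuousAt_powerQuotientDeriv (r : ℕ) {u : ℂ} (hu : |u.im| ≤ 1 / 2) :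
    ContinuousAt (powerQuotientDeriv r) u := by
  refine tendsto_finsetSum _ fun i _ => ?_
  exact (continuousAt_const.mul (hasDerivAt_mixedPower _ _ hu).continuousAt).add
    (continuousAt_const.mul (hasDerivAt_mixedPower _ _ hu).continuousAt)

lemma mul_powerQuotient (r : ℕ) {u : ℂ} (h1 : 1 + Complex.I * u ≠ 0) (h2 : 1 - Complex.I * u ≠ 0) :
    u * powerQuotient r u = (1 + Complex.I * u)⁻¹ ^ r - (1 - Complex.I * u)⁻¹ ^ r := by
  have e : (1 + Complex.I * u)⁻¹ - (1 - Complex.I * u)⁻¹ =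
      -2 * Complex.I * u * ((1 + Complex.I * u)⁻¹ * (1 - Complex.I * u)⁻¹) := by
    field_simp
    ring
  rw [← geom_sum₂_mul, e, powerQuotient, Finset.mul_sum, Finset.sum_mul]
  refine Finset.sum_congr rfl fun i _ => ?_
  rw [mixedPower]
  ring

lemma powerQuotient_eq (r : ℕ) {u : ℂ} (h1 : 1 + Complex.I * u ≠ 0) (h2 : 1 - Complex.I * u ≠ 0) :
    powerQuotient r u = -Complex.I * ∑ j ∈ Finset.range r,
      ((1 + Complex.I * u)⁻¹ ^ (j + 1) + (1 - Complex.I * u)⁻¹ ^ (j + 1)) := by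
  rcases eq_or_ne u 0 with rfl | hu
  · simp only [powerQuotient, mixedPower, mul_zero, add_zero, sub_zero, inv_one, one_pow, mul_one,
      Finset.sum_const, Finset.card_range, nsmul_eq_mul]
    ring
  · refine mul_left_cancel₀ hu ?_
    rw [mul_powerQuotient r h1 h2]
    set A := (1 + Complex.I * u)⁻¹ with hA
    set B := (1 - Complex.I * u)⁻¹ with hB
    have hA' : A - 1 = -Complex.I * u * A := by
      rw [hA]
      field_simp
      ring
    have hB' : B - 1 = Complex.I * u * B := by
      rw [hB]
      field_simp
      ring
    have e1 := geom_sum_mul A r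
    have e2 := geom_sum_mul B r
    rw [hA'] at e1
    rw [hB'] at e2
    simp only [pow_succ, Finset.sum_add_distrib, ← Finset.sum_mul]
    linear_combination e2 - e1

lemma tendsto_inv_one_add {s : ℝ} (hs : |s| = 1) (l : Filter ℝ)
    (hl : Tendsto (fun x : ℝ => x⁻¹) l (𝓝 0)) (hl0 : ∀ᶠ x : ℝ in l, x ≠ 0) :
    Tendsto (fun x : ℝ => (1 + Complex.I * (s * x : ℝ))⁻¹) l (𝓝 0) := by
  refine squeeze_zero_norm' ?_ (by simpa only [abs_zero] using hl.abs)
  filter_upwards [hl0] with x hx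
  rw [norm_inv, abs_inv]
  have h1 : |x| ≤ ‖1 + Complex.I * (s * x : ℝ)‖ := by
    have := Complex.abs_im_le_norm (1 + Complex.I * (s * x : ℝ))
    simpa [abs_mul, hs] using this
  have := abs_pos.mpr hx
  gcongr

/-- A primitive of `powerQuotient (m + 1)` along the real line. -/
def powerQuotientPrimitive (m : ℕ) (x : ℝ) : ℂ :=
  -Complex.I * (∑ j ∈ Finset.range m, (Complex.I / (j + 1 : ℕ)) *
    ((1 + Complex.I * x)⁻¹ ^ (j + 1) - (1 - Complex.I * x)⁻¹ ^ (j + 1)) + 2 * (Real.arctan x : ℂ))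

lemma hasDerivAt_powerQuotientPrimitive (m : ℕ) (x : ℝ) :
    HasDerivAt (powerQuotientPrimitive m) (powerQuotient (m + 1) x) x := by
  have hx : |(x : ℂ).im| ≤ 1 / 2 := by simp
  have h1 := one_add_ne_zero_of_im hx
  have h2 := one_sub_ne_zero_of_im hx
  rw [powerQuotient_eq _ h1 h2, Finset.sum_range_succ']
  refine HasDerivAt.const_mul _ (HasDerivAt.add (HasDerivAt.fun_sum fun j _ => ?_) ?_)
  · have h := (((hasDerivAt_inv_one_add h1).fun_pow (j + 1)).sub
      ((hasDerivAt_inv_one_sub h2).fun_pow (j + 1))).const_mul (Complex.I / (j + 1 : ℕ))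
    refine h.comp_ofReal.congr_deriv ?_
    have : ((j + 1 : ℕ) : ℂ) ≠ 0 := Nat.cast_ne_zero.mpr (by omega)
    rw [Nat.add_sub_cancel]
    generalize (1 + Complex.I * (x : ℂ))⁻¹ = A
    generalize (1 - Complex.I * (x : ℂ))⁻¹ = B
    field_simp
    linear_combination (-(A ^ (j + 2)) - B ^ (j + 2)) * Complex.I_sq
  · have h := ((Real.hasDerivAt_arctan x).ofReal_comp).const_mul (2 : ℂ)
    refine h.congr_deriv ?_
    have h3 : (1 + Complex.I * x) * (1 - Complex.I * x) = 1 + (x : ℂ) ^ 2 := by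
      linear_combination (-(x : ℂ) ^ 2) * Complex.I_sq
    have h4 : (1 + (x : ℂ) ^ 2) ≠ 0 := h3 ▸ mul_ne_zero h1 h2
    push_cast
    rw [pow_one, pow_one, ← h3]
    field_simp
    ring

lemma tendsto_powerQuotientPrimitive (m : ℕ) (l : Filter ℝ)
    (hl : Tendsto (fun x : ℝ => x⁻¹) l (𝓝 0)) (hl0 : ∀ᶠ x : ℝ in l, x ≠ 0) {a : ℝ}
    (ha : Tendsto Real.arctan l (𝓝 a)) :
    Tendsto (powerQuotientPrimitive m) l (𝓝 (-2 * Complex.I * a)) := by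
  have h1 := tendsto_inv_one_add abs_one l hl hl0
  have h2 := tendsto_inv_one_add (s := -1) (by simp) l hl hl0
  simp only [one_mul, neg_mul, Complex.ofReal_neg, mul_neg, ← sub_eq_add_neg] at h1 h2
  have h3 : Tendsto (fun x : ℝ => ∑ j ∈ Finset.range m, (Complex.I / (j + 1 : ℕ)) *
      ((1 + Complex.I * x)⁻¹ ^ (j + 1) - (1 - Complex.I * x)⁻¹ ^ (j + 1))) l
      (𝓝 (∑ j ∈ Finset.range m, (Complex.I / (j + 1 : ℕ)) * ((0 : ℂ) ^ (j + 1) - 0 ^ (j + 1)))) :=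
    tendsto_finsetSum _ fun j _ => ((h1.pow (j + 1)).sub (h2.pow (j + 1))).const_mul _
  have h4 : Tendsto (fun x => (Real.arctan x : ℂ)) l (𝓝 (a : ℂ)) :=
    (Complex.continuous_ofReal.tendsto a).comp ha
  have h5 := (h3.add (h4.const_mul 2)).const_mul (-Complex.I)
  simp only [sub_self, mul_zero, Finset.sum_const_zero, zero_add] at h5
  rw [show -2 * Complex.I * (a : ℂ) = -Complex.I * (2 * a) by ring]
  exact h5

lemma continuous_powerQuotient_add (r : ℕ) {ε : ℝ} (hε : |ε| ≤ 1 / 2) :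
    Continuous fun x : ℝ => powerQuotient r (x + Complex.I * ε) := by
  refine continuous_iff_continuousAt.mpr fun x => ?_
  have h := (hasDerivAt_powerQuotient r (u := x + Complex.I * ε) (by simpa using hε)).continuousAt
  exact h.comp (f := fun x : ℝ => (x + Complex.I * ε : ℂ)) (by fun_prop)

lemma integrable_powerQuotient (r : ℕ) {ε : ℝ} (hε : |ε| ≤ 1 / 2) :
    Integrable fun x : ℝ => powerQuotient r (x + Complex.I * ε) := by
  obtain ⟨C, hC, h⟩ := exists_powerQuotient_bound r
  refine (integrable_inv_one_add_sq.const_mul C).mono'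
    (continuous_powerQuotient_add r hε).aestronglyMeasurable (Eventually.of_forall fun x => ?_)
  simpa using (h (x + Complex.I * ε) (by simpa using hε)).1

lemma integral_powerQuotient {r : ℕ} (hr : 0 < r) :
    ∫ x : ℝ, powerQuotient r x = -2 * Complex.I * Real.pi := by
  obtain ⟨m, rfl⟩ : ∃ m, r = m + 1 := ⟨r - 1, by omega⟩
  have hint : Integrable fun x : ℝ => powerQuotient (m + 1) x := by
    simpa using integrable_powerQuotient (m + 1) (ε := 0) (by simp)
  rw [integral_of_hasDerivAt_of_tendsto (hasDerivAt_powerQuotientPrimitive m) hint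
    (tendsto_powerQuotientPrimitive m atBot tendsto_inv_atBot_zero (eventually_ne_atBot 0)
      (Real.tendsto_arctan_atBot.mono_right nhdsWithin_le_nhds))
    (tendsto_powerQuotientPrimitive m atTop tendsto_inv_atTop_zero (eventually_ne_atTop 0)
      (Real.tendsto_arctan_atTop.mono_right nhdsWithin_le_nhds))]
  push_cast
  ring

lemma norm_powerQuotient_sub_le {r : ℕ} {C : ℝ}
    (hC : ∀ u : ℂ, |u.im| ≤ 1 / 2 → ‖powerQuotientDeriv r u‖ ≤ C * (1 + u.re ^ 2)⁻¹)
    {ε : ℝ} (hε : |ε| ≤ 1 / 2) (x : ℝ) :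
    ‖powerQuotient r (x + Complex.I * ε) - powerQuotient r x‖ ≤ C * (1 + x ^ 2)⁻¹ * |ε| := by
  have h1 : ∀ s ∈ Metric.closedBall (0 : ℝ) (1 / 2),
      HasDerivWithinAt (fun s : ℝ => powerQuotient r (x + Complex.I * s))
        (powerQuotientDeriv r (x + Complex.I * s) * Complex.I) (Metric.closedBall 0 (1 / 2)) s := by
    intro s hs
    have h2 := hasDerivAt_powerQuotient r (u := x + Complex.I * s) (by simpa using hs)
    have h3 : HasDerivAt (fun s : ℂ => (x : ℂ) + Complex.I * s) Complex.I s := by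
      simpa using ((hasDerivAt_id (s : ℂ)).const_mul Complex.I).const_add (x : ℂ)
    exact (h2.comp (s : ℂ) h3).comp_ofReal.hasDerivWithinAt
  have h4 := (convex_closedBall (0 : ℝ) (1 / 2)).norm_image_sub_le_of_norm_hasDerivWithin_le
    (C := C * (1 + x ^ 2)⁻¹) (x := 0) (y := ε) h1 (fun s hs => ?_) (by simp) (by simpa using hε)
  · simpa using h4
  · have h5 := hC (x + Complex.I * s) (by simpa using hs)
    rw [norm_mul, Complex.norm_I, mul_one]
    simpa using h5

/-- A sum over the integers is approximated by the integral with an error at most the total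
variation of the function. -/
lemma summable_and_norm_tsum_sub_integral_le {F F' : ℝ → ℂ} (hF : ∀ x, HasDerivAt F (F' x) x)
    (hcont : Continuous F') (hint : Integrable F) (hint' : Integrable F') :
    Summable (fun m : ℤ => F m) ∧ ‖∑' m : ℤ, F m - ∫ x, F x‖ ≤ ∫ x, ‖F' x‖ := by
  have h1 : HasSum (fun m : ℤ => ∫ x in (m : ℝ)..m + 1, F x) (∫ x, F x) := by
    simpa using hint.hasSum_intervalIntegral 0
  have h2 : HasSum (fun m : ℤ => ∫ x in (m : ℝ)..m + 1, ‖F' x‖) (∫ x, ‖F' x‖) := by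
    simpa using hint'.norm.hasSum_intervalIntegral 0
  have h3 : ∀ m : ℤ, ‖F m - ∫ x in (m : ℝ)..m + 1, F x‖ ≤ ∫ x in (m : ℝ)..m + 1, ‖F' x‖ := by
    intro m
    have hparts := intervalIntegral.integral_mul_deriv_eq_deriv_mul (a := (m : ℝ)) (b := m + 1)
      (u := fun x : ℝ => ((x - m - 1 : ℝ) : ℂ)) (u' := fun _ => 1) (v := F) (v' := F')
      (fun x _ => by
        have := (((hasDerivAt_id x).sub_const (m : ℝ)).sub_const 1).ofReal_comp
        simpa using this) (fun x _ => hF x)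
      (by simp) (hcont.intervalIntegrable _ _)
    have e : F m - ∫ x in (m : ℝ)..m + 1, F x =
        ∫ x in (m : ℝ)..m + 1, ((x - m - 1 : ℝ) : ℂ) * F' x := by
      rw [hparts]
      simp
    rw [e]
    refine intervalIntegral.norm_integral_le_of_norm_le (by simp) ?_
      (hcont.norm.intervalIntegrable _ _)
    refine Eventually.of_forall fun x hx => ?_
    have hx1 : |x - m - 1| ≤ 1 := abs_le.mpr ⟨by linarith [hx.1], by linarith [hx.2]⟩
    rw [norm_mul, Complex.norm_real, Real.norm_eq_abs]
    exact mul_le_of_le_one_left (norm_nonneg _) hx1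
  have h4 := Summable.of_norm_bounded h2.summable h3
  have h5 : HasSum (fun m : ℤ => F m - ∫ x in (m : ℝ)..m + 1, F x)
    (∑' m : ℤ, (F m - ∫ x in (m : ℝ)..m + 1, F x)) := h4.hasSum
  have h6 := h5.add h1
  simp only [sub_add_cancel] at h6
  refine ⟨h6.summable, ?_⟩
  rw [h6.tsum_eq, add_sub_cancel_right, ← h2.tsum_eq]
  exact tsum_of_norm_bounded h2.summable.hasSum h3

theorem exists_riemannSum_bound {r : ℕ} (hr : 0 < r) : ∃ C : ℝ, 0 ≤ C ∧ ∀ (w : ℂ) (δ : ℝ), 0 < δ →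
    δ * |w.im| ≤ 1 / 2 → Summable (fun m : ℤ => δ * powerQuotient r (δ * (w + m))) ∧
    ‖∑' m : ℤ, δ * powerQuotient r (δ * (w + m)) + 2 * Complex.I * Real.pi‖ ≤
      C * δ * (1 + |w.im|) := by
  obtain ⟨C, hC, hb⟩ := exists_powerQuotient_bound r
  refine ⟨C * Real.pi, by positivity, fun w δ hδ hw => ?_⟩
  have him : ∀ x : ℝ, ((δ : ℂ) * (w + x)).im = δ * w.im := fun x => by simp
  have hre : ∀ x : ℝ, ((δ : ℂ) * (w + x)).re = δ * (x + w.re) := fun x => by simp [add_comm]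
  have him' : ∀ x : ℝ, |((δ : ℂ) * (w + x)).im| ≤ 1 / 2 := fun x => by
    rwa [him, abs_mul, abs_of_pos hδ]
  set ε := δ * w.im with hε
  have hε' : |ε| ≤ 1 / 2 := by rwa [hε, abs_mul, abs_of_pos hδ]
  set F : ℝ → ℂ := fun x => δ * powerQuotient r (δ * (w + x)) with hF
  set F' : ℝ → ℂ := fun x => δ * (powerQuotientDeriv r (δ * (w + x)) * δ) with hF'
  have hderiv : ∀ x, HasDerivAt F (F' x) x := fun x => by
    have h3 : HasDerivAt (fun s : ℂ => (δ : ℂ) * (w + s)) δ x := by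
      simpa using ((hasDerivAt_id (x : ℂ)).const_add w).const_mul (δ : ℂ)
    exact (((hasDerivAt_powerQuotient r (him' x)).comp (x : ℂ) h3).const_mul (δ : ℂ)).comp_ofReal
  have hscale : Integrable fun x : ℝ => (1 + (δ * (x + w.re)) ^ 2)⁻¹ :=
    (integrable_inv_one_add_sq.comp_mul_left' hδ.ne').comp_add_right w.re
  have hscale' : ∫ x : ℝ, (1 + (δ * (x + w.re)) ^ 2)⁻¹ = δ⁻¹ * Real.pi := by
    rw [integral_add_right_eq_self (fun x : ℝ => (1 + (δ * x) ^ 2)⁻¹) w.re,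
      Measure.integral_comp_mul_left (fun x : ℝ => (1 + x ^ 2)⁻¹), integral_univ_inv_one_add_sq,
      abs_of_pos (by positivity), smul_eq_mul]
  have hcont' : Continuous F' := by
    refine continuous_iff_continuousAt.mpr fun x => ?_
    have h3 : ContinuousAt (fun s : ℝ => (δ : ℂ) * (w + s)) x := by fun_prop
    exact continuousAt_const.mul (((continuousAt_powerQuotientDeriv r (him' x)).comp
      (f := fun s : ℝ => (δ : ℂ) * (w + s)) h3).mul continuousAt_const)
  have hbF : ∀ x, ‖F x‖ ≤ δ * C * (1 + (δ * (x + w.re)) ^ 2)⁻¹ := fun x => by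
    rw [hF, norm_mul, Complex.norm_real, Real.norm_of_nonneg hδ.le, mul_assoc, ← hre]
    exact mul_le_mul_of_nonneg_left (hb _ (him' x)).1 hδ.le
  have hbF' : ∀ x, ‖F' x‖ ≤ δ ^ 2 * C * (1 + (δ * (x + w.re)) ^ 2)⁻¹ := fun x => by
    rw [hF', norm_mul, norm_mul, Complex.norm_real, Real.norm_of_nonneg hδ.le, ← hre]
    nlinarith [mul_le_mul_of_nonneg_left (hb _ (him' x)).2 (sq_nonneg δ)]
  have hcontF : Continuous F := continuous_iff_continuousAt.mpr fun x => (hderiv x).continuousAt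
  have hintF : Integrable F := (hscale.const_mul _).mono' hcontF.aestronglyMeasurable
    (Eventually.of_forall hbF)
  have hintF' : Integrable F' := (hscale.const_mul _).mono' hcont'.aestronglyMeasurable
    (Eventually.of_forall hbF')
  obtain ⟨hsum, hle⟩ := summable_and_norm_tsum_sub_integral_le hderiv hcont' hintF hintF'
  have h1 : ∫ x, ‖F' x‖ ≤ C * Real.pi * δ := by
    refine (integral_mono hintF'.norm (hscale.const_mul _) hbF').trans (le_of_eq ?_)
    rw [integral_const_mul, hscale']
    field_simp
  have h2 : ∫ x, F x = ∫ x : ℝ, powerQuotient r (x + Complex.I * ε) := by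
    have e : ∀ x : ℝ, F x = δ * powerQuotient r ((δ * (x + w.re) : ℝ) + Complex.I * ε) := by
      intro x
      simp only [hF]
      congr 2
      apply Complex.ext
      · rw [hre]; simp
      · rw [him]; simp
    simp only [e]
    rw [integral_add_right_eq_self
      (fun x : ℝ => (δ : ℂ) * powerQuotient r ((δ * x : ℝ) + Complex.I * ε)) w.re,
      integral_const_mul,
      Measure.integral_comp_mul_left (fun x : ℝ => powerQuotient r (x + Complex.I * ε)),
      abs_of_pos (by positivity), Complex.real_smul, ← mul_assoc]
    push_cast
    rw [mul_inv_cancel₀ (Complex.ofReal_ne_zero.mpr hδ.ne'), one_mul]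
  have h3 : ‖(∫ x, F x) + 2 * Complex.I * Real.pi‖ ≤ C * Real.pi * |ε| := by
    have hint0 : Integrable fun x : ℝ => powerQuotient r x := by
      simpa using integrable_powerQuotient r (ε := 0) (by simp)
    rw [h2, show (2 * Complex.I * Real.pi : ℂ) = -∫ x : ℝ, powerQuotient r x by
      rw [integral_powerQuotient hr]; ring, ← sub_eq_add_neg,
      ← integral_sub (integrable_powerQuotient r hε') hint0]
    refine (norm_integral_le_of_norm_le ((integrable_inv_one_add_sq.const_mul C).mul_const |ε|)
      (Eventually.of_forall fun x =>
        norm_powerQuotient_sub_le (fun u hu => (hb u hu).2) hε' x)).trans (le_of_eq ?_)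
    rw [integral_mul_const, integral_const_mul, integral_univ_inv_one_add_sq]
  refine ⟨hsum, ?_⟩
  have h4 : |ε| = δ * |w.im| := by rw [hε, abs_mul, abs_of_pos hδ]
  calc _ = ‖(∑' m : ℤ, F m - ∫ x, F x) + ((∫ x, F x) + 2 * Complex.I * Real.pi)‖ := by
        rw [← add_assoc, sub_add_cancel]
        simp [hF]
    _ ≤ C * Real.pi * δ + C * Real.pi * |ε| := (norm_add_le _ _).trans (add_le_add (hle.trans h1) h3)
    _ = _ := by rw [h4]; ring

/-! ### Cosets of the translations -/

lemma T_zpow_entries (m : ℤ) : (ModularGroup.T ^ m) 0 0 = 1 ∧ (ModularGroup.T ^ m) 0 1 = m ∧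
    (ModularGroup.T ^ m) 1 0 = 0 ∧ (ModularGroup.T ^ m) 1 1 = 1 := by
  simp [ModularGroup.coe_T_zpow]

lemma nu_T_zpow_mul (m : ℤ) (M : SL(2, ℤ)) (z : ℂ) :
    nu (ModularGroup.T ^ m * M) z = nu M z + m * de M z := by
  obtain ⟨h1, h2, -, -⟩ := T_zpow_entries m
  simp only [nu, de, mul_entry, h1, h2]
  push_cast
  ring

lemma de_T_zpow_mul (m : ℤ) (M : SL(2, ℤ)) (z : ℂ) : de (ModularGroup.T ^ m * M) z = de M z := by
  obtain ⟨-, -, h1, h2⟩ := T_zpow_entries m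
  simp only [de, mul_entry, h1, h2]
  push_cast
  ring

lemma nu_S_mul (M : SL(2, ℤ)) (z : ℂ) : nu (ModularGroup.S * M) z = -de M z := by
  simp only [nu, de, mul_entry]
  simp [ModularGroup.coe_S]
  ring

lemma de_S_mul (M : SL(2, ℤ)) (z : ℂ) : de (ModularGroup.S * M) z = nu M z := by
  simp only [nu, de, mul_entry]
  simp [ModularGroup.coe_S]

lemma exists_bottom_row (v : EisensteinSeries.gammaSet 1 1 0) :
    ∃ M : SL(2, ℤ), M 1 0 = (v : Fin 2 → ℤ) 0 ∧ M 1 1 = (v : Fin 2 → ℤ) 1 := by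
  obtain ⟨M, -, h⟩ := ModularGroup.bottom_row_surj ((EisensteinSeries.mem_gammaSet_one _).mp v.2)
  exact ⟨M, congrFun h 0, congrFun h 1⟩

/-- A matrix with a given bottom row. -/
def cosetRep (v : EisensteinSeries.gammaSet 1 1 0) : SL(2, ℤ) := (exists_bottom_row v).choose

lemma cosetRep_spec (v : EisensteinSeries.gammaSet 1 1 0) :
    cosetRep v 1 0 = (v : Fin 2 → ℤ) 0 ∧ cosetRep v 1 1 = (v : Fin 2 → ℤ) 1 :=
  (exists_bottom_row v).choose_spec

lemma coset_bijective : Function.Bijective fun p : EisensteinSeries.gammaSet 1 1 0 × ℤ =>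
    ModularGroup.T ^ p.2 * cosetRep p.1 := by
  have hrow : ∀ (m : ℤ) (M : SL(2, ℤ)) (j : Fin 2), (ModularGroup.T ^ m * M) 1 j = M 1 j := by
    intro m M j
    obtain ⟨-, -, h1, h2⟩ := T_zpow_entries m
    rw [mul_entry, h1, h2]
    ring
  refine ⟨fun ⟨v, m⟩ ⟨w, l⟩ h => ?_, fun M => ?_⟩
  · simp only at h
    have hv : v = w := by
      refine Subtype.ext (funext fun j => ?_)
      have h1 := congrArg (fun M : SL(2, ℤ) => M 1 j) h
      simp only [hrow] at h1
      fin_cases j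
      · exact (cosetRep_spec v).1.symm.trans (h1.trans (cosetRep_spec w).1)
      · exact (cosetRep_spec v).2.symm.trans (h1.trans (cosetRep_spec w).2)
    subst hv
    have h2 := congrArg (fun M : SL(2, ℤ) => M 0 1) (mul_right_cancel h)
    simp only [(T_zpow_entries _).2.1] at h2
    rw [h2]
  · have hco : IsCoprime (M 1 0) (M 1 1) := ModularGroup.bottom_row_coprime M
    set v : EisensteinSeries.gammaSet 1 1 0 :=
      ⟨![M 1 0, M 1 1], (EisensteinSeries.mem_gammaSet_one _).mpr (by simpa using hco)⟩ with hv
    set N := cosetRep v with hN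
    have h10 : N 1 0 = M 1 0 := (cosetRep_spec v).1
    have h11 : N 1 1 = M 1 1 := (cosetRep_spec v).2
    have d1 := det_entries M
    have d2 := det_entries N
    rw [h10, h11] at d2
    refine ⟨(v, M 0 1 * N 0 0 - M 0 0 * N 0 1), ?_⟩
    simp only
    ext i j
    rw [← hN]
    fin_cases i
    · obtain ⟨h1, h2, -, -⟩ := T_zpow_entries (M 0 1 * N 0 0 - M 0 0 * N 0 1)
      fin_cases j
      · change (ModularGroup.T ^ (M 0 1 * N 0 0 - M 0 0 * N 0 1) * N) 0 0 = M 0 0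
        rw [mul_entry, h1, h2, h10]
        linear_combination (-(N 0 0)) * d1 + M 0 0 * d2
      · change (ModularGroup.T ^ (M 0 1 * N 0 0 - M 0 0 * N 0 1) * N) 0 1 = M 0 1
        rw [mul_entry, h1, h2, h11]
        linear_combination (-(N 0 1)) * d1 + M 0 1 * d2
    · fin_cases j
      · exact (hrow _ _ _).trans h10
      · exact (hrow _ _ _).trans h11

/-- The decomposition of the modular group into cosets of the translations. -/
def cosetEquiv : EisensteinSeries.gammaSet 1 1 0 × ℤ ≃ SL(2, ℤ) :=
  Equiv.ofBijective _ coset_bijective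

lemma eisSummand_eq_de (k : ℕ) (v : EisensteinSeries.gammaSet 1 1 0) (τ : ℍ) :
    EisensteinSeries.eisSummand ((2 * k : ℕ) : ℤ) v τ = (de (cosetRep v) τ ^ (2 * k))⁻¹ := by
  rw [EisensteinSeries.eisSummand, de, (cosetRep_spec v).1, (cosetRep_spec v).2, zpow_neg,
    zpow_natCast]

lemma summable_norm_inv_de {k : ℕ} (hk : 2 ≤ k) (τ : ℍ) :
    Summable fun v => ‖(de (cosetRep v) τ ^ (2 * k))⁻¹‖ := by
  have h := (EisensteinSeries.summable_norm_eisSummand (k := ((2 * k : ℕ) : ℤ)) (by omega) τ).subtype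
    (EisensteinSeries.gammaSet 1 1 0)
  refine h.congr fun v => ?_
  simp only [Function.comp, eisSummand_eq_de]

lemma three_le_two_mul {k : ℕ} (hk : 2 ≤ k) : 3 ≤ 2 * k := by omega

lemma hasSum_inv_de {k : ℕ} (hk : 2 ≤ k) (τ : ℍ) :
    HasSum (fun v => (de (cosetRep v) τ ^ (2 * k))⁻¹)
      (2 * ModularForm.E (three_le_two_mul hk) τ) := by
  have e : 2 * ModularForm.E (three_le_two_mul hk) τ =
      ∑' v : EisensteinSeries.gammaSet 1 1 0, (de (cosetRep v) τ ^ (2 * k))⁻¹ := by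
    rw [← tsum_congr fun v => eisSummand_eq_de k v τ]
    change 2 * ((1 / 2 : ℂ) • eisensteinSeries 0 _ τ) = _
    rw [smul_eq_mul, ← mul_assoc, mul_one_div_cancel two_ne_zero, one_mul, eisensteinSeries]
  rw [e]
  exact (summable_norm_inv_de hk τ).of_norm.hasSum

/-! ### The zeroth moment -/

/-- The integral of two terms of the line kernel over a half-line. -/
lemma integral_Ioi_line {n d : ℂ} (hd : d ≠ 0) (hne : ∀ t : ℝ, n - Complex.I * t * d ≠ 0) {k : ℕ}
    (hk : 2 ≤ k) (δ : ℝ) (hint : IntegrableOn (fun t : ℝ => ((n - Complex.I * t * d) ^ (2 * k))⁻¹ +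
      ((n - Complex.I * (-t : ℝ) * d) ^ (2 * k))⁻¹) (Set.Ioi δ)) :
    ∫ t in Set.Ioi δ, (((n - Complex.I * t * d) ^ (2 * k))⁻¹ +
      ((n - Complex.I * (-t : ℝ) * d) ^ (2 * k))⁻¹) = (Complex.I * (2 * k - 1 : ℕ) * d)⁻¹ *
        ((n - Complex.I * (-δ : ℝ) * d)⁻¹ ^ (2 * k - 1) -
          (n - Complex.I * δ * d)⁻¹ ^ (2 * k - 1)) := by
  obtain ⟨r, hr, hr'⟩ : ∃ r, 2 * k = r + 2 ∧ 2 * k - 1 = r + 1 := ⟨2 * k - 2, by omega, by omega⟩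
  set G : ℝ → ℂ := fun t => (Complex.I * (2 * k - 1 : ℕ) * d)⁻¹ *
    ((n - Complex.I * t * d)⁻¹ ^ (2 * k - 1) - (n - Complex.I * (-t : ℝ) * d)⁻¹ ^ (2 * k - 1)) with hG
  have h0 : ((2 * k - 1 : ℕ) : ℂ) ≠ 0 := Nat.cast_ne_zero.mpr (by omega)
  have hderiv : ∀ t : ℝ, HasDerivAt G (((n - Complex.I * t * d) ^ (2 * k))⁻¹ +
      ((n - Complex.I * (-t : ℝ) * d) ^ (2 * k))⁻¹) t := by
    intro t
    have h1 : HasDerivAt (fun t : ℝ => (t : ℂ)) 1 t := Complex.ofRealCLM.hasDerivAt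
    have h2 := (((h1.const_mul Complex.I).mul_const d).const_sub n).fun_inv (hne t)
    have h1' : HasDerivAt (fun t : ℝ => ((-t : ℝ) : ℂ)) (-1) t := by
      simpa only [Complex.ofReal_neg] using h1.fun_neg
    have h3 := (((h1'.const_mul Complex.I).mul_const d).const_sub n).fun_inv (hne (-t))
    refine (((h2.fun_pow (2 * k - 1)).sub (h3.fun_pow (2 * k - 1))).const_mul _).congr_deriv ?_
    simp only [div_eq_mul_inv, ← inv_pow]
    rw [hr'] at h0 ⊢
    rw [hr]
    generalize (n - Complex.I * t * d)⁻¹ = A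
    generalize (n - Complex.I * (-t : ℝ) * d)⁻¹ = B
    have hI := Complex.I_ne_zero
    rw [Nat.add_sub_cancel]
    field_simp
    ring
  have htends : ∀ l : Filter ℝ, Tendsto (fun t : ℝ => (t : ℂ)⁻¹) l (𝓝 0) →
      (∀ᶠ t : ℝ in l, t ≠ 0) → Tendsto (fun t : ℝ => (n - Complex.I * t * d)⁻¹) l (𝓝 0) := by
    intro l hl hl0
    have h := (tendsto_line_quotient (n := n) hd l hl hl0).mul hl
    rw [mul_zero] at h
    refine h.congr' ?_
    filter_upwards [hl0] with t ht
    have : (t : ℂ) ≠ 0 := Complex.ofReal_ne_zero.mpr ht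
    field_simp
  have hinv : Tendsto (fun x : ℝ => ((x : ℝ) : ℂ)⁻¹) atTop (𝓝 0) := by
    simpa only [Function.comp_def, Complex.ofReal_inv] using
      (Complex.continuous_ofReal.tendsto' 0 0 (by simp)).comp tendsto_inv_atTop_zero
  have hinv' : Tendsto (fun x : ℝ => ((x : ℝ) : ℂ)⁻¹) atBot (𝓝 0) := by
    simpa only [Function.comp_def, Complex.ofReal_inv] using
      (Complex.continuous_ofReal.tendsto' 0 0 (by simp)).comp tendsto_inv_atBot_zero
  have hlim : Tendsto G atTop (𝓝 0) := by
    have h1 := (htends atTop hinv (eventually_ne_atTop 0)).pow (2 * k - 1)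
    have h2 := ((htends atBot hinv' (eventually_ne_atBot 0)).comp
      tendsto_neg_atTop_atBot).pow (2 * k - 1)
    have h3 := (h1.sub h2).const_mul (Complex.I * (2 * k - 1 : ℕ) * d)⁻¹
    rwa [zero_pow (by omega), sub_self, mul_zero] at h3
  rw [integral_Ioi_of_hasDerivAt_of_tendsto' (fun t _ => hderiv t) hint hlim, hG, zero_sub,
    ← mul_neg, neg_sub]

lemma norm_lineTerm_le_inv_sq {k : ℕ} (hk : 2 ≤ k) {p q t δ : ℝ} (hp : 1 / 12 ≤ p ^ 2)
    (hq : 1 / 12 ≤ q ^ 2) (hδ : 0 < δ) (ht : δ < |t|) : ((p ^ 2 + t ^ 2 * q ^ 2) ^ k)⁻¹ ≤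
      12 ^ (k - 2) * (1 + (δ ^ 2)⁻¹) * (q ^ 2 * p ^ 2)⁻¹ * (1 + t ^ 2)⁻¹ := by
  set X := p ^ 2 + t ^ 2 * q ^ 2 with hX
  have ht2 : δ ^ 2 < t ^ 2 := by
    rw [← sq_abs t]
    gcongr
  have ht0 : 0 < t ^ 2 := (by positivity : 0 < δ ^ 2).trans ht2
  have hXp : 1 / 12 ≤ X := by nlinarith [mul_nonneg ht0.le (sq_nonneg q)]
  have h1 : X ^ k = X ^ (k - 2) * X ^ 2 := by
    rw [← pow_add]
    congr 1
    omega
  have h2 : p ^ 2 * (t ^ 2 * q ^ 2) ≤ X ^ 2 := by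
    nlinarith [sq_nonneg p, mul_nonneg ht0.le (sq_nonneg q), sq_nonneg (p ^ 2 - t ^ 2 * q ^ 2)]
  have h3 : (1 + t ^ 2) ≤ (1 + (δ ^ 2)⁻¹) * t ^ 2 := by
    have : 1 ≤ (δ ^ 2)⁻¹ * t ^ 2 := by
      rw [← div_eq_inv_mul, le_div_iff₀ (by positivity)]
      linarith
    linarith
  have hp0 : 0 < p ^ 2 := by linarith
  have hq0 : 0 < q ^ 2 := by linarith
  have h4 : (t ^ 2)⁻¹ ≤ (1 + (δ ^ 2)⁻¹) * (1 + t ^ 2)⁻¹ := by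
    rw [← div_eq_mul_inv, le_div_iff₀ (by positivity), ← div_eq_inv_mul, div_le_iff₀ ht0]
    exact h3
  calc (X ^ k)⁻¹ ≤ ((1 / 12) ^ (k - 2) * (p ^ 2 * (t ^ 2 * q ^ 2)))⁻¹ := by
        rw [h1]
        gcongr
    _ = 12 ^ (k - 2) * (q ^ 2 * p ^ 2)⁻¹ * (t ^ 2)⁻¹ := by
        rw [mul_inv, ← inv_pow]
        norm_num [mul_inv]
        ring
    _ ≤ 12 ^ (k - 2) * (q ^ 2 * p ^ 2)⁻¹ * ((1 + (δ ^ 2)⁻¹) * (1 + t ^ 2)⁻¹) := by gcongr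
    _ = _ := by ring

lemma hasSum_truncated_lineKernel {k : ℕ} (hk : 2 ≤ k) {τ : ℍ} (hτ : (τ : ℂ) ∈ goodSet)
    (hre : |(τ : ℂ).re| ≤ 1 / 2) (him : 1 / 2 ≤ (τ : ℂ).im) {δ : ℝ} (hδ : 0 < δ) :
    HasSum (fun M : SL(2, ℤ) => (Complex.I * (2 * k - 1 : ℕ) * de M τ)⁻¹ *
        ((nu M τ - Complex.I * (-δ : ℝ) * de M τ)⁻¹ ^ (2 * k - 1) -
          (nu M τ - Complex.I * δ * de M τ)⁻¹ ^ (2 * k - 1)))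
      (∫ t in Set.Ioi δ, (lineKernel k τ t + lineKernel k τ (-t))) := by
  obtain ⟨c, hc, hsep⟩ := exists_line_separation hτ
  have hnu : ∀ M, nu M (τ : ℂ) ≠ 0 := fun M => nu_ne_zero M τ.im_pos.ne'
  have hde : ∀ M, de M (τ : ℂ) ≠ 0 := fun M => de_ne_zero M τ.im_pos.ne'
  set C : ℝ := (c ^ k)⁻¹ * (12 ^ (k - 2) * (1 + (δ ^ 2)⁻¹))
  have hb : ∀ (M : SL(2, ℤ)) (t : ℝ), δ < |t| → ‖lineTerm k τ M t‖ ≤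
      C * (‖de M (τ : ℂ)‖ ^ 2 * ‖nu M (τ : ℂ)‖ ^ 2)⁻¹ * (1 + t ^ 2)⁻¹ := by
    intro M t ht
    obtain ⟨h1, h2⟩ := norm_forms_of_strip M hre him
    refine (norm_lineTerm_le (k := k) hc (hnu M) (hsep M t)).trans ?_
    refine (mul_le_mul_of_nonneg_left (norm_lineTerm_le_inv_sq hk h1 h2 hδ ht)
      (by positivity)).trans (le_of_eq ?_)
    simp only [C]
    ring
  set f : SL(2, ℤ) → ℝ → ℂ := fun M t => lineTerm k τ M t + lineTerm k τ M (-t) with hf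
  have hbf : ∀ M, ∀ t ∈ Set.Ioi δ, ‖f M t‖ ≤
      2 * C * (‖de M (τ : ℂ)‖ ^ 2 * ‖nu M (τ : ℂ)‖ ^ 2)⁻¹ * (1 + t ^ 2)⁻¹ := by
    intro M t ht
    have ht0 : δ < |t| := lt_of_lt_of_le ht (le_abs_self t)
    have h1 := hb M t ht0
    have h2 := hb M (-t) (by rwa [abs_neg])
    rw [neg_sq] at h2
    refine (norm_add_le _ _).trans ?_
    linarith
  have hcont : ∀ M, Continuous (f M) := fun M => by
    have h1 : ∀ t : ℝ, (nu M (τ : ℂ) - Complex.I * t * de M τ) ^ (2 * k) ≠ 0 := fun t =>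
      pow_ne_zero _ (lineForm_ne_zero hτ M t)
    have h2 : Continuous (lineTerm k τ M) := by
      unfold lineTerm
      fun_prop (disch := assumption)
    exact h2.add (h2.comp continuous_neg)
  have hint : ∀ M, IntegrableOn (f M) (Set.Ioi δ) := fun M =>
    (integrable_inv_one_add_sq.const_mul _).integrableOn.mono' (hcont M).aestronglyMeasurable
      (ae_restrict_of_forall_mem measurableSet_Ioi (hbf M))
  have hnorm : Summable fun M : SL(2, ℤ) => ∫ t in Set.Ioi δ, ‖f M t‖ := by
    refine Summable.of_nonneg_of_le (fun M => integral_nonneg fun t => norm_nonneg _) (fun M => ?_)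
      (((summable_inv_forms hre him).mul_left (2 * C)).mul_right (∫ t in Set.Ioi δ, (1 + t ^ 2)⁻¹))
    rw [← integral_const_mul]
    exact setIntegral_mono_on (hint M).norm
      (integrable_inv_one_add_sq.const_mul _).integrableOn measurableSet_Ioi (hbf M)
  have key := hasSum_integral_of_summable_integral_norm hint hnorm
  have hsum : ∀ t, δ < |t| → Summable fun M => lineTerm k τ M t := fun t ht =>
    Summable.of_norm_bounded (((summable_inv_forms hre him).mul_left C).mul_right (1 + t ^ 2)⁻¹)
      fun M => hb M t ht
  have e1 : ∫ t in Set.Ioi δ, ∑' M, f M t =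
      ∫ t in Set.Ioi δ, (lineKernel k τ t + lineKernel k τ (-t)) := by
    refine setIntegral_congr_fun measurableSet_Ioi fun t ht => ?_
    have ht0 : δ < |t| := lt_of_lt_of_le ht (le_abs_self t)
    simp only [hf, lineKernel_eq_tsum]
    exact (hsum t ht0).tsum_add (hsum (-t) (by rwa [abs_neg]))
  rw [e1] at key
  refine key.congr_fun fun M => ?_
  exact (integral_Ioi_line (hde M) (lineForm_ne_zero hτ M) hk δ (hint M)).symm

lemma truncated_term_eq {k : ℕ} (hk : 2 ≤ k) {ν d : ℂ} (hν : ν ≠ 0) (hd : d ≠ 0) {δ : ℝ}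
    (h : |((δ : ℂ) * (ν / d)).im| ≤ 1 / 2) :
    (Complex.I * (2 * k - 1 : ℕ) * ν)⁻¹ * ((-d - Complex.I * (-δ : ℝ) * ν)⁻¹ ^ (2 * k - 1) -
      (-d - Complex.I * δ * ν)⁻¹ ^ (2 * k - 1)) = (Complex.I * (2 * k - 1 : ℕ))⁻¹ *
        ((d ^ (2 * k))⁻¹ * (δ * powerQuotient (2 * k - 1) (δ * (ν / d)))) := by
  have h1 := one_add_ne_zero_of_im h
  have h2 := one_sub_ne_zero_of_im h
  have h3 := mul_powerQuotient (2 * k - 1) h1 h2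
  have hodd : Odd (2 * k - 1) := ⟨k - 1, by omega⟩
  have e1 : (-d - Complex.I * (-δ : ℝ) * ν)⁻¹ = -(d⁻¹ * (1 - Complex.I * (δ * (ν / d)))⁻¹) := by
    rw [← mul_inv, ← inv_neg]
    congr 1
    push_cast
    field_simp
    ring
  have e2 : (-d - Complex.I * δ * ν)⁻¹ = -(d⁻¹ * (1 + Complex.I * (δ * (ν / d)))⁻¹) := by
    rw [← mul_inv, ← inv_neg]
    congr 1
    field_simp
    ring
  have e3 : δ * powerQuotient (2 * k - 1) (δ * (ν / d)) = d / ν *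
      ((1 + Complex.I * (δ * (ν / d)))⁻¹ ^ (2 * k - 1) -
        (1 - Complex.I * (δ * (ν / d)))⁻¹ ^ (2 * k - 1)) := by
    rw [← h3]
    field_simp
  have e4 : (d ^ (2 * k))⁻¹ * d = (d⁻¹) ^ (2 * k - 1) := by
    obtain ⟨r, hr, hr'⟩ : ∃ r, 2 * k = r + 1 ∧ 2 * k - 1 = r := ⟨2 * k - 1, by omega, rfl⟩
    rw [hr', hr, pow_succ, inv_pow]
    field_simp
  rw [e1, e2, e3, hodd.neg_pow, hodd.neg_pow, mul_pow, mul_pow, ← e4, mul_inv]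
  ring

lemma div_cosetRep (v : EisensteinSeries.gammaSet 1 1 0) (m : ℤ) (τ : ℍ) :
    nu (cosetEquiv (v, m)) τ / de (cosetEquiv (v, m)) τ =
      nu (cosetRep v) τ / de (cosetRep v) τ + m := by
  change nu (ModularGroup.T ^ m * cosetRep v) τ / de (ModularGroup.T ^ m * cosetRep v) τ = _
  have := de_ne_zero (cosetRep v) τ.im_pos.ne'
  rw [nu_T_zpow_mul, de_T_zpow_mul]
  field_simp

lemma abs_im_div_le {τ : ℍ} (hre : |(τ : ℂ).re| ≤ 1 / 2) (him : 1 / 2 ≤ (τ : ℂ).im)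
    (M : SL(2, ℤ)) : |(nu M τ / de M τ).im| ≤ 12 * (τ : ℂ).im := by
  obtain ⟨-, h2⟩ := norm_forms_of_strip M hre him
  rw [← coe_smul_eq, UpperHalfPlane.coe_im, abs_of_pos (M • τ).im_pos,
    ModularGroup.im_smul_eq_div_normSq, denom_eq_de, ← Complex.sq_norm,
    div_le_iff₀ (by linarith), UpperHalfPlane.coe_im]
  nlinarith [τ.im_pos]

lemma hasSum_truncated_cosets {k : ℕ} (hk : 2 ≤ k) {τ : ℍ} (hτ : (τ : ℂ) ∈ goodSet)
    (hre : |(τ : ℂ).re| ≤ 1 / 2) (him : 1 / 2 ≤ (τ : ℂ).im) {δ : ℝ} (hδ : 0 < δ)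
    (hδτ : δ * (12 * (τ : ℂ).im) ≤ 1 / 2) :
    HasSum (fun p : EisensteinSeries.gammaSet 1 1 0 × ℤ => (Complex.I * (2 * k - 1 : ℕ))⁻¹ *
      ((de (cosetRep p.1) τ ^ (2 * k))⁻¹ * (δ * powerQuotient (2 * k - 1)
        (δ * (nu (cosetRep p.1) τ / de (cosetRep p.1) τ + p.2)))))
      (∫ t in Set.Ioi δ, (lineKernel k τ t + lineKernel k τ (-t))) := by
  have h1 := (cosetEquiv.trans (Equiv.mulLeft ModularGroup.S)).hasSum_iff.mpr
    (hasSum_truncated_lineKernel hk hτ hre him hδ)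
  refine (congrArg (fun F => HasSum F _) (funext fun p => ?_)).mp h1
  obtain ⟨v, m⟩ := p
  set M := cosetEquiv (v, m) with hM
  have h4 : |((δ : ℂ) * (nu M (τ : ℂ) / de M (τ : ℂ))).im| ≤ 1 / 2 := by
    rw [Complex.im_ofReal_mul, abs_mul, abs_of_pos hδ]
    exact (mul_le_mul_of_nonneg_left (abs_im_div_le hre him M) hδ.le).trans hδτ
  have h5 := truncated_term_eq hk (nu_ne_zero M τ.im_pos.ne') (de_ne_zero M τ.im_pos.ne') h4
  have e1 : de M (τ : ℂ) = de (cosetRep v) τ := de_T_zpow_mul m (cosetRep v) τ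
  have e2 : nu M (τ : ℂ) / de M τ = nu (cosetRep v) τ / de (cosetRep v) τ + m :=
    div_cosetRep v m τ
  rw [e2, e1] at h5
  rw [Function.comp_apply, Equiv.trans_apply, ← hM, Equiv.coe_mulLeft, nu_S_mul, de_S_mul, e1]
  exact h5

lemma hasSum_eisenstein_limit {k : ℕ} (hk : 2 ≤ k) (τ : ℍ) :
    HasSum (fun v => (Complex.I * (2 * k - 1 : ℕ))⁻¹ *
      ((de (cosetRep v) τ ^ (2 * k))⁻¹ * (2 * Complex.I * Real.pi)))
      (4 * Real.pi / (2 * k - 1 : ℕ) * ModularForm.E (three_le_two_mul hk) τ) := by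
  have h7 := ((hasSum_inv_de hk τ).mul_right (2 * Complex.I * Real.pi)).mul_left
    (Complex.I * (2 * k - 1 : ℕ))⁻¹
  refine (congrArg (HasSum _) ?_).mp h7
  have h0 : ((2 * k - 1 : ℕ) : ℂ) ≠ 0 := Nat.cast_ne_zero.mpr (by omega)
  have hI := Complex.I_ne_zero
  generalize ModularForm.E (three_le_two_mul hk) τ = e
  field_simp
  ring

theorem exists_norm_truncated_add_eisenstein_le {k : ℕ} (hk : 2 ≤ k) {τ : ℍ}
    (hτ : (τ : ℂ) ∈ goodSet) (hre : |(τ : ℂ).re| ≤ 1 / 2) (him : 1 / 2 ≤ (τ : ℂ).im) :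
    ∃ K : ℝ, ∀ δ : ℝ, 0 < δ → δ * (12 * (τ : ℂ).im) ≤ 1 / 2 →
      ‖(∫ t in Set.Ioi δ, (lineKernel k τ t + lineKernel k τ (-t))) +
        4 * Real.pi / (2 * k - 1 : ℕ) * ModularForm.E (three_le_two_mul hk) τ‖ ≤ K * δ := by
  obtain ⟨C, hC, hbound⟩ := exists_riemannSum_bound (r := 2 * k - 1) (by omega)
  set Y : ℝ := 12 * (τ : ℂ).im with hY
  set a : ℂ := (Complex.I * (2 * k - 1 : ℕ))⁻¹ with ha
  set D : EisensteinSeries.gammaSet 1 1 0 → ℂ := fun v => (de (cosetRep v) τ ^ (2 * k))⁻¹ with hD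
  have hDsum : Summable fun v => ‖D v‖ := summable_norm_inv_de hk τ
  refine ⟨‖a‖ * ((∑' v, ‖D v‖) * (C * (1 + Y))), fun δ hδ hδY => ?_⟩
  set W : EisensteinSeries.gammaSet 1 1 0 → ℂ := fun v => nu (cosetRep v) τ / de (cosetRep v) τ
  have hW : ∀ v, |(W v).im| ≤ Y := fun v => abs_im_div_le hre him (cosetRep v)
  have hδW : ∀ v, δ * |(W v).im| ≤ 1 / 2 := fun v =>
    (mul_le_mul_of_nonneg_left (hW v) hδ.le).trans hδY
  set S : EisensteinSeries.gammaSet 1 1 0 → ℂ := fun v =>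
    ∑' m : ℤ, δ * powerQuotient (2 * k - 1) (δ * (W v + m)) with hS
  have h2 : ∀ v, HasSum (fun m : ℤ => a * (D v * (δ * powerQuotient (2 * k - 1) (δ * (W v + m)))))
      (a * (D v * S v)) := fun v =>
    (((hbound _ δ hδ (hδW v)).1.hasSum).mul_left (D v)).mul_left a
  have h3 := (hasSum_truncated_cosets hk hτ hre him hδ hδY).prod_fiberwise h2
  have h8 := h3.add (hasSum_eisenstein_limit hk τ)
  have h9 : ∀ v, ‖a * (D v * S v) + a * (D v * (2 * Complex.I * Real.pi))‖ ≤
      ‖a‖ * (‖D v‖ * (C * (1 + Y))) * δ := fun v => by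
    rw [← mul_add, ← mul_add, norm_mul, norm_mul,
      show ‖a‖ * (‖D v‖ * (C * (1 + Y))) * δ = ‖a‖ * (‖D v‖ * (C * δ * (1 + Y))) by ring]
    have h11 : C * δ * (1 + |(W v).im|) ≤ C * δ * (1 + Y) := by
      gcongr
      exact hW v
    have h12 := (hbound _ δ hδ (hδW v)).2.trans h11
    gcongr
  have h10 := h8.norm_le_of_bounded (((hDsum.hasSum.mul_right (C * (1 + Y))).mul_left ‖a‖).mul_right δ) h9
  exact h10

theorem integral_lineKernel_zero {k : ℕ} (hk : 2 ≤ k) {τ : ℍ}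
    (hτ : (τ : ℂ) ∈ goodSet) (hre : |(τ : ℂ).re| ≤ 1 / 2) (him : 1 / 2 ≤ (τ : ℂ).im) :
    ∫ t : ℝ, lineKernel k τ t * (t : ℂ) ^ 0 =
      -(4 * Real.pi / (2 * k - 1 : ℕ) * ModularForm.E (three_le_two_mul hk) τ) := by
  set e : ℂ := 4 * Real.pi / (2 * k - 1 : ℕ) * ModularForm.E (three_le_two_mul hk) τ with he
  have hint : Integrable fun t : ℝ => lineKernel k τ t := by
    simpa using integrable_lineKernel hk (Nat.zero_le _) hτ
  have hint' : Integrable fun t : ℝ => lineKernel k τ t + lineKernel k τ (-t) :=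
    hint.add hint.comp_neg
  have e1 : ∫ t : ℝ, lineKernel k τ t * (t : ℂ) ^ 0 =
      ∫ t in Set.Ioi (0 : ℝ), (lineKernel k τ t + lineKernel k τ (-t)) := by
    simp only [pow_zero, mul_one]
    rw [integral_add hint.integrableOn hint.comp_neg.integrableOn,
      ← integral_add_compl measurableSet_Ioi hint, Set.compl_Ioi]
    congr 1
    simp
  have h1 : Tendsto (fun δ : ℝ => ∫ t in Set.Ioi δ, (lineKernel k τ t + lineKernel k τ (-t)))
      (𝓝[>] 0) (𝓝 (∫ t in Set.Ioi (0 : ℝ), (lineKernel k τ t + lineKernel k τ (-t)))) :=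
    (IntegrableOn.continuousWithinAt_Ici_primitive_Ioi hint'.integrableOn).mono_left
      (nhdsWithin_mono _ Set.Ioi_subset_Ici_self)
  obtain ⟨K, hK⟩ := exists_norm_truncated_add_eisenstein_le hk hτ hre him
  have h2 : Tendsto (fun δ : ℝ => (∫ t in Set.Ioi δ, (lineKernel k τ t + lineKernel k τ (-t))) + e)
      (𝓝[>] 0) (𝓝 0) := by
    have h3 : Tendsto (fun δ : ℝ => K * δ) (𝓝[>] 0) (𝓝 0) :=
      ((continuous_const_mul K).tendsto' 0 0 (by simp)).mono_left nhdsWithin_le_nhds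
    refine squeeze_zero_norm' ?_ h3
    have h4 : Tendsto (fun δ : ℝ => δ * (12 * (τ : ℂ).im)) (𝓝[>] 0) (𝓝 0) :=
      ((continuous_mul_const _).tendsto' 0 0 (by simp)).mono_left nhdsWithin_le_nhds
    filter_upwards [self_mem_nhdsWithin, h4.eventually_le_const (by norm_num : (0 : ℝ) < 1 / 2)]
      with δ hδ hδ' using hK δ hδ hδ'
  rw [e1]
  exact eq_neg_of_add_eq_zero_left (tendsto_nhds_unique (h1.add_const e) h2)

/-! ### All moments along the imaginary line -/

theorem kernelMoment_top {k : ℕ} (hk : 2 ≤ k) (a : ℂ) :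
    kernelMoment k (2 * k - 2) a = (-1) ^ k * kernelMoment k 0 a := by
  rw [kernelMoment, kernelMoment, ← integral_comp_rpow_Ioi
    (fun y : ℝ => kernelSeries k (Complex.I * y) a * (y : ℂ) ^ 0) (by norm_num : (-1 : ℝ) ≠ 0), ← integral_const_mul]
  refine setIntegral_congr_fun measurableSet_Ioi fun y hy => ?_
  have hy0 : (0 : ℝ) < y := hy
  have hyc : (y : ℂ) ≠ 0 := Complex.ofReal_ne_zero.mpr hy0.ne'
  have h1 := kernelSeries_inv k (I_mul_ne_zero hy0) a
  rw [neg_inv_I_mul] at h1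
  have h2 : ((y ^ ((-1 : ℝ) - 1) : ℝ) : ℂ) = ((y : ℂ) ^ 2)⁻¹ := by
    rw [show (-1 : ℝ) - 1 = -(2 : ℕ) by norm_num, Real.rpow_neg hy0.le, Real.rpow_natCast]
    push_cast
    rfl
  have h3 : (Complex.I * (y : ℂ)) ^ (2 * k) = (-1) ^ k * (y : ℂ) ^ (2 * k) := by
    rw [mul_pow, pow_mul, Complex.I_sq]
  have h4 : (y : ℂ) ^ (2 * k) = (y : ℂ) ^ (2 * k - 2) * (y : ℂ) ^ 2 := by
    rw [← pow_add]
    congr 1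
    omega
  have h5 : ((-1 : ℂ) ^ k) ≠ 0 := pow_ne_zero _ (by norm_num)
  simp only [pow_zero, mul_one, Real.rpow_neg_one, abs_neg, abs_one, one_mul, Complex.real_smul]
  rw [h1, h2, h3, h4]
  field_simp
  rw [← pow_mul, mul_comm k 2, pow_mul, neg_one_sq, one_pow, one_mul]

/-- The moment of the kernel series along the whole imaginary line. -/
def lineMoment (k n : ℕ) (τ : ℂ) : ℂ := kernelMoment k n τ + (-1) ^ n * dualMoment k n τ

lemma lineMoment_smul (k n : ℕ) (γ : SL(2, ℤ)) (τ : ℍ) :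
    lineMoment k n (γ • τ : ℍ) = de γ τ ^ (2 * k) * lineMoment k n τ := by
  rw [lineMoment, dualMoment_smul, coe_smul_eq, kernelMoment_moebius k n γ τ
    (de_ne_zero γ τ.im_pos.ne'), lineMoment]
  ring

lemma lineMoment_top {k : ℕ} (hk : 2 ≤ k) (τ : ℂ) :
    lineMoment k (2 * k - 2) τ = (-1) ^ k * lineMoment k 0 τ := by
  have h : Even (2 * k - 2) := ⟨k - 1, by omega⟩
  simp only [lineMoment, dualMoment, kernelMoment_top hk, map_mul, map_pow, map_neg, map_one,
    h.neg_one_pow]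
  ring

lemma eisenstein_smul {k : ℕ} (hk : 2 ≤ k) (γ : SL(2, ℤ)) (τ : ℍ) :
    ModularForm.E (three_le_two_mul hk) (γ • τ) =
      de γ τ ^ (2 * k) * ModularForm.E (three_le_two_mul hk) τ := by
  have hmem : (Matrix.SpecialLinearGroup.mapGL ℝ γ : GL (Fin 2) ℝ) ∈ 𝒮ℒ := ⟨γ, rfl⟩
  have h := SlashInvariantForm.slash_action_eqn'' (ModularForm.E (three_le_two_mul hk)) hmem τ
  rw [zpow_natCast] at h
  rw [← denom_eq_de γ τ]
  exact h

lemma smul_mem_goodSet {τ : ℍ} (hτ : (τ : ℂ) ∈ goodSet) (γ : SL(2, ℤ)) :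
    ((γ • τ : ℍ) : ℂ) ∈ goodSet := by
  rw [← not_mem_exceptionalSet_iff] at hτ ⊢
  intro h
  obtain ⟨M, w, hw, h2⟩ := Set.mem_iUnion.mp h
  exact hτ (Set.mem_iUnion.mpr ⟨γ⁻¹ * M, w, hw, by
    simp only at h2 ⊢
    rw [mul_smul, h2, inv_smul_smul]⟩)

lemma lineMoment_of_mem_fd {k n : ℕ} (hk : 2 ≤ k) (hn : n ≤ 2 * k - 2) {τ : ℍ}
    (hτ : (τ : ℂ) ∈ goodSet) (hfd : τ ∈ ModularGroup.fd) : lineMoment k n τ =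
      -(((if n = 0 then 1 else 0) + (-1) ^ k * (if n = 2 * k - 2 then 1 else 0)) *
        (4 * Real.pi / (2 * k - 1 : ℕ) * ModularForm.E (three_le_two_mul hk) τ)) := by
  have hre := abs_re_le_of_mem_fd hfd
  have him : 1 / 2 ≤ (τ : ℂ).im := half_le_im_of_mem_fd hfd
  have h0 : lineMoment k 0 τ =
      -(4 * Real.pi / (2 * k - 1 : ℕ) * ModularForm.E (three_le_two_mul hk) τ) :=
    (kernelMoment_add_conj hk (Nat.zero_le _) hτ).trans (integral_lineKernel_zero hk hτ hre him)
  rcases Nat.eq_zero_or_pos n with rfl | hn0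
  · rw [h0, if_pos rfl, if_neg (by omega)]
    ring
  rcases hn.eq_or_lt with rfl | hlt
  · rw [lineMoment_top hk, h0, if_pos rfl, if_neg (by omega)]
    ring
  · rw [if_neg hn0.ne', if_neg hlt.ne]
    refine (kernelMoment_add_conj hk hn hτ).trans ?_
    rw [integral_lineKernel_inner hn0 hlt hτ hre him]
    ring

theorem lineMoment_eq {k n : ℕ} (hk : 2 ≤ k) (hn : n ≤ 2 * k - 2) {τ : ℍ}
    (hτ : (τ : ℂ) ∈ goodSet) : lineMoment k n τ =
      -(((if n = 0 then 1 else 0) + (-1) ^ k * (if n = 2 * k - 2 then 1 else 0)) *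
        (4 * Real.pi / (2 * k - 1 : ℕ) * ModularForm.E (three_le_two_mul hk) τ)) := by
  obtain ⟨γ, hγ⟩ := ModularGroup.exists_smul_mem_fd τ
  have h := lineMoment_of_mem_fd hk hn (smul_mem_goodSet hτ γ) hγ
  rw [lineMoment_smul, eisenstein_smul hk] at h
  have hd : de γ (τ : ℂ) ^ (2 * k) ≠ 0 := pow_ne_zero _ (de_ne_zero γ τ.im_pos.ne')
  refine mul_left_cancel₀ hd (h.trans ?_)
  ring

theorem dOp_iterate_curlyH_eq {k n : ℕ} (hk : 2 ≤ k) (hn : n ≤ 2 * k - 2) {τ : ℍ}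
    (hτ : (τ : ℂ) ∈ goodSet) : (dOp^[2 * k - 1]) (curlyH k n) τ =
      (-1) ^ (n + 1) * (((2 * k - 2).factorial : ℂ) / (4 * (Real.pi : ℂ)) ^ (2 * k - 1)) *
        periodCuspForm hk hn τ
      - ((-1) ^ k * (if n = 0 then 1 else 0) + (if n = 2 * k - 2 then 1 else 0))
        * (((2 * k - 2).factorial : ℂ) / (2 * (Real.pi : ℂ)) ^ (2 * k - 1))
        * ModularForm.E (three_le_two_mul hk) τ := by
  have h1 : kernelMoment k n τ = lineMoment k n τ - (-1) ^ n * dualMoment k n τ := by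
    rw [lineMoment]
    ring
  rw [dOp_iterate_curlyH_top hk hn hτ, h1, lineMoment_eq hk hn hτ, periodCuspForm_apply,
    periodScale]
  change _ = _ * (_ * dualMoment k n τ) - _
  generalize dualMoment k n τ = X
  generalize ModularForm.E (three_le_two_mul hk) τ = e
  generalize (if n = 0 then (1 : ℂ) else 0) = a
  generalize (if n = 2 * k - 2 then (1 : ℂ) else 0) = b
  obtain ⟨m, rfl⟩ : ∃ m, k = m + 1 := ⟨k - 1, by omega⟩
  rw [show 2 * (m + 1) - 1 = 2 * m + 1 by omega, show 2 * (m + 1) - 2 = 2 * m by omega,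
    Nat.add_sub_cancel, Nat.factorial_succ]
  have hpi : (Real.pi : ℂ) ≠ 0 := Complex.ofReal_ne_zero.mpr Real.pi_ne_zero
  have hm : (2 * (m : ℂ) + 1) ≠ 0 := by exact_mod_cast (by omega : 2 * m + 1 ≠ 0)
  have hs : ((-1 : ℂ) ^ m) * (-1) ^ m = 1 := by rw [← mul_pow]; norm_num
  have hI := Complex.I_ne_zero
  have hI2 : Complex.I ^ (2 * m) = (-1) ^ m := by rw [pow_mul, Complex.I_sq]
  push_cast
  rw [show (-4 : ℂ) = -1 * 4 by norm_num, mul_pow (-1 : ℂ) 4, one_div, inv_pow, mul_pow _ Complex.I,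
    pow_succ Complex.I, hI2, mul_pow, mul_pow 4, pow_succ (2 : ℂ), pow_succ (4 : ℂ), pow_mul (2 : ℂ),
    show (2 : ℂ) ^ 2 = 4 by norm_num, mul_comm 2 m, pow_mul (4 : ℂ), pow_succ (-1 : ℂ) m]
  set s : ℂ := (-1) ^ m with hs'
  have hs0 : s ≠ 0 := left_ne_zero_of_mul_eq_one hs
  have h4 : (4 : ℂ) ^ m ≠ 0 := pow_ne_zero _ (by norm_num)
  have hII := Complex.I_sq
  field_simp
  rw [hII, pow_succ]
  linear_combination (((m * 2).factorial : ℂ) * (2 * m + 1) * (-1) ^ n * X +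
    4 * Real.pi * e * a * (m * 2).factorial) * hs

end PeriodMaass

end

theorem proposition1p1 (k n : ℕ) (hk : 2 ≤ k) (hn : n ≤ 2 * k - 2) :
    ∃ R : CuspForm 𝒮ℒ (2 * (k : ℤ)),
      PeriodMaass.RepresentsPeriod k n R ∧
      (∀ R' : CuspForm 𝒮ℒ (2 * (k : ℤ)), PeriodMaass.RepresentsPeriod k n R' → R' = R) ∧
      ∀ τ : ℍ, τ ∉ PeriodMaass.exceptionalSet →
        (∀ y : ℝ, 0 < y → Summable (fun M : SL(2, ℤ) =>
          PeriodMaass.poincareTerm (k : ℤ) ((k : ℤ) - 1) (PeriodMaass.imPoint y) τ M)) ∧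
        MeasureTheory.IntegrableOn (PeriodMaass.curlyHIntegrand k n τ) (Set.Ioi 0) ∧
        ContDiffAt ℝ ∞ (PeriodMaass.curlyH k n ∘ UpperHalfPlane.ofComplex) (τ : ℂ) ∧
        PeriodMaass.xiOp (2 - 2 * (k : ℤ)) (PeriodMaass.curlyH k n) τ = -R τ ∧
        (PeriodMaass.dOp^[2 * k - 1]) (PeriodMaass.curlyH k n) τ =
          (-1) ^ (n + 1) * (((2 * k - 2).factorial : ℂ) / (4 * (Real.pi : ℂ)) ^ (2 * k - 1)) * R τ
          - ((-1) ^ k * (if n = 0 then 1 else 0) + (if n = 2 * k - 2 then 1 else 0))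
            * (((2 * k - 2).factorial : ℂ) / (2 * (Real.pi : ℂ)) ^ (2 * k - 1))
            * ModularForm.E (k := 2 * k) (by omega) τ := by
  refine ⟨PeriodMaass.periodCuspForm hk hn, PeriodMaass.representsPeriod_periodCuspForm hk hn,
    fun R' h => PeriodMaass.representsPeriod_unique
      (PeriodMaass.representsPeriod_periodCuspForm hk hn) h, fun τ hτ => ?_⟩
  have hgood := (PeriodMaass.not_mem_exceptionalSet_iff τ).mp hτ
  exact ⟨fun y hy => (PeriodMaass.hasSum_poincareTerm hk hgood hy).summable,
    PeriodMaass.integrableOn_curlyHIntegrand hk hn hgood,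
    PeriodMaass.contDiffAt_curlyH hk hn hgood,
    PeriodMaass.xiOp_curlyH hk hn hgood,
    PeriodMaass.dOp_iterate_curlyH_eq hk hn hgood⟩
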